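/- **Conventions.** All vector spaces are complex. A *bornological vector space* is a vector space with a convex vector bornology; its bounded sets are called small. It is *complete* if every small set is contained in a small disk $T$ whose span, normed by the Minkowski functional of $T$, is a Banach space. All spaces below are complete; "isomorphism" means bornological isomorphism (linear bijection, bounded in both directions). $\mathrm{Hom}(V,W)$ is the space of bounded linear maps with the equibounded bornology, and $V\hat\otimes W$ is the completed bornological tensor product, universal for bounded bilinear maps from $V\times W$ to complete spaces. $V$ has the *approximation property* if for every compact disk $S\subset V$ (that is, a disk $S$ which is compact in the Banach space spanned by some small disk) there is a sequence of finite rank operators on $V$ converging to the identity in $\mathrm{Hom}(\langle S\rangle,V)$. A *bornological algebra* $H$ is a complete bornological vector space with an associative, not necessarily unital, bounded bilinear multiplication $\mu$. For a right $H$-module $M$ and a left $H$-module $N$, $M\hat\otimes_H N$ is the quotient of $M\hat\otimes N$ by the closed subspace generated by all $mh\otimes n-m\otimes hn$. $H$ is *essential* if $H\neq 0$ and $\mu$ induces an isomorphism $H\hat\otimes_H H\cong H$. The multiplier algebra $M(H)$ consists of the pairs $(L,R)$ of bounded linear maps $H\to H$ with $L(xy)=L(x)y$, $R(xy)=xR(y)$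 and $xL(y)=R(x)y$; for $m=(L,R)$ one writes $mx=L(x)$, $xm=R(x)$. A bounded homomorphism $f:H\to M(K)$ is *essential* if it induces isomorphisms $H\hat\otimes_H K\cong K\cong K\hat\otimes_H H$. It then has a unique extension to a unital homomorphism $M(H)\to M(K)$, again denoted by $f$. Essential homomorphisms $f_i:H_i\to M(K_i)$ of essential algebras $H_i$ ($i=1,2$) induce an essential homomorphism $f_1\hat\otimes f_2:H_1\hat\otimes H_2\to M(K_1\hat\otimes K_2)$. Likewise an antiautomorphism $S$ of $H$ extends to $M(H)$ by $S(m)S(x)=S(xm)$, $S(x)S(m)=S(mx)$. Note that $M(\mathbb C)=\mathbb C$. A *bornological quantum group* is an essential bornological algebra $H$ with the approximation property, together with * an essential homomorphism $\Delta:H\to M(H\hat\otimes H)$ with $(\Delta\hat\otimes\mathrm{id})\Delta=(\mathrm{id}\hat\otimes\Delta)\Delta$, such that the four Galois maps $$\gamma_l(f\otimes g)=\Delta(f)(g\otimes 1),\quad \gamma_r(f\otimes g)=\Delta(f)(1\otimes g),\quad \rho_l(f\otimes g)=(f\otimes 1)\Delta(g),\quad \rho_r(f\otimes g)=(1\otimes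 f)\Delta(g)$$ are isomorphisms of $H\hat\otimes H$ onto itself; * a bounded linear functional $\phi:H\to\mathbb C$ which is faithful (if $\phi(fg)=0$ for all $g$ then $f=0$; if $\phi(fg)=0$ for all $f$ then $g=0$) and left invariant: $(\mathrm{id}\hat\otimes\phi)\Delta(f)=\phi(f)1$ in $M(H)$ for all $f\in H$. Here, for a bounded functional $\omega$, the multiplier $(\mathrm{id}\hat\otimes\omega)\Delta(f)$ is given by $(\mathrm{id}\hat\otimes\omega)\Delta(f)\cdot g=(\mathrm{id}\hat\otimes\omega)\gamma_l(f\otimes g)$ and $g\cdot(\mathrm{id}\hat\otimes\omega)\Delta(f)=(\mathrm{id}\hat\otimes\omega)\rho_l(g\otimes f)$, and $(\omega\hat\otimes\mathrm{id})\Delta(f)$ is given in the same way by $(\omega\hat\otimes\mathrm{id})\gamma_r(f\otimes g)$ and $(\omega\hat\otimes\mathrm{id})\rho_r(g\otimes f)$. A *morphism* from a bornological quantum group $H$ to a bornological quantum group $K$ is an essential homomorphism $\alpha:H\to M(K)$ with $(\alpha\hat\otimes\alpha)\Delta_H=\Delta_K\alpha$. A *counit and antipode* of $H$ are an essential homomorphism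 $\epsilon:H\to\mathbb C$ and an isomorphism $S:H\to H$ that is an algebra antihomomorphism and a coalgebra antihomomorphism ($\Delta S=(S\hat\otimes S)\tau\Delta$, where $\tau$ is the flip), such that $$(\epsilon\hat\otimes\mathrm{id})\Delta=\mathrm{id}=(\mathrm{id}\hat\otimes\epsilon)\Delta,\qquad \mu(S\hat\otimes\mathrm{id})\gamma_r=\epsilon\hat\otimes\mathrm{id},\qquad \mu(\mathrm{id}\hat\otimes S)\rho_l=\mathrm{id}\hat\otimes\epsilon .$$ **Proposition.** Let $\alpha:H\to M(K)$ be a morphism of bornological quantum groups. Then $H$ and $K$ have a unique counit and antipode, $(\epsilon_H,S_H)$ and $(\epsilon_K,S_K)$ respectively, and $\alpha$ is compatible with them: for all $f\in H$, $$\epsilon_K(\alpha(f))=\epsilon_H(f)\ \text{ in } M(\mathbb C)=\mathbb C,\qquad \alpha(S_H(f))=S_K(\alpha(f))\ \text{ in } M(K),$$ where $\epsilon_K$ and $S_K$ are extended to $M(K)$. Moreover $\epsilon_H(S_H(f))=\epsilon_H(f)$ for all $f\in H$. -/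

import Mathlib

noncomputable section

set_option linter.unusedSectionVars false
set_option linter.unusedVariables false

namespace Born

open Bornology
open scoped Pointwise

universe u v w

section Disks

variable {V : Type u} [AddCommGroup V] [Module ℂ V] {D : Set V} {x y : V}

/-- A disk: a circled and convex subset of a complex vector space. -/
def IsDisk (D : Set V) : Prop :=
  ∀ x ∈ D, ∀ y ∈ D, ∀ a b : ℂ, ‖a‖ + ‖b‖ ≤ 1 → a • x + b • y ∈ D

/-- A disk `T` is completant if its linear span, with the Minkowski functional of `T` as
semi-norm, is a Banach space: the semi-norm is a norm, and Cauchy sequences converge.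
(The Minkowski functional of `z` is small iff `z ∈ ε • T` with small `ε`.) -/
def IsCompletant (T : Set V) : Prop :=
  (∀ x : V, (∀ ε : ℝ, 0 < ε → x ∈ (ε : ℂ) • T) → x = 0) ∧
  ∀ s : ℕ → V, (∀ n, s n ∈ Submodule.span ℂ T) →
    (∀ ε : ℝ, 0 < ε → ∃ N, ∀ m ≥ N, ∀ n ≥ N, s m - s n ∈ (ε : ℂ) • T) →
    ∃ x ∈ Submodule.span ℂ T, ∀ ε : ℝ, 0 < ε → ∃ N, ∀ n ≥ N, s n - x ∈ (ε : ℂ) • T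

theorem IsDisk.smul_mem (h : IsDisk D) (hx : x ∈ D) {c : ℂ} (hc : ‖c‖ ≤ 1) : c • x ∈ D := by
  simpa using h x hx x hx c 0 (by simpa using hc)

theorem IsDisk.scale_smul (h : IsDisk D) {r : ℝ} (hx : x ∈ (r : ℂ) • D) (c : ℂ) :
    c • x ∈ ((‖c‖ * r : ℝ) : ℂ) • D := by
  obtain ⟨d, hd, rfl⟩ := hx
  refine ⟨(c / ‖c‖) • d, h.smul_mem hd ?_, ?_⟩
  · rw [norm_div, Complex.norm_real, norm_norm]
    exact div_self_le_one _
  · by_cases hc : c = 0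
    · simp [hc]
    · have : (‖c‖ : ℂ) ≠ 0 := by simpa using hc
      simp only [smul_smul]
      congr 1
      push_cast
      field_simp

theorem IsDisk.scale_mono (h : IsDisk D) {r s : ℝ} (hr : 0 ≤ r) (hrs : r ≤ s)
    (hx : x ∈ (r : ℂ) • D) : x ∈ (s : ℂ) • D := by
  obtain ⟨d, hd, rfl⟩ := hx
  by_cases hs : s = 0
  · obtain rfl : r = s := by linarith
    exact ⟨d, hd, rfl⟩
  · have hs' : 0 < s := lt_of_le_of_ne (hr.trans hrs) (Ne.symm hs)
    refine ⟨((r / s : ℝ) : ℂ) • d, h.smul_mem hd ?_, ?_⟩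
    · rw [Complex.norm_real, Real.norm_of_nonneg (by positivity)]
      exact (div_le_one hs').2 hrs
    · simp only [smul_smul]
      congr 1
      norm_cast
      field_simp

theorem IsDisk.scale_add (h : IsDisk D) {r s : ℝ} (hr : 0 ≤ r) (hs : 0 ≤ s)
    (hx : x ∈ (r : ℂ) • D) (hy : y ∈ (s : ℂ) • D) : x + y ∈ ((r + s : ℝ) : ℂ) • D := by
  obtain ⟨d, hd, rfl⟩ := hx
  obtain ⟨e, he, rfl⟩ := hy
  by_cases h0 : r + s = 0
  · obtain rfl : r = 0 := by linarith
    obtain rfl : s = 0 := by linarith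
    exact ⟨d, hd, by simp⟩
  · have h1 : 0 < r + s := lt_of_le_of_ne (by positivity) (Ne.symm h0)
    refine ⟨((r / (r + s) : ℝ) : ℂ) • d + ((s / (r + s) : ℝ) : ℂ) • e, h d hd e he _ _ ?_, ?_⟩
    · rw [Complex.norm_real, Complex.norm_real, Real.norm_of_nonneg (by positivity),
        Real.norm_of_nonneg (by positivity), ← add_div, div_self h0]
    · simp only [smul_add, smul_smul]
      congr 2 <;> norm_cast <;> field_simp

theorem IsDisk.scale_neg (h : IsDisk D) {r : ℝ} (hx : x ∈ (r : ℂ) • D) : -x ∈ (r : ℂ) • D := by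
  simpa using h.scale_smul hx (-1)

theorem IsDisk.scale_sub (h : IsDisk D) {r s : ℝ} (hr : 0 ≤ r) (hs : 0 ≤ s)
    (hx : x ∈ (r : ℂ) • D) (hy : y ∈ (s : ℂ) • D) : x - y ∈ ((r + s : ℝ) : ℂ) • D := by
  rw [sub_eq_add_neg]
  exact h.scale_add hr hs hx (h.scale_neg hy)

theorem IsDisk.scale_sum (h : IsDisk D) (h0 : (0 : V) ∈ D) {ι : Type*} (s : Finset ι)
    (c : ι → ℂ) (e : ι → V) (he : ∀ i ∈ s, c i ≠ 0 → e i ∈ D) :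
    ∑ i ∈ s, c i • e i ∈ ((∑ i ∈ s, ‖c i‖ : ℝ) : ℂ) • D := by
  classical
  induction s using Finset.induction_on with
  | empty => exact ⟨0, h0, by simp⟩
  | insert i s hi ih =>
    rw [Finset.sum_insert hi, Finset.sum_insert hi]
    refine h.scale_add (norm_nonneg _) (Finset.sum_nonneg fun _ _ => norm_nonneg _) ?_
      (ih fun j hj => he j (Finset.mem_insert_of_mem hj))
    by_cases hc : c i = 0
    · exact ⟨0, h0, by simp [hc]⟩
    · have := h.scale_smul (r := 1) (x := e i)
        ⟨e i, he i (Finset.mem_insert_self _ _) hc, by simp⟩ (c i)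
      simpa using this

theorem mem_span_of_scale {r : ℝ} (hx : x ∈ (r : ℂ) • D) : x ∈ Submodule.span ℂ D := by
  obtain ⟨d, hd, rfl⟩ := hx
  exact Submodule.smul_mem _ _ (Submodule.subset_span hd)

end Disks

/-- Complete (convex) bornological vector spaces. The bounded sets of the bornology are the small
sets. Convexity of the bornology is part of the last field: every small set lies in a small disk,
which moreover is completant. -/
class BornologicalSpace (V : Type u) [AddCommGroup V] [Module ℂ V] [Bornology V] : Prop where
  bounded_add : ∀ {s t : Set V}, IsBounded s → IsBounded t → IsBounded (s + t)
  bounded_smul : ∀ (c : ℂ) {s : Set V}, IsBounded s → IsBounded (c • s)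
  complete : ∀ {s : Set V}, IsBounded s →
    ∃ T : Set V, IsBounded T ∧ IsDisk T ∧ IsCompletant T ∧ s ⊆ T

/-- Convergence of a sequence: convergence in the semi-normed space of some small disk. -/
def BornTendsto {V : Type u} [AddCommGroup V] [Module ℂ V] [Bornology V]
    (s : ℕ → V) (x : V) : Prop :=
  ∃ D : Set V, IsBounded D ∧ IsDisk D ∧
    ∀ ε : ℝ, 0 < ε → ∃ N, ∀ n ≥ N, s n - x ∈ (ε : ℂ) • D

section Basic

variable {V : Type u} [AddCommGroup V] [Module ℂ V] [Bornology V] [BornologicalSpace V]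

theorem exists_disk {s : Set V} (hs : IsBounded s) :
    ∃ T : Set V, IsBounded T ∧ IsDisk T ∧ IsCompletant T ∧ s ⊆ T ∧ (0 : V) ∈ T := by
  obtain ⟨T, h1, h2, h3, h4⟩ := BornologicalSpace.complete (hs.union (isBounded_singleton (x := (0 : V))))
  exact ⟨T, h1, h2, h3, fun x hx => h4 (Or.inl hx), h4 (Or.inr rfl)⟩

theorem scale_subset {D T : Set V} (h : D ⊆ T) {r : ℂ} {x : V} (hx : x ∈ r • D) : x ∈ r • T :=
  Set.smul_set_mono h hx

theorem BornTendsto.unique {s : ℕ → V} {x y : V} (hx : BornTendsto s x) (hy : BornTendsto s y) :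
    x = y := by
  obtain ⟨D, hD, _, hDx⟩ := hx
  obtain ⟨E, hE, _, hEy⟩ := hy
  obtain ⟨T, _, hT, hc, hsub, _⟩ := exists_disk (hD.union hE)
  refine sub_eq_zero.1 (hc.1 _ fun ε hε => ?_)
  obtain ⟨N, hN⟩ := hDx (ε / 2) (by positivity)
  obtain ⟨M, hM⟩ := hEy (ε / 2) (by positivity)
  have h1 := scale_subset (fun z hz => hsub (Or.inl hz)) (hN (max N M) (le_max_left _ _))
  have h2 := scale_subset (fun z hz => hsub (Or.inr hz)) (hM (max N M) (le_max_right _ _))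
  have := hT.scale_sub (by positivity) (by positivity) h2 h1
  rwa [add_halves, sub_sub_sub_cancel_left] at this

theorem BornTendsto.add {s t : ℕ → V} {x y : V} (hx : BornTendsto s x) (hy : BornTendsto t y) :
    BornTendsto (fun n => s n + t n) (x + y) := by
  obtain ⟨D, hD, _, hDx⟩ := hx
  obtain ⟨E, hE, _, hEy⟩ := hy
  obtain ⟨T, hTb, hT, _, hsub, _⟩ := exists_disk (hD.union hE)
  refine ⟨T, hTb, hT, fun ε hε => ?_⟩
  obtain ⟨N, hN⟩ := hDx (ε / 2) (by positivity)
  obtain ⟨M, hM⟩ := hEy (ε / 2) (by positivity)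
  refine ⟨max N M, fun n hn => ?_⟩
  have h1 := scale_subset (fun z hz => hsub (Or.inl hz)) (hN n (le_of_max_le_left hn))
  have h2 := scale_subset (fun z hz => hsub (Or.inr hz)) (hM n (le_of_max_le_right hn))
  have := hT.scale_add (by positivity) (by positivity) h1 h2
  rwa [add_halves, sub_add_sub_comm] at this

theorem BornTendsto.smul {s : ℕ → V} {x : V} (c : ℂ) (hx : BornTendsto s x) :
    BornTendsto (fun n => c • s n) (c • x) := by
  obtain ⟨D, hD, hd, hDx⟩ := hx
  refine ⟨D, hD, hd, fun ε hε => ?_⟩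
  obtain ⟨N, hN⟩ := hDx (ε / (‖c‖ + 1)) (by positivity)
  refine ⟨N, fun n hn => ?_⟩
  rw [← smul_sub]
  refine hd.scale_mono (by positivity) ?_ (hd.scale_smul (hN n hn) c)
  rw [mul_div_assoc', div_le_iff₀ (by positivity)]
  nlinarith [norm_nonneg c]

theorem bornTendsto_const (x : V) : BornTendsto (fun _ => x) x := by
  refine ⟨{0}, isBounded_singleton, ?_, fun ε _ => ⟨0, fun n _ => ?_⟩⟩
  · rintro x rfl y rfl a b _
    simp
  · simp

end Basic

/-- The bounded linear maps, as a subspace of all linear maps. -/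
def boundedMaps (V : Type u) (W : Type v) [AddCommGroup V] [Module ℂ V] [Bornology V]
    [AddCommGroup W] [Module ℂ W] [Bornology W] [BornologicalSpace W] :
    Submodule ℂ (V →ₗ[ℂ] W) where
  carrier := {f | ∀ s : Set V, IsBounded s → IsBounded (f '' s)}
  add_mem' := by
    intro f g hf hg s hs
    refine (BornologicalSpace.bounded_add (hf s hs) (hg s hs)).subset ?_
    rintro _ ⟨x, hx, rfl⟩
    exact Set.add_mem_add ⟨x, hx, rfl⟩ ⟨x, hx, rfl⟩
  zero_mem' := by
    intro s _
    refine (isBounded_singleton (x := (0 : W))).subset ?_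
    rintro _ ⟨x, _, rfl⟩
    rfl
  smul_mem' := by
    intro c f hf s hs
    refine (BornologicalSpace.bounded_smul c (hf s hs)).subset ?_
    rintro _ ⟨x, hx, rfl⟩
    exact Set.smul_mem_smul_set ⟨x, hx, rfl⟩

/-- `BLin V W` is the space `Hom(V, W)` of bounded linear maps. -/
def BLin (V : Type u) (W : Type v) [AddCommGroup V] [Module ℂ V] [Bornology V]
    [AddCommGroup W] [Module ℂ W] [Bornology W] [BornologicalSpace W] : Type (max u v) :=
  boundedMaps V W

section BLin

variable {V : Type u} {W : Type v} {X : Type w} [AddCommGroup V] [Module ℂ V] [Bornology V]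
  [AddCommGroup W] [Module ℂ W] [Bornology W] [BornologicalSpace W]
  [AddCommGroup X] [Module ℂ X] [Bornology X] [BornologicalSpace X]

instance : AddCommGroup (BLin V W) := inferInstanceAs (AddCommGroup (boundedMaps V W))
instance : Module ℂ (BLin V W) := inferInstanceAs (Module ℂ (boundedMaps V W))

instance : FunLike (BLin V W) V W where
  coe f := (Subtype.val f : V →ₗ[ℂ] W)
  coe_injective _ _ h := Subtype.ext (DFunLike.coe_injective h)

/-- A bounded linear map from a linear map and a proof of its boundedness. -/
def BLin.of (f : V →ₗ[ℂ] W) (hf : ∀ s : Set V, IsBounded s → IsBounded (f '' s)) : BLin V W :=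
  Subtype.mk f hf

instance : LinearMapClass (BLin V W) ℂ V W where
  map_add f := LinearMap.map_add (Subtype.val f)
  map_smulₛₗ f := LinearMap.map_smul (Subtype.val f)

theorem BLin.bounded (f : BLin V W) {s : Set V} (hs : IsBounded s) : IsBounded (f '' s) :=
  Subtype.property f s hs

@[simp] theorem BLin.of_apply (f : V →ₗ[ℂ] W) (hf) (x : V) :
    (BLin.of f hf : BLin V W) x = f x := rfl
@[simp] theorem BLin.add_apply (f g : BLin V W) (x : V) : (f + g) x = f x + g x := rfl
@[simp] theorem BLin.sub_apply (f g : BLin V W) (x : V) : (f - g) x = f x - g x := rfl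
@[simp] theorem BLin.neg_apply (f : BLin V W) (x : V) : (-f) x = -f x := rfl
@[simp] theorem BLin.zero_apply (x : V) : (0 : BLin V W) x = 0 := rfl
@[simp] theorem BLin.smul_apply (c : ℂ) (f : BLin V W) (x : V) : (c • f) x = c • f x := rfl

@[ext] theorem BLin.ext {f g : BLin V W} (h : ∀ x, f x = g x) : f = g := DFunLike.ext _ _ h

/-- The natural bornology of `Hom(V, W)`: the equibounded sets of maps. -/
instance : Bornology (BLin V W) :=
  Bornology.ofBounded {L | ∀ s : Set V, IsBounded s → IsBounded {y : W | ∃ f ∈ L, ∃ x ∈ s, f x = y}}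
    (by
      intro s _
      refine isBounded_empty.subset ?_
      rintro _ ⟨f, hf, _⟩
      exact hf)
    (by
      intro L hL M hM s hs
      refine (hL s hs).subset ?_
      rintro _ ⟨f, hf, h⟩
      exact ⟨f, hM hf, h⟩)
    (by
      intro L hL M hM s hs
      refine ((hL s hs).union (hM s hs)).subset ?_
      rintro _ ⟨f, hf | hf, h⟩
      · exact Or.inl ⟨f, hf, h⟩
      · exact Or.inr ⟨f, hf, h⟩)
    (by
      intro f s hs
      refine (f.bounded hs).subset ?_
      rintro _ ⟨g, rfl, x, hx, rfl⟩
      exact ⟨x, hx, rfl⟩)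

theorem BLin.isBounded_iff {L : Set (BLin V W)} :
    IsBounded L ↔ ∀ s : Set V, IsBounded s → IsBounded {y : W | ∃ f ∈ L, ∃ x ∈ s, f x = y} :=
  isBounded_ofBounded_iff _

theorem BornTendsto.map (f : BLin V W) {s : ℕ → V} {x : V} (h : BornTendsto s x) :
    BornTendsto (fun n => f (s n)) (f x) := by
  obtain ⟨D, hD, hd, hDx⟩ := h
  refine ⟨f '' D, f.bounded hD, ?_, fun ε hε => ?_⟩
  · rintro _ ⟨x, hx, rfl⟩ _ ⟨y, hy, rfl⟩ a b hab
    exact ⟨a • x + b • y, hd x hx y hy a b hab, by simp⟩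
  · obtain ⟨N, hN⟩ := hDx ε hε
    refine ⟨N, fun n hn => ?_⟩
    obtain ⟨d, hd, h⟩ := hN n hn
    exact ⟨f d, ⟨d, hd, rfl⟩, by simp only at h ⊢; rw [← map_sub, ← h, map_smul]⟩

/-- `Hom(V, W)` is complete if `W` is. -/
instance : BornologicalSpace (BLin V W) where
  bounded_add := by
    intro L M hL hM
    rw [BLin.isBounded_iff] at *
    intro s hs
    refine (BornologicalSpace.bounded_add (hL s hs) (hM s hs)).subset ?_
    rintro _ ⟨_, ⟨f, hf, g, hg, rfl⟩, x, hx, rfl⟩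
    exact Set.add_mem_add ⟨f, hf, x, hx, rfl⟩ ⟨g, hg, x, hx, rfl⟩
  bounded_smul := by
    intro c L hL
    rw [BLin.isBounded_iff] at *
    intro s hs
    refine (BornologicalSpace.bounded_smul c (hL s hs)).subset ?_
    rintro _ ⟨_, ⟨f, hf, rfl⟩, x, hx, rfl⟩
    exact Set.smul_mem_smul_set ⟨f, hf, x, hx, rfl⟩
  complete := by
    intro L hL
    rw [BLin.isBounded_iff] at hL
    have key : ∀ s : Set V, ∃ T : Set W, IsBounded T ∧ IsDisk T ∧ IsCompletant T ∧
        (IsBounded s → {y : W | ∃ f ∈ L, ∃ x ∈ s, f x = y} ⊆ T) := by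
      intro s
      by_cases hs : IsBounded s
      · obtain ⟨T, h1, h2, h3, h4, _⟩ := exists_disk (hL s hs)
        exact ⟨T, h1, h2, h3, fun _ => h4⟩
      · obtain ⟨T, h1, h2, h3, _⟩ := exists_disk (V := W) isBounded_empty
        exact ⟨T, h1, h2, h3, fun h => absurd h hs⟩
    choose T hTb hTd hTc hT using key
    let D : Set (BLin V W) := {f | ∀ s : Set V, IsBounded s → ∀ x ∈ s, f x ∈ T s}
    have hsc : ∀ {ε : ℝ} {f : BLin V W}, f ∈ (ε : ℂ) • D → ∀ s : Set V, IsBounded s → ∀ x ∈ s,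
        f x ∈ (ε : ℂ) • T s := by
      rintro ε _ ⟨f, hf, rfl⟩ s hs x hx
      exact ⟨f x, hf s hs x hx, rfl⟩
    have hcs : ∀ {ε : ℝ} {f : BLin V W}, 0 < ε → (∀ s : Set V, IsBounded s → ∀ x ∈ s,
        f x ∈ (ε : ℂ) • T s) → f ∈ (ε : ℂ) • D := by
      intro ε f hε h
      have hε' : (ε : ℂ) ≠ 0 := by exact_mod_cast hε.ne'
      rw [Set.mem_smul_set_iff_inv_smul_mem₀ hε']
      intro s hs x hx
      exact (Set.mem_smul_set_iff_inv_smul_mem₀ hε' _ _).1 (h s hs x hx)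
    refine ⟨D, ?_, ?_, ⟨?_, ?_⟩, ?_⟩
    · rw [BLin.isBounded_iff]
      intro s hs
      refine (hTb s).subset ?_
      rintro _ ⟨f, hf, x, hx, rfl⟩
      exact hf s hs x hx
    · intro f hf g hg a b hab s hs x hx
      exact hTd s _ (hf s hs x hx) _ (hg s hs x hx) a b hab
    · intro f hf
      ext x
      refine (hTc {x}).1 _ fun ε hε => ?_
      exact hsc (hf ε hε) {x} isBounded_singleton x rfl
    · intro F hF hC
      have hspan : ∀ f ∈ Submodule.span ℂ D, ∀ s, IsBounded s → ∀ x ∈ s,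
          f x ∈ Submodule.span ℂ (T s) := by
        intro f hf s hs x hx
        induction hf using Submodule.span_induction with
        | mem g hg => exact Submodule.subset_span (hg s hs x hx)
        | zero => exact Submodule.zero_mem _
        | add g h _ _ h1 h2 => exact Submodule.add_mem _ h1 h2
        | smul c g _ h1 => exact Submodule.smul_mem _ c h1
      have hlim : ∀ s, IsBounded s → ∀ x ∈ s, ∃ y, ∀ ε : ℝ, 0 < ε → ∃ N, ∀ n ≥ N,
          F n x - y ∈ (ε : ℂ) • T s := by
        intro s hs x hx
        obtain ⟨y, _, hy⟩ := (hTc s).2 (fun n => F n x) (fun n => hspan _ (hF n) s hs x hx)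
          (fun ε hε => by
            obtain ⟨N, hN⟩ := hC ε hε
            exact ⟨N, fun m hm n hn => hsc (hN m hm n hn) s hs x hx⟩)
        exact ⟨y, hy⟩
      have hl1 : ∀ x : V, ∃ y, ∀ ε : ℝ, 0 < ε → ∃ N, ∀ n ≥ N,
          F n x - y ∈ (ε : ℂ) • T {x} := fun x => hlim {x} isBounded_singleton x rfl
      choose g hg using hl1
      have hgt : ∀ x, BornTendsto (fun n => F n x) (g x) := fun x =>
        ⟨T {x}, hTb _, hTd _, hg x⟩
      have hg2 : ∀ s, IsBounded s → ∀ x ∈ s, ∀ ε : ℝ, 0 < ε → ∃ N, ∀ n ≥ N,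
          F n x - g x ∈ (ε : ℂ) • T s := by
        intro s hs x hx
        obtain ⟨y, hy⟩ := hlim s hs x hx
        have : BornTendsto (fun n => F n x) y := ⟨T s, hTb _, hTd _, hy⟩
        rw [(hgt x).unique this]
        exact hy
      have hg3 : ∀ ε : ℝ, 0 < ε → ∃ N, ∀ n ≥ N, ∀ s, IsBounded s → ∀ x ∈ s,
          F n x - g x ∈ (ε : ℂ) • T s := by
        intro ε hε
        obtain ⟨N, hN⟩ := hC (ε / 2) (by positivity)
        refine ⟨N, fun n hn s hs x hx => ?_⟩
        obtain ⟨M, hM⟩ := hg2 s hs x hx (ε / 2) (by positivity)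
        have h1 := hsc (hN n hn (max N M) (le_max_left _ _)) s hs x hx
        have h2 := hM (max N M) (le_max_right _ _)
        have := (hTd s).scale_add (by positivity) (by positivity) h1 h2
        rwa [add_halves, BLin.sub_apply, sub_add_sub_cancel] at this
      let G : V →ₗ[ℂ] W :=
        { toFun := g
          map_add' := fun x y => by
            have h1 := (hgt x).add (hgt y)
            simp only [← map_add] at h1
            exact (hgt _).unique h1
          map_smul' := fun c x => by
            have h1 := (hgt x).smul c
            simp only [← map_smul] at h1
            exact (hgt _).unique h1 }
      have hG : ∀ s : Set V, IsBounded s → IsBounded (G '' s) := by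
        intro s hs
        obtain ⟨N, hN⟩ := hg3 1 one_pos
        refine (BornologicalSpace.bounded_add ((F N).bounded hs)
          (BornologicalSpace.bounded_smul (-1) (hTb s))).subset ?_
        rintro _ ⟨x, hx, rfl⟩
        obtain ⟨d, hd, h⟩ := hN N le_rfl s hs x hx
        refine ⟨F N x, ⟨x, hx, rfl⟩, (-1 : ℂ) • d, ⟨d, hd, rfl⟩, ?_⟩
        have h' : d = F N x - g x := by simpa using h
        change F N x + (-1 : ℂ) • d = g x
        rw [h']
        simp
      have hconv : ∀ ε : ℝ, 0 < ε → ∃ N, ∀ n ≥ N, F n - BLin.of G hG ∈ (ε : ℂ) • D := by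
        intro ε hε
        obtain ⟨N, hN⟩ := hg3 ε hε
        exact ⟨N, fun n hn => hcs hε fun s hs x hx => hN n hn s hs x hx⟩
      refine ⟨BLin.of G hG, ?_, hconv⟩
      obtain ⟨N, hN⟩ := hconv 1 one_pos
      have := Submodule.sub_mem _ (hF N) (mem_span_of_scale (hN N le_rfl))
      simpa using this
    · intro f hf s hs x hx
      exact hT s hs ⟨f, hf, x, hx, rfl⟩

/-- Bounded bilinear maps `V × W → X`, as elements of `Hom(V, Hom(W, X))`. -/
def BLin.mk₂ (b : V → W → X) (h1 : ∀ x x' y, b (x + x') y = b x y + b x' y)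
    (h2 : ∀ (c : ℂ) x y, b (c • x) y = c • b x y)
    (h3 : ∀ x y y', b x (y + y') = b x y + b x y')
    (h4 : ∀ (c : ℂ) x y, b x (c • y) = c • b x y)
    (h5 : ∀ s t, IsBounded s → IsBounded t → IsBounded (Set.image2 b s t)) :
    BLin V (BLin W X) :=
  BLin.of
    { toFun := fun x =>
        BLin.of { toFun := b x, map_add' := h3 x, map_smul' := fun c => h4 c x } (by
          intro t ht
          refine (h5 {x} t isBounded_singleton ht).subset ?_
          rintro _ ⟨y, hy, rfl⟩
          exact ⟨x, rfl, y, hy, rfl⟩)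
      map_add' := fun x x' => BLin.ext (h1 x x')
      map_smul' := fun c x => BLin.ext (h2 c x) } (by
    intro s hs
    rw [BLin.isBounded_iff]
    intro t ht
    refine (h5 s t hs ht).subset ?_
    rintro _ ⟨_, ⟨x, hx, rfl⟩, y, hy, rfl⟩
    exact ⟨x, hx, y, hy, rfl⟩)

@[simp] theorem BLin.mk₂_apply (b : V → W → X) (h1 h2 h3 h4 h5) (x : V) (y : W) :
    BLin.mk₂ b h1 h2 h3 h4 h5 x y = b x y := rfl

theorem BLin.bounded₂ (b : BLin V (BLin W X)) {s : Set V} {t : Set W} (hs : IsBounded s)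
    (ht : IsBounded t) : IsBounded (Set.image2 (fun x y => b x y) s t) := by
  refine (BLin.isBounded_iff.1 (b.bounded hs) t ht).subset ?_
  rintro _ ⟨x, hx, y, hy, rfl⟩
  exact ⟨b x, ⟨x, hx, rfl⟩, y, hy, rfl⟩

/-- Composition of bounded linear maps. -/
def BLin.comp (g : BLin W X) (f : BLin V W) : BLin V X :=
  BLin.of { toFun := fun x => g (f x), map_add' := by simp, map_smul' := by simp } (by
    intro s hs
    refine (g.bounded (f.bounded hs)).subset ?_
    rintro _ ⟨x, hx, rfl⟩
    exact ⟨f x, ⟨x, hx, rfl⟩, rfl⟩)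

@[simp] theorem BLin.comp_apply (g : BLin W X) (f : BLin V W) (x : V) : g.comp f x = g (f x) := rfl

/-- The identity map. -/
def BLin.id (V : Type u) [AddCommGroup V] [Module ℂ V] [Bornology V] [BornologicalSpace V] :
    BLin V V :=
  BLin.of LinearMap.id (by intro s hs; simpa using hs)

@[simp] theorem BLin.id_apply {V : Type u} [AddCommGroup V] [Module ℂ V] [Bornology V]
    [BornologicalSpace V] (x : V) : BLin.id V x = x := rfl

/-- The bilinear map with the two arguments exchanged. -/
def BLin.flip [BornologicalSpace V] (b : BLin V (BLin W X)) : BLin W (BLin V X) :=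
  BLin.mk₂ (fun y x => b x y) (by simp) (by simp) (by simp) (by simp) (by
    intro s t hs ht
    refine (b.bounded₂ ht hs).subset ?_
    rintro _ ⟨y, hy, x, hx, rfl⟩
    exact ⟨x, hx, y, hy, rfl⟩)

@[simp] theorem BLin.flip_apply [BornologicalSpace V] (b : BLin V (BLin W X)) (x : V) (y : W) :
    b.flip y x = b x y := rfl

/-- Isomorphisms of bornological vector spaces. -/
def IsBornIso [BornologicalSpace V] (f : BLin V W) : Prop :=
  ∃ g : BLin W V, (∀ x, g (f x) = x) ∧ ∀ y, f (g y) = y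

end BLin

section Sums

variable {V : Type u} [AddCommGroup V] [Module ℂ V] [Bornology V] [BornologicalSpace V]

/-- Unconditional convergence of a series in the semi-normed space of some small disk. -/
def BornHasSum {ι : Type v} (f : ι → V) (x : V) : Prop :=
  ∃ D : Set V, IsBounded D ∧ IsDisk D ∧
    ∀ ε : ℝ, 0 < ε → ∃ s₀ : Finset ι, ∀ s, s₀ ⊆ s → x - ∑ i ∈ s, f i ∈ (ε : ℂ) • D

theorem BornHasSum.exists_seq {ι : Type v} {f : ι → V} {x : V} (h : BornHasSum f x) :
    ∃ s : ℕ → Finset ι, ∀ t : ℕ → Finset ι, (∀ n, s n ⊆ t n) →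
      BornTendsto (fun n => ∑ i ∈ t n, f i) x := by
  obtain ⟨D, hD, hd, h⟩ := h
  choose s hs using fun n : ℕ => h (1 / ((n : ℝ) + 1)) (by positivity)
  refine ⟨s, fun t ht => ⟨D, hD, hd, fun ε hε => ?_⟩⟩
  obtain ⟨N, hN⟩ := exists_nat_one_div_lt hε
  refine ⟨N, fun n hn => ?_⟩
  rw [← neg_sub]
  refine hd.scale_neg (hd.scale_mono (by positivity) ?_ (hs n (t n) (ht n)))
  refine le_trans ?_ hN.le
  have : (N : ℝ) ≤ n := by exact_mod_cast hn
  gcongr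

theorem BornHasSum.unique {ι : Type v} {f : ι → V} {x y : V} (hx : BornHasSum f x)
    (hy : BornHasSum f y) : x = y := by
  classical
  obtain ⟨s, hs⟩ := hx.exists_seq
  obtain ⟨t, ht⟩ := hy.exists_seq
  exact (hs (fun n => s n ∪ t n) fun n => Finset.subset_union_left).unique
    (ht (fun n => s n ∪ t n) fun n => Finset.subset_union_right)

theorem BornHasSum.add {ι : Type v} {f g : ι → V} {x y : V} (hx : BornHasSum f x)
    (hy : BornHasSum g y) : BornHasSum (fun i => f i + g i) (x + y) := by
  classical
  obtain ⟨D, hD, _, hDx⟩ := hx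
  obtain ⟨E, hE, _, hEy⟩ := hy
  obtain ⟨T, hTb, hT, _, hsub, _⟩ := exists_disk (hD.union hE)
  refine ⟨T, hTb, hT, fun ε hε => ?_⟩
  obtain ⟨N, hN⟩ := hDx (ε / 2) (by positivity)
  obtain ⟨M, hM⟩ := hEy (ε / 2) (by positivity)
  refine ⟨N ∪ M, fun n hn => ?_⟩
  have h1 := scale_subset (fun z hz => hsub (Or.inl hz)) (hN n (Finset.union_subset_left hn))
  have h2 := scale_subset (fun z hz => hsub (Or.inr hz)) (hM n (Finset.union_subset_right hn))
  have := hT.scale_add (by positivity) (by positivity) h1 h2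
  rwa [add_halves, sub_add_sub_comm, ← Finset.sum_add_distrib] at this

theorem BornHasSum.smul {ι : Type v} {f : ι → V} {x : V} (c : ℂ) (hx : BornHasSum f x) :
    BornHasSum (fun i => c • f i) (c • x) := by
  obtain ⟨D, hD, hd, hDx⟩ := hx
  refine ⟨D, hD, hd, fun ε hε => ?_⟩
  obtain ⟨N, hN⟩ := hDx (ε / (‖c‖ + 1)) (by positivity)
  refine ⟨N, fun n hn => ?_⟩
  rw [← Finset.smul_sum, ← smul_sub]
  refine hd.scale_mono (by positivity) ?_ (hd.scale_smul (hN n hn) c)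
  rw [mul_div_assoc', div_le_iff₀ (by positivity)]
  nlinarith [norm_nonneg c]

/-- Absolutely convergent series converge in a completant disk. -/
theorem IsCompletant.exists_sum {ι : Type v} {D : Set V} (hD : IsDisk D) (h0 : (0 : V) ∈ D)
    (hc : IsCompletant D) {c : ι → ℂ} (hsum : Summable fun i => ‖c i‖) {e : ι → V}
    (he : ∀ i, c i ≠ 0 → e i ∈ D) :
    ∃ x, ∀ ε : ℝ, 0 < ε → ∃ s₀ : Finset ι, ∀ s, s₀ ⊆ s →
      x - ∑ i ∈ s, c i • e i ∈ (ε : ℂ) • D := by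
  classical
  have hv : ∀ ε : ℝ, 0 < ε → ∃ s₀ : Finset ι, ∀ s, s₀ ⊆ s →
      (∑ i ∈ s, c i • e i) - ∑ i ∈ s₀, c i • e i ∈ (ε : ℂ) • D := by
    intro ε hε
    obtain ⟨s₀, hs₀⟩ := summable_iff_vanishing_norm.1 hsum ε hε
    refine ⟨s₀, fun s hs => ?_⟩
    rw [← Finset.sum_sdiff hs, add_sub_cancel_right]
    refine hD.scale_mono (Finset.sum_nonneg fun _ _ => norm_nonneg _) ?_
      (hD.scale_sum h0 (s \ s₀) c e fun i _ hi => he i hi)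
    have := hs₀ (s \ s₀) Finset.sdiff_disjoint
    rw [Real.norm_of_nonneg (Finset.sum_nonneg fun _ _ => norm_nonneg _)] at this
    exact this.le
  choose s hs using fun n : ℕ => hv (1 / ((n : ℝ) + 1)) (by positivity)
  have hsmall : ∀ ε : ℝ, 0 < ε → ∃ N : ℕ, ∀ t, s N ⊆ t →
      (∑ i ∈ t, c i • e i) - ∑ i ∈ s N, c i • e i ∈ (ε : ℂ) • D := by
    intro ε hε
    obtain ⟨N, hN⟩ := exists_nat_one_div_lt hε
    exact ⟨N, fun t ht => hD.scale_mono (by positivity) hN.le (hs N t ht)⟩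
  let t : ℕ → Finset ι := fun n => (Finset.range (n + 1)).biUnion s
  have hst : ∀ N n, N ≤ n → s N ⊆ t n := fun N n h =>
    Finset.subset_biUnion_of_mem s (Finset.mem_range.2 (Nat.lt_succ_of_le h))
  obtain ⟨x, -, hx⟩ := hc.2 (fun n => ∑ i ∈ t n, c i • e i)
    (fun n => mem_span_of_scale (hD.scale_sum h0 (t n) c e fun i _ hi => he i hi))
    (fun ε hε => by
      obtain ⟨N, hN⟩ := hsmall (ε / 2) (by positivity)
      refine ⟨N, fun m hm n hn => ?_⟩
      have := hD.scale_sub (by positivity) (by positivity) (hN _ (hst N m hm)) (hN _ (hst N n hn))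
      rwa [add_halves, sub_sub_sub_cancel_right] at this)
  refine ⟨x, fun ε hε => ?_⟩
  obtain ⟨N, hN⟩ := hsmall (ε / 3) (by positivity)
  obtain ⟨M, hM⟩ := hx (ε / 3) (by positivity)
  refine ⟨s N, fun r hr => ?_⟩
  have h1 := hM (max N M) (le_max_right _ _)
  have h2 := hN _ (hst N (max N M) (le_max_left _ _))
  have h3 := hN r hr
  have h4 := hD.scale_sub (by positivity) (by positivity)
    (hD.scale_sub (by positivity) (by positivity) h2 h3) h1
  rw [show ε / 3 + ε / 3 + ε / 3 = ε by ring] at h4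
  convert h4 using 1
  abel

end Sums

section Quotient

variable {E : Type u} [AddCommGroup E] [Module ℂ E] [Bornology E]

/-- Closed subspaces: those containing all limits of their convergent sequences. -/
def IsBornClosed (N : Submodule ℂ E) : Prop :=
  ∀ (s : ℕ → E) (x : E), (∀ n, s n ∈ N) → BornTendsto s x → x ∈ N

/-- The smallest closed subspace containing a given set. -/
def closedSpan (R : Set E) : Submodule ℂ E := sInf {N | R ⊆ N ∧ IsBornClosed N}

theorem subset_closedSpan (R : Set E) : R ⊆ closedSpan R := by
  intro x hx
  simp only [closedSpan, SetLike.mem_coe, Submodule.mem_sInf]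
  exact fun N hN => hN.1 hx

theorem isBornClosed_closedSpan (R : Set E) : IsBornClosed (closedSpan R) := by
  intro s x hs hx
  simp only [closedSpan, Submodule.mem_sInf] at hs ⊢
  exact fun N hN => hN.2 s x (fun n => hs n N hN) hx

theorem closedSpan_le {R : Set E} {N : Submodule ℂ E} (h : R ⊆ N) (hN : IsBornClosed N) :
    closedSpan R ≤ N := sInf_le ⟨h, hN⟩

/-- The quotient of a complete bornological vector space by the closed subspace generated
by `R`, with the quotient bornology. -/
def BQuot (R : Set E) : Type u := E ⧸ closedSpan R

variable (R : Set E)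

instance : AddCommGroup (BQuot R) := inferInstanceAs (AddCommGroup (E ⧸ closedSpan R))
instance : Module ℂ (BQuot R) := inferInstanceAs (Module ℂ (E ⧸ closedSpan R))

/-- The linear quotient map. -/
def BQuot.mkLin : E →ₗ[ℂ] BQuot R := (closedSpan R).mkQ

theorem BQuot.mkLin_surjective : Function.Surjective (BQuot.mkLin R) :=
  (closedSpan R).mkQ_surjective

theorem BQuot.mkLin_eq_zero {x : E} : BQuot.mkLin R x = 0 ↔ x ∈ closedSpan R :=
  Submodule.Quotient.mk_eq_zero _

/-- The quotient bornology: a set is small iff it is contained in the image of a small set. -/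
instance : Bornology (BQuot R) :=
  Bornology.ofBounded {s | ∃ t : Set E, IsBounded t ∧ s ⊆ BQuot.mkLin R '' t}
    ⟨∅, isBounded_empty, by simp⟩
    (fun _ ⟨t, ht, h⟩ _ h' => ⟨t, ht, h'.trans h⟩)
    (fun _ ⟨t, ht, h⟩ _ ⟨t', ht', h'⟩ =>
      ⟨t ∪ t', ht.union ht', by rw [Set.image_union]; exact Set.union_subset_union h h'⟩)
    (fun x => by
      obtain ⟨y, rfl⟩ := BQuot.mkLin_surjective R x
      exact ⟨{y}, isBounded_singleton, by simp⟩)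

theorem BQuot.isBounded_iff {s : Set (BQuot R)} :
    IsBounded s ↔ ∃ t : Set E, IsBounded t ∧ s ⊆ BQuot.mkLin R '' t :=
  isBounded_ofBounded_iff _

variable [BornologicalSpace E]

theorem BQuot.isCompletant_image {D : Set E} (hb : IsBounded D) (hD : IsDisk D)
    (h0 : (0 : E) ∈ D) (hc : IsCompletant D) : IsCompletant (BQuot.mkLin R '' D) := by
  constructor
  · intro y hy
    obtain ⟨x, rfl⟩ := BQuot.mkLin_surjective R y
    rw [BQuot.mkLin_eq_zero]
    have : ∀ n : ℕ, ∃ d ∈ D, x - ((1 / ((n : ℝ) + 1) : ℝ) : ℂ) • d ∈ closedSpan R := by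
      intro n
      obtain ⟨_, ⟨d, hd, rfl⟩, h⟩ := hy (1 / ((n : ℝ) + 1)) (by positivity)
      refine ⟨d, hd, ?_⟩
      rw [← BQuot.mkLin_eq_zero, map_sub, map_smul, ← h, sub_self]
    choose d hd hx using this
    refine isBornClosed_closedSpan R _ x hx ⟨D, hb, hD, fun ε hε => ?_⟩
    obtain ⟨N, hN⟩ := exists_nat_one_div_lt hε
    refine ⟨N, fun n hn => ?_⟩
    rw [sub_sub_cancel_left]
    refine hD.scale_neg (hD.scale_mono (by positivity) ?_ ⟨d n, hd n, rfl⟩)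
    refine le_trans ?_ hN.le
    have : (N : ℝ) ≤ n := by exact_mod_cast hn
    gcongr
  · intro s hs hC
    have hex : ∀ k : ℕ, ∃ N, ∀ m ≥ N, ∀ n ≥ N,
        s m - s n ∈ (((1 / 2 : ℝ) ^ k : ℝ) : ℂ) • (BQuot.mkLin R '' D) :=
      fun k => hC _ (by positivity)
    choose N₀ hN₀ using hex
    let M : ℕ → ℕ := fun k => (Finset.range (k + 1)).sup N₀
    have hM0 : ∀ k, N₀ k ≤ M k := fun k => Finset.le_sup (f := N₀) (by simp)
    have hMm : ∀ k, M k ≤ M (k + 1) := fun k =>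
      Finset.sup_mono (Finset.range_mono (by omega))
    have hstep : ∀ k, ∃ d ∈ D,
        BQuot.mkLin R ((((1 / 2 : ℝ) ^ k : ℝ) : ℂ) • d) = s (M (k + 1)) - s (M k) := by
      intro k
      obtain ⟨_, ⟨d, hd, rfl⟩, h⟩ := hN₀ k (M (k + 1)) ((hM0 k).trans (hMm k)) (M k) (hM0 k)
      exact ⟨d, hd, by rw [map_smul]; exact h⟩
    choose d hd hds using hstep
    have hsp : ∃ x₀ ∈ Submodule.span ℂ D, BQuot.mkLin R x₀ = s (M 0) := by
      have h := hs (M 0)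
      rw [← Submodule.map_span] at h
      exact h
    obtain ⟨x₀, hx₀, hx₀s⟩ := hsp
    let c : ℕ → ℂ := fun k => (((1 / 2 : ℝ) ^ k : ℝ) : ℂ)
    have hnc : ∀ k, ‖c k‖ = (1 / 2 : ℝ) ^ k := fun k => by
      rw [Complex.norm_real, Real.norm_of_nonneg (by positivity)]
    have hpart : ∀ k, BQuot.mkLin R (x₀ + ∑ i ∈ Finset.range k, c i • d i) = s (M k) := by
      intro k
      induction k with
      | zero => simpa using hx₀s
      | succ k ih =>
        rw [Finset.sum_range_succ, ← add_assoc, map_add, ih, hds k]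
        abel
    obtain ⟨x, hx⟩ := hc.exists_sum hD h0 (c := c) (e := d)
      (by simp only [hnc]; exact summable_geometric_of_lt_one (by norm_num) (by norm_num))
      (fun i _ => hd i)
    have hconv : ∀ ε : ℝ, 0 < ε → ∃ k, (1 / 2 : ℝ) ^ k < ε ∧
        s (M k) - BQuot.mkLin R (x₀ + x) ∈ (ε : ℂ) • (BQuot.mkLin R '' D) := by
      intro ε hε
      obtain ⟨s₀, hs₀⟩ := hx ε hε
      obtain ⟨k₁, hk₁⟩ := exists_pow_lt_of_lt_one hε (by norm_num : (1 / 2 : ℝ) < 1)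
      let k := max k₁ (s₀.sup _root_.id + 1)
      have hk : s₀ ⊆ Finset.range k := by
        intro i hi
        rw [Finset.mem_range]
        exact lt_of_lt_of_le (Nat.lt_succ_of_le (Finset.le_sup (f := _root_.id) hi))
          (le_max_right _ _)
      refine ⟨k, ?_, ?_⟩
      · exact (pow_le_pow_of_le_one (by norm_num) (by norm_num) (le_max_left _ _)).trans_lt hk₁
      · obtain ⟨e, he, h⟩ := hD.scale_neg (hs₀ _ hk)
        refine ⟨BQuot.mkLin R e, ⟨e, he, rfl⟩, ?_⟩
        rw [← hpart k, ← map_sub]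
        simp only at h ⊢
        rw [← map_smul, h]
        congr 1
        abel
    have hDi : IsDisk (BQuot.mkLin R '' D) := by
      rintro _ ⟨x, hx, rfl⟩ _ ⟨y, hy, rfl⟩ a b hab
      exact ⟨a • x + b • y, hD x hx y hy a b hab, by simp⟩
    have hfin : ∀ ε : ℝ, 0 < ε → ∃ N, ∀ n ≥ N,
        s n - BQuot.mkLin R (x₀ + x) ∈ (ε : ℂ) • (BQuot.mkLin R '' D) := by
      intro ε hε
      obtain ⟨k, hk, h⟩ := hconv (ε / 2) (by positivity)
      refine ⟨M k, fun n hn => ?_⟩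
      have h1 := hDi.scale_mono (by positivity) hk.le
        (hN₀ k n ((hM0 k).trans hn) (M k) (hM0 k))
      have := hDi.scale_add (by positivity) (by positivity) h1 h
      rwa [add_halves, sub_add_sub_cancel] at this
    refine ⟨_, ?_, hfin⟩
    obtain ⟨N, hN⟩ := hfin 1 one_pos
    have := Submodule.sub_mem _ (hs N) (mem_span_of_scale (hN N le_rfl))
    simpa using this

instance : BornologicalSpace (BQuot R) where
  bounded_add := by
    intro s t hs ht
    rw [BQuot.isBounded_iff] at *
    obtain ⟨a, ha, hsa⟩ := hs
    obtain ⟨b, hb, htb⟩ := ht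
    refine ⟨a + b, BornologicalSpace.bounded_add ha hb, ?_⟩
    rintro _ ⟨x, hx, y, hy, rfl⟩
    obtain ⟨x', hx', rfl⟩ := hsa hx
    obtain ⟨y', hy', rfl⟩ := htb hy
    exact ⟨x' + y', Set.add_mem_add hx' hy', by simp⟩
  bounded_smul := by
    intro c s hs
    rw [BQuot.isBounded_iff] at *
    obtain ⟨a, ha, hsa⟩ := hs
    refine ⟨c • a, BornologicalSpace.bounded_smul c ha, ?_⟩
    rintro _ ⟨x, hx, rfl⟩
    obtain ⟨x', hx', rfl⟩ := hsa hx
    exact ⟨c • x', Set.smul_mem_smul_set hx', by simp⟩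
  complete := by
    intro s hs
    rw [BQuot.isBounded_iff] at hs
    obtain ⟨a, ha, hsa⟩ := hs
    obtain ⟨D, hDb, hD, hDc, haD, h0⟩ := exists_disk ha
    refine ⟨BQuot.mkLin R '' D, (BQuot.isBounded_iff R).2 ⟨D, hDb, le_rfl⟩, ?_,
      BQuot.isCompletant_image R hDb hD h0 hDc, hsa.trans (Set.image_mono haD)⟩
    rintro _ ⟨x, hx, rfl⟩ _ ⟨y, hy, rfl⟩ a b hab
    exact ⟨a • x + b • y, hD x hx y hy a b hab, by simp⟩

/-- The quotient map. -/
def BQuot.mk : BLin E (BQuot R) :=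
  BLin.of (BQuot.mkLin R) fun s hs => (BQuot.isBounded_iff R).2 ⟨s, hs, le_rfl⟩

theorem BQuot.mk_surjective : Function.Surjective (BQuot.mk R) := BQuot.mkLin_surjective R

theorem BQuot.mk_eq_zero {x : E} : BQuot.mk R x = 0 ↔ x ∈ closedSpan R :=
  BQuot.mkLin_eq_zero R

variable {X : Type v} [AddCommGroup X] [Module ℂ X] [Bornology X] [BornologicalSpace X]

theorem BLin.isBornClosed_ker (f : BLin E X) :
    IsBornClosed { carrier := {x | f x = 0}, add_mem' := fun {a b} (ha : f a = 0) (hb : f b = 0) =>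
                      (by simp [ha, hb] : f (a + b) = 0),
                   zero_mem' := map_zero f,
                   smul_mem' := fun c x (h : f x = 0) => (by simp [h] : f (c • x) = 0) } := by
  intro s x hs hx
  have h := hx.map f
  simp only [show ∀ n, f (s n) = 0 from hs] at h
  exact h.unique (bornTendsto_const 0)

theorem BLin.eq_zero_of_mem_closedSpan {R : Set E} (f : BLin E X) (h : ∀ r ∈ R, f r = 0) {x : E}
    (hx : x ∈ closedSpan R) : f x = 0 :=
  closedSpan_le (R := R) (fun r hr => h r hr) f.isBornClosed_ker hx

variable {R}

/-- The universal property of the quotient. -/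
def BQuot.lift (f : BLin E X) (h : ∀ r ∈ R, f r = 0) : BLin (BQuot R) X :=
  BLin.of ((closedSpan R).liftQ { toFun := f, map_add' := map_add f, map_smul' := map_smul f }
    fun _ hx => f.eq_zero_of_mem_closedSpan h hx) (by
      intro s hs
      obtain ⟨t, ht, hst⟩ := (BQuot.isBounded_iff R).1 hs
      refine (f.bounded ht).subset ?_
      rintro _ ⟨x, hx, rfl⟩
      obtain ⟨y, hy, rfl⟩ := hst hx
      exact ⟨y, hy, rfl⟩)

@[simp] theorem BQuot.lift_mk (f : BLin E X) (h : ∀ r ∈ R, f r = 0) (x : E) :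
    BQuot.lift f h (BQuot.mk R x) = f x := rfl

theorem BQuot.hom_ext {f g : BLin (BQuot R) X} (h : ∀ x, f (BQuot.mk R x) = g (BQuot.mk R x)) :
    f = g := by
  ext y
  obtain ⟨x, rfl⟩ := BQuot.mk_surjective R y
  exact h x

end Quotient

section Ell1

variable (X : Type u) [Bornology X]

/-- Absolutely summable functions on `X` supported in a small set. -/
def ell1 : Submodule ℂ (lp (fun _ : X => ℂ) 1) where
  carrier := {a | ∃ B : Set X, IsBounded B ∧ ∀ x ∉ B, a x = 0}
  add_mem' := by
    rintro a b ⟨B, hB, ha⟩ ⟨C, hC, hb⟩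
    refine ⟨B ∪ C, hB.union hC, fun x hx => ?_⟩
    rw [lp.coeFn_add, Pi.add_apply, ha x fun h => hx (Or.inl h), hb x fun h => hx (Or.inr h),
      add_zero]
  zero_mem' := ⟨∅, isBounded_empty, fun x _ => rfl⟩
  smul_mem' := by
    rintro c a ⟨B, hB, ha⟩
    refine ⟨B, hB, fun x hx => ?_⟩
    rw [lp.coeFn_smul, Pi.smul_apply, ha x hx, smul_zero]

/-- The free complete bornological vector space on the bornological set `X`. -/
def Ell1 : Type u := ell1 X

instance : AddCommGroup (Ell1 X) := inferInstanceAs (AddCommGroup (ell1 X))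
instance : Module ℂ (Ell1 X) := inferInstanceAs (Module ℂ (ell1 X))

variable {X}

/-- The underlying summable function. -/
def Ell1.val : Ell1 X →ₗ[ℂ] lp (fun _ : X => ℂ) 1 := (ell1 X).subtype

theorem Ell1.val_injective : Function.Injective (Ell1.val (X := X)) := Subtype.val_injective

theorem Ell1.exists_support (a : Ell1 X) : ∃ B : Set X, IsBounded B ∧ ∀ x ∉ B, Ell1.val a x = 0 :=
  Subtype.property a

/-- The functions of norm at most `C` supported in `B`. -/
def Ell1.ball (B : Set X) (C : ℝ) : Set (Ell1 X) :=
  {a | (∀ x ∉ B, Ell1.val a x = 0) ∧ ‖Ell1.val a‖ ≤ C}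

theorem Ell1.ball_mono {B B' : Set X} (hB : B ⊆ B') {C C' : ℝ} (hC : C ≤ C') :
    Ell1.ball B C ⊆ Ell1.ball B' C' :=
  fun _ ha => ⟨fun x hx => ha.1 x fun h => hx (hB h), ha.2.trans hC⟩

/-- A set of functions is small iff it is norm bounded and all supports lie in one small set. -/
instance : Bornology (Ell1 X) :=
  Bornology.ofBounded {s | ∃ B : Set X, IsBounded B ∧ ∃ C : ℝ, s ⊆ Ell1.ball B C}
    ⟨∅, isBounded_empty, 0, by simp⟩
    (fun _ ⟨B, hB, C, h⟩ _ h' => ⟨B, hB, C, h'.trans h⟩)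
    (fun _ ⟨B, hB, C, h⟩ _ ⟨B', hB', C', h'⟩ => ⟨B ∪ B', hB.union hB', max C C',
      Set.union_subset (h.trans (Ell1.ball_mono Set.subset_union_left (le_max_left _ _)))
        (h'.trans (Ell1.ball_mono Set.subset_union_right (le_max_right _ _)))⟩)
    (fun a => by
      obtain ⟨B, hB, h⟩ := a.exists_support
      exact ⟨B, hB, ‖Ell1.val a‖, by rintro _ rfl; exact ⟨h, le_rfl⟩⟩)

theorem Ell1.isBounded_iff {s : Set (Ell1 X)} :
    IsBounded s ↔ ∃ B : Set X, IsBounded B ∧ ∃ C : ℝ, s ⊆ Ell1.ball B C :=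
  isBounded_ofBounded_iff _

theorem Ell1.mem_smul_ball {B : Set X} {ε : ℝ} (hε : 0 < ε) {a : Ell1 X} {C : ℝ} :
    a ∈ (ε : ℂ) • Ell1.ball B C ↔ (∀ x ∉ B, Ell1.val a x = 0) ∧ ‖Ell1.val a‖ ≤ ε * C := by
  have hε' : (ε : ℂ) ≠ 0 := by exact_mod_cast hε.ne'
  rw [Set.mem_smul_set_iff_inv_smul_mem₀ hε']
  simp only [Ell1.ball, Set.mem_ofPred_eq, map_smul, lp.coeFn_smul, Pi.smul_apply, norm_smul,
    norm_inv, Complex.norm_real, Real.norm_of_nonneg hε.le, smul_eq_zero, inv_eq_zero, hε',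
    false_or]
  rw [inv_mul_le_iff₀ hε]

instance : BornologicalSpace (Ell1 X) where
  bounded_add := by
    intro s t hs ht
    rw [Ell1.isBounded_iff] at *
    obtain ⟨B, hB, C, h⟩ := hs
    obtain ⟨B', hB', C', h'⟩ := ht
    refine ⟨B ∪ B', hB.union hB', C + C', ?_⟩
    rintro _ ⟨a, ha, b, hb, rfl⟩
    refine ⟨fun x hx => ?_, ?_⟩
    · simp only [map_add, lp.coeFn_add, Pi.add_apply]
      rw [(h ha).1 x fun h => hx (Or.inl h), (h' hb).1 x fun h => hx (Or.inr h), add_zero]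
    · simp only [map_add]
      exact (norm_add_le _ _).trans (add_le_add (h ha).2 (h' hb).2)
  bounded_smul := by
    intro c s hs
    rw [Ell1.isBounded_iff] at *
    obtain ⟨B, hB, C, h⟩ := hs
    refine ⟨B, hB, ‖c‖ * C, ?_⟩
    rintro _ ⟨a, ha, rfl⟩
    refine ⟨fun x hx => ?_, ?_⟩
    · simp only [map_smul, lp.coeFn_smul, Pi.smul_apply]
      rw [(h ha).1 x hx, smul_zero]
    · simp only [map_smul, norm_smul]
      exact mul_le_mul_of_nonneg_left (h ha).2 (norm_nonneg _)
  complete := by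
    intro s hs
    obtain ⟨B, hB, C, h⟩ := Ell1.isBounded_iff.1 hs
    have hC : (0 : ℝ) < |C| + 1 := by positivity
    have hmem : ∀ {ε : ℝ}, 0 < ε → ∀ {a : Ell1 X},
        a ∈ (ε : ℂ) • Ell1.ball B (|C| + 1) ↔
          (∀ x ∉ B, Ell1.val a x = 0) ∧ ‖Ell1.val a‖ ≤ ε * (|C| + 1) :=
      fun hε _ => Ell1.mem_smul_ball hε
    refine ⟨Ell1.ball B (|C| + 1), Ell1.isBounded_iff.2 ⟨B, hB, _, le_rfl⟩, ?_, ⟨?_, ?_⟩,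
      h.trans (Ell1.ball_mono le_rfl (by linarith [le_abs_self C]))⟩
    · rintro a ha b hb c d hcd
      refine ⟨fun x hx => ?_, ?_⟩
      · simp only [map_add, map_smul, lp.coeFn_add, lp.coeFn_smul, Pi.add_apply, Pi.smul_apply]
        rw [ha.1 x hx, hb.1 x hx]
        simp
      · simp only [map_add, map_smul]
        refine (norm_add_le _ _).trans ?_
        rw [norm_smul, norm_smul]
        nlinarith [ha.2, hb.2, norm_nonneg c, norm_nonneg d, norm_nonneg (Ell1.val a),
          norm_nonneg (Ell1.val b), mul_le_mul_of_nonneg_left ha.2 (norm_nonneg c),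
          mul_le_mul_of_nonneg_left hb.2 (norm_nonneg d)]
    · intro a ha
      apply Ell1.val_injective
      rw [map_zero, ← norm_le_zero_iff]
      refine le_of_forall_pos_le_add fun ε hε => ?_
      have := ((hmem (by positivity)).1 (ha (ε / (|C| + 1)) (by positivity))).2
      rwa [div_mul_cancel₀ _ hC.ne', ← zero_add ε] at this
    · intro F hF hCau
      have hsupp : ∀ n, ∀ x ∉ B, Ell1.val (F n) x = 0 := by
        intro n x hx
        have hFn := hF n
        generalize F n = b at hFn
        induction hFn using Submodule.span_induction with
        | mem a ha => exact ha.1 x hx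
        | zero => rfl
        | add a b _ _ h1 h2 => simp [h1, h2]
        | smul c a _ h1 => simp [h1]
      have hcs : CauchySeq fun n => Ell1.val (F n) := by
        rw [Metric.cauchySeq_iff]
        intro ε hε
        obtain ⟨N, hN⟩ := hCau (ε / 2 / (|C| + 1)) (by positivity)
        refine ⟨N, fun m hm n hn => ?_⟩
        have := ((hmem (by positivity)).1 (hN m hm n hn)).2
        rw [div_mul_cancel₀ _ hC.ne', map_sub] at this
        rw [dist_eq_norm]
        linarith
      obtain ⟨g, hg⟩ := cauchySeq_tendsto_of_complete hcs
      have hgs : ∀ x ∉ B, g x = 0 := by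
        intro x hx
        have h1 : Filter.Tendsto (fun n => (Ell1.val (F n)) x) Filter.atTop (nhds (g x)) := by
          rw [tendsto_iff_norm_sub_tendsto_zero] at hg ⊢
          refine squeeze_zero (fun _ => norm_nonneg _) (fun n => ?_) hg
          exact lp.norm_apply_le_norm one_ne_zero (Ell1.val (F n) - g) x
        simp only [hsupp _ x hx] at h1
        exact tendsto_nhds_unique h1 tendsto_const_nhds
      let G : Ell1 X := Subtype.mk g ⟨B, hB, hgs⟩
      have hG : Ell1.val G = g := rfl
      have hconv : ∀ ε : ℝ, 0 < ε → ∃ N, ∀ n ≥ N, F n - G ∈ (ε : ℂ) • Ell1.ball B (|C| + 1) := by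
        intro ε hε
        obtain ⟨N, hN⟩ := (Metric.tendsto_atTop.1 hg) (ε * (|C| + 1)) (by positivity)
        refine ⟨N, fun n hn => (hmem hε).2 ⟨fun x hx => ?_, ?_⟩⟩
        · rw [map_sub, hG, lp.coeFn_sub, Pi.sub_apply, hsupp n x hx, hgs x hx, sub_zero]
        · have := hN n hn
          rw [dist_eq_norm] at this
          rw [map_sub, hG]
          exact this.le
      refine ⟨G, ?_, hconv⟩
      obtain ⟨N, hN⟩ := hconv 1 one_pos
      have := Submodule.sub_mem _ (hF N) (mem_span_of_scale (hN N le_rfl))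
      simpa using this

open scoped Classical in
/-- The point mass at `x`. -/
def Ell1.delta (x : X) : Ell1 X :=
  Subtype.mk (lp.single 1 x (1 : ℂ)) ⟨{x}, isBounded_singleton, fun y hy => by
    rw [lp.single_apply]
    exact Pi.single_eq_of_ne hy _⟩

open scoped Classical in
theorem Ell1.val_delta (x : X) :
    Ell1.val (Ell1.delta x) = lp.single (E := fun _ : X => ℂ) 1 x (1 : ℂ) := rfl

theorem Ell1.delta_apply_self (x : X) : Ell1.val (Ell1.delta x) x = 1 := by
  classical
  rw [Ell1.val_delta, lp.single_apply, Pi.single_eq_same]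

theorem Ell1.delta_apply_of_ne {x y : X} (h : y ≠ x) : Ell1.val (Ell1.delta x) y = 0 := by
  classical
  rw [Ell1.val_delta, lp.single_apply, Pi.single_eq_of_ne h]

theorem Ell1.norm_delta (x : X) : ‖Ell1.val (Ell1.delta x)‖ = 1 := by
  classical
  rw [Ell1.val_delta, lp.norm_single (by norm_num)]
  simp

theorem Ell1.summable (a : Ell1 X) : Summable fun x => ‖Ell1.val a x‖ := by
  have := (lp.hasSum_norm (p := 1) (by norm_num) (Ell1.val a)).summable
  simpa using this

theorem Ell1.sum_norm_le (a : Ell1 X) (s : Finset X) : ∑ x ∈ s, ‖Ell1.val a x‖ ≤ ‖Ell1.val a‖ := by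
  have := lp.hasSum_norm (p := 1) (by norm_num) (Ell1.val a)
  simp only [ENNReal.toReal_one, Real.rpow_one] at this
  exact sum_le_hasSum s (fun _ _ => norm_nonneg _) this

theorem Ell1.hasSum_delta (a : Ell1 X) :
    BornHasSum (fun x => Ell1.val a x • Ell1.delta x) a := by
  classical
  obtain ⟨B, hB, h⟩ := a.exists_support
  obtain ⟨T, hTb, hT, hc, hsub, h0⟩ := exists_disk
    (s := Ell1.ball B 1) (Ell1.isBounded_iff.2 ⟨B, hB, 1, le_rfl⟩)
  have hlim := lp.hasSum_single (E := fun _ : X => ℂ) (p := 1) (by norm_num) (Ell1.val a)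
  have hcoe : ∀ s : Finset X, Ell1.val (∑ x ∈ s, Ell1.val a x • Ell1.delta x) =
      ∑ x ∈ s, lp.single (E := fun _ : X => ℂ) 1 x (Ell1.val a x) := by
    intro s
    rw [map_sum]
    refine Finset.sum_congr rfl fun x _ => ?_
    rw [map_smul, Ell1.val_delta, ← lp.single_smul, smul_eq_mul, mul_one]
  refine ⟨T, hTb, hT, fun ε hε => ?_⟩
  have := (Metric.tendsto_nhds.1 hlim) ε hε
  obtain ⟨s₀, hs₀⟩ := Filter.eventually_atTop.1 this
  refine ⟨s₀, fun s hs => scale_subset hsub ((Ell1.mem_smul_ball hε).2 ⟨fun x hx => ?_, ?_⟩)⟩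
  · rw [map_sub, hcoe, lp.coeFn_sub, Pi.sub_apply, h x hx, zero_sub, neg_eq_zero,
      lp.coeFn_sum, Finset.sum_apply]
    refine Finset.sum_eq_zero fun y _ => ?_
    rw [lp.single_apply]
    by_cases hxy : x = y
    · subst hxy
      simp [h x hx]
    · exact Pi.single_eq_of_ne hxy _
  · have := hs₀ s hs
    rw [dist_eq_norm, ← norm_neg, neg_sub] at this
    rw [map_sub, hcoe, mul_one]
    exact this.le

variable {V : Type v} [AddCommGroup V] [Module ℂ V] [Bornology V] [BornologicalSpace V]

theorem Ell1.hom_ext {f g : BLin (Ell1 X) V} (h : ∀ x, f (Ell1.delta x) = g (Ell1.delta x)) :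
    f = g := by
  ext a
  obtain ⟨s, hs⟩ := a.hasSum_delta.exists_seq
  have h1 := (hs s fun _ => le_rfl).map f
  have h2 := (hs s fun _ => le_rfl).map g
  simp only [map_sum, map_smul, h] at h1 h2
  exact h1.unique h2

theorem Ell1.exists_lift (e : X → V) {B : Set X} {D : Set V} (hD : IsBounded D) (hd : IsDisk D)
    (hc : IsCompletant D) (h0 : (0 : V) ∈ D) (heD : ∀ x ∈ B, e x ∈ D) (a : Ell1 X)
    (ha : ∀ x ∉ B, Ell1.val a x = 0) :
    ∃ y, BornHasSum (fun x => Ell1.val a x • e x) y ∧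
      y ∈ ((1 + ‖Ell1.val a‖ : ℝ) : ℂ) • D := by
  have he : ∀ x, Ell1.val a x ≠ 0 → e x ∈ D := fun x hx =>
    heD x (by by_contra h; exact hx (ha x h))
  obtain ⟨y, hy⟩ := hc.exists_sum hd h0 a.summable he
  refine ⟨y, ⟨D, hD, hd, hy⟩, ?_⟩
  obtain ⟨s, hs⟩ := hy 1 one_pos
  have h1 := hs s le_rfl
  have h2 := hd.scale_mono (Finset.sum_nonneg fun _ _ => norm_nonneg _) (a.sum_norm_le s)
    (hd.scale_sum h0 s (fun x => Ell1.val a x) e fun x _ hx => he x hx)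
  have := hd.scale_add zero_le_one (norm_nonneg _) h1 h2
  rwa [sub_add_cancel] at this

theorem Ell1.exists_lift' (e : X → V) (he : ∀ s : Set X, IsBounded s → IsBounded (e '' s))
    (a : Ell1 X) : ∃ y, BornHasSum (fun x => Ell1.val a x • e x) y := by
  obtain ⟨B, hB, h⟩ := a.exists_support
  obtain ⟨D, hDb, hd, hc, hsub, h0⟩ := exists_disk (he B hB)
  obtain ⟨y, hy, _⟩ := Ell1.exists_lift e hDb hd hc h0 (fun x hx => hsub ⟨x, hx, rfl⟩) a h
  exact ⟨y, hy⟩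

/-- The sum of the series `∑ a x • e x`. -/
def Ell1.series (e : X → V) (he : ∀ s : Set X, IsBounded s → IsBounded (e '' s)) (a : Ell1 X) : V :=
  (Ell1.exists_lift' e he a).choose

theorem Ell1.hasSum_series (e : X → V) (he : ∀ s : Set X, IsBounded s → IsBounded (e '' s))
    (a : Ell1 X) : BornHasSum (fun x => Ell1.val a x • e x) (Ell1.series e he a) :=
  (Ell1.exists_lift' e he a).choose_spec

/-- The universal property of `Ell1 X`: a bounded map `e` from `X` to a complete space extends to
the bounded linear map that sends `a` to the sum of the series `∑ a x • e x`. -/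
def Ell1.lift (e : X → V)
    (he : ∀ s : Set X, IsBounded s → IsBounded (e '' s)) : BLin (Ell1 X) V :=
  BLin.of
    { toFun := Ell1.series e he
      map_add' := fun a b => by
        refine BornHasSum.unique ?_
          ((Ell1.hasSum_series e he a).add (Ell1.hasSum_series e he b))
        have h2 := Ell1.hasSum_series e he (a + b)
        simpa only [map_add, lp.coeFn_add, Pi.add_apply, add_smul] using h2
      map_smul' := fun c a => by
        refine BornHasSum.unique ?_ ((Ell1.hasSum_series e he a).smul c)
        have h2 := Ell1.hasSum_series e he (c • a)
        simpa only [map_smul, lp.coeFn_smul, Pi.smul_apply, smul_eq_mul, mul_smul] using h2 } (by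
    intro s hs
    obtain ⟨B, hB, C, hsC⟩ := Ell1.isBounded_iff.1 hs
    obtain ⟨D, hDb, hd, hc, hsub, h0⟩ := exists_disk (he B hB)
    refine (BornologicalSpace.bounded_smul ((1 + |C| : ℝ) : ℂ) hDb).subset ?_
    rintro _ ⟨a, ha, rfl⟩
    obtain ⟨y, hy, hyD⟩ := Ell1.exists_lift e hDb hd hc h0 (fun x hx => hsub ⟨x, hx, rfl⟩) a
      (hsC ha).1
    have : y = Ell1.series e he a := hy.unique (Ell1.hasSum_series e he a)
    simp only [LinearMap.coe_mk, AddHom.coe_mk]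
    rw [← this]
    exact hd.scale_mono (by positivity)
      (by linarith [(hsC ha).2, le_abs_self C]) hyD)

theorem Ell1.lift_hasSum (e : X → V) (he : ∀ s : Set X, IsBounded s → IsBounded (e '' s))
    (a : Ell1 X) : BornHasSum (fun x => Ell1.val a x • e x) (Ell1.lift e he a) :=
  Ell1.hasSum_series e he a

@[simp] theorem Ell1.lift_delta (e : X → V) (he) (x : X) :
    Ell1.lift e he (Ell1.delta x) = e x := by
  classical
  refine (Ell1.lift_hasSum e he (Ell1.delta x)).unique
    ⟨{0}, isBounded_singleton, ?_, fun ε _ => ⟨{x}, fun s hs => ?_⟩⟩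
  · rintro _ rfl _ rfl a b _
    simp
  · rw [Finset.sum_eq_single_of_mem x (hs (Finset.mem_singleton_self x))
      (fun y _ hy => by rw [Ell1.delta_apply_of_ne hy, zero_smul]), Ell1.delta_apply_self]
    simp

end Ell1

section Tensor

variable (V : Type u) (W : Type v) [AddCommGroup V] [Module ℂ V] [Bornology V]
  [AddCommGroup W] [Module ℂ W] [Bornology W]

/-- The relations of bilinearity. -/
def tensorRel : Set (Ell1 (V × W)) :=
  {r | (∃ x x' y, r = Ell1.delta (x + x', y) - Ell1.delta (x, y) - Ell1.delta (x', y)) ∨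
    (∃ x y y', r = Ell1.delta (x, y + y') - Ell1.delta (x, y) - Ell1.delta (x, y')) ∨
    (∃ (c : ℂ) (x : V) (y : W), r = Ell1.delta (c • x, y) - c • Ell1.delta (x, y)) ∨
    (∃ (c : ℂ) (x : V) (y : W), r = Ell1.delta (x, c • y) - c • Ell1.delta (x, y))}

/-- The completed bornological tensor product of `V` and `W`: the complete bornological
vector space generated by the bornological set `V × W`, modulo the relations of bilinearity.
Its universal property is `BTensor.lift`, `BTensor.lift_tmul` and `BTensor.hom_ext`. -/
def BTensor : Type (max u v) := BQuot (tensorRel V W)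

instance : AddCommGroup (BTensor V W) := inferInstanceAs (AddCommGroup (BQuot (tensorRel V W)))
instance : Module ℂ (BTensor V W) := inferInstanceAs (Module ℂ (BQuot (tensorRel V W)))
instance : Bornology (BTensor V W) := inferInstanceAs (Bornology (BQuot (tensorRel V W)))
instance : BornologicalSpace (BTensor V W) :=
  inferInstanceAs (BornologicalSpace (BQuot (tensorRel V W)))

variable {V W}

/-- The quotient map onto the tensor product. -/
def BTensor.mk : BLin (Ell1 (V × W)) (BTensor V W) := BQuot.mk (tensorRel V W)

theorem BTensor.mk_surjective : Function.Surjective (BTensor.mk (V := V) (W := W)) :=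
  BQuot.mk_surjective _

theorem BTensor.mk_eq_zero {r : Ell1 (V × W)} (h : r ∈ tensorRel V W) : BTensor.mk r = 0 :=
  (BQuot.mk_eq_zero _).2 (subset_closedSpan _ h)

theorem BTensor.exists_of_isBounded {s : Set (BTensor V W)} (hs : IsBounded s) :
    ∃ (S : Set V) (T : Set W) (C : ℝ), IsBounded S ∧ IsBounded T ∧
      s ⊆ BTensor.mk '' Ell1.ball (S ×ˢ T) C := by
  obtain ⟨t, ht, h⟩ := (BQuot.isBounded_iff (tensorRel V W)).1 hs
  obtain ⟨B, hB, C, hC⟩ := Ell1.isBounded_iff.1 ht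
  refine ⟨Prod.fst '' B, Prod.snd '' B, C, hB.image_fst, hB.image_snd, h.trans ?_⟩
  have hsub : B ⊆ (Prod.fst '' B) ×ˢ (Prod.snd '' B) := fun p hp =>
    Set.mk_mem_prod (Set.mem_image_of_mem Prod.fst hp) (Set.mem_image_of_mem Prod.snd hp)
  exact Set.image_mono (hC.trans (Ell1.ball_mono hsub le_rfl))

/-- The bounded bilinear map `(x, y) ↦ x ⊗ y`. -/
def tmul : BLin V (BLin W (BTensor V W)) :=
  BLin.mk₂ (fun x y => BTensor.mk (Ell1.delta (x, y)))
    (fun x x' y => by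
      have := BTensor.mk_eq_zero (Or.inl ⟨x, x', y, rfl⟩ : _ ∈ tensorRel V W)
      rwa [map_sub, map_sub, sub_sub, sub_eq_zero] at this)
    (fun c x y => by
      have := BTensor.mk_eq_zero (Or.inr (Or.inr (Or.inl ⟨c, x, y, rfl⟩)) : _ ∈ tensorRel V W)
      rwa [map_sub, map_smul, sub_eq_zero] at this)
    (fun x y y' => by
      have := BTensor.mk_eq_zero (Or.inr (Or.inl ⟨x, y, y', rfl⟩) : _ ∈ tensorRel V W)
      rwa [map_sub, map_sub, sub_sub, sub_eq_zero] at this)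
    (fun c x y => by
      have := BTensor.mk_eq_zero (Or.inr (Or.inr (Or.inr ⟨c, x, y, rfl⟩)) : _ ∈ tensorRel V W)
      rwa [map_sub, map_smul, sub_eq_zero] at this)
    (fun s t hs ht => by
      have h : IsBounded (Ell1.ball (s ×ˢ t) 1) :=
        Ell1.isBounded_iff.2 ⟨s ×ˢ t, hs.prod ht, 1, le_rfl⟩
      refine (BTensor.mk.bounded h).subset ?_
      rintro _ ⟨x, hx, y, hy, rfl⟩
      refine ⟨_, ⟨fun p hp => Ell1.delta_apply_of_ne ?_, (Ell1.norm_delta _).le⟩, rfl⟩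
      rintro rfl
      exact hp ⟨hx, hy⟩)

theorem tmul_def (x : V) (y : W) : tmul x y = BTensor.mk (Ell1.delta (x, y)) := rfl

variable {X : Type w} [AddCommGroup X] [Module ℂ X] [Bornology X] [BornologicalSpace X]

theorem BTensor.hom_ext {f g : BLin (BTensor V W) X}
    (h : ∀ x y, f (tmul x y) = g (tmul x y)) : f = g := by
  have h1 : f.comp BTensor.mk = g.comp BTensor.mk := Ell1.hom_ext fun p => h p.1 p.2
  ext z
  obtain ⟨a, rfl⟩ := BTensor.mk_surjective z
  exact DFunLike.congr_fun h1 a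

variable [BornologicalSpace V] [BornologicalSpace W]

theorem BLin.bounded_prod (b : BLin V (BLin W X)) (s : Set (V × W)) (hs : IsBounded s) :
    IsBounded ((fun p : V × W => b p.1 p.2) '' s) := by
  refine (b.bounded₂ hs.image_fst hs.image_snd).subset ?_
  rintro _ ⟨p, hp, rfl⟩
  exact ⟨p.1, ⟨p, hp, rfl⟩, p.2, ⟨p, hp, rfl⟩, rfl⟩

/-- A bounded bilinear map induces a bounded linear map on the tensor product. -/
def BTensor.lift (b : BLin V (BLin W X)) : BLin (BTensor V W) X :=
  BQuot.lift (Ell1.lift (fun p => b p.1 p.2) b.bounded_prod) (by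
    rintro r (⟨x, x', y, rfl⟩ | ⟨x, y, y', rfl⟩ | ⟨c, x, y, rfl⟩ | ⟨c, x, y, rfl⟩) <;> simp)

@[simp] theorem BTensor.lift_tmul (b : BLin V (BLin W X)) (x : V) (y : W) :
    BTensor.lift b (tmul x y) = b x y :=
  Ell1.lift_delta (fun p : V × W => b p.1 p.2) b.bounded_prod (x, y)

theorem BTensor.lift_bounded {L : Set (BLin V (BLin W X))} (hL : IsBounded L)
    {s : Set (BTensor V W)} (hs : IsBounded s) :
    IsBounded {y : X | ∃ b ∈ L, ∃ z ∈ s, BTensor.lift b z = y} := by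
  obtain ⟨S, T, C, hS, hT, hsC⟩ := BTensor.exists_of_isBounded hs
  have h1 := BLin.isBounded_iff.1 (BLin.isBounded_iff.1 hL S hS) T hT
  obtain ⟨D, hDb, hd, hc, hsub, h0⟩ := exists_disk h1
  refine (BornologicalSpace.bounded_smul ((1 + |C| : ℝ) : ℂ) hDb).subset ?_
  rintro _ ⟨b, hb, z, hz, rfl⟩
  obtain ⟨a, ha, rfl⟩ := hsC hz
  obtain ⟨y, hy, hyD⟩ := Ell1.exists_lift (fun p : V × W => b p.1 p.2) hDb hd hc h0
    (B := S ×ˢ T) (fun p hp => hsub ⟨b p.1, ⟨b, hb, p.1, hp.1, rfl⟩, p.2, hp.2, rfl⟩) a ha.1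
  have : y = BTensor.lift b (BTensor.mk a) := hy.unique (Ell1.lift_hasSum _ b.bounded_prod a)
  rw [← this]
  exact hd.scale_mono (by positivity) (by linarith [ha.2, le_abs_self C]) hyD

variable {V' : Type*} {W' : Type*} [AddCommGroup V'] [Module ℂ V'] [Bornology V']
  [BornologicalSpace V'] [AddCommGroup W'] [Module ℂ W'] [Bornology W'] [BornologicalSpace W']

/-- The tensor product `f ⊗ g` of bounded linear maps. -/
def BTensor.map (f : BLin V V') (g : BLin W W') : BLin (BTensor V W) (BTensor V' W') :=
  BTensor.lift (BLin.mk₂ (fun x y => tmul (f x) (g y)) (by simp) (by simp) (by simp) (by simp) (by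
    intro s t hs ht
    refine (tmul.bounded₂ (f.bounded hs) (g.bounded ht)).subset ?_
    rintro _ ⟨x, hx, y, hy, rfl⟩
    exact ⟨f x, ⟨x, hx, rfl⟩, g y, ⟨y, hy, rfl⟩, rfl⟩))

@[simp] theorem BTensor.map_tmul (f : BLin V V') (g : BLin W W') (x : V) (y : W) :
    BTensor.map f g (tmul x y) = tmul (f x) (g y) := by
  simp [BTensor.map]

/-- `f ⊗ g` depends on `f` and `g` in a bounded bilinear way. -/
def BTensor.mapB : BLin (BLin V V') (BLin (BLin W W') (BLin (BTensor V W) (BTensor V' W'))) :=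
  BLin.mk₂ BTensor.map
    (fun f f' g => BTensor.hom_ext (by simp))
    (fun c f g => BTensor.hom_ext (by simp))
    (fun f g g' => BTensor.hom_ext (by simp))
    (fun c f g => BTensor.hom_ext (by simp))
    (by
      intro F G hF hG
      rw [BLin.isBounded_iff]
      intro s hs
      have hL : IsBounded (Set.image2 (fun (f : BLin V V') (g : BLin W W') =>
          (BLin.mk₂ (fun x y => tmul (f x) (g y)) (by simp) (by simp) (by simp) (by simp) (by
            intro s t hs ht
            refine (tmul.bounded₂ (f.bounded hs) (g.bounded ht)).subset ?_
            rintro _ ⟨x, hx, y, hy, rfl⟩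
            exact ⟨f x, ⟨x, hx, rfl⟩, g y, ⟨y, hy, rfl⟩, rfl⟩) :
          BLin V (BLin W (BTensor V' W')))) F G) := by
        rw [BLin.isBounded_iff]
        intro S hS
        rw [BLin.isBounded_iff]
        intro T hT
        refine (tmul.bounded₂ (BLin.isBounded_iff.1 hF S hS)
          (BLin.isBounded_iff.1 hG T hT)).subset ?_
        rintro _ ⟨_, ⟨_, ⟨f, hf, g, hg, rfl⟩, x, hx, rfl⟩, y, hy, rfl⟩
        exact ⟨f x, ⟨f, hf, x, hx, rfl⟩, g y, ⟨g, hg, y, hy, rfl⟩, rfl⟩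
      refine (BTensor.lift_bounded hL hs).subset ?_
      rintro _ ⟨_, ⟨f, hf, g, hg, rfl⟩, z, hz, rfl⟩
      exact ⟨_, ⟨f, hf, g, hg, rfl⟩, z, hz, rfl⟩)

@[simp] theorem BTensor.mapB_apply (f : BLin V V') (g : BLin W W') :
    BTensor.mapB f g = BTensor.map f g := rfl

end Tensor

section Algebra

/-- Bornological algebras (not necessarily unital): complete bornological vector spaces with a
bounded bilinear associative multiplication. -/
class BornologicalAlgebra (A : Type u) [NonUnitalRing A] [Module ℂ A] [Bornology A] : Prop
    extends BornologicalSpace A, IsScalarTower ℂ A A, SMulCommClass ℂ A A where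
  bounded_mul : ∀ {s t : Set A}, IsBounded s → IsBounded t → IsBounded (s * t)

variable {A : Type u} [NonUnitalRing A] [Module ℂ A] [Bornology A] [BornologicalAlgebra A]
  {B : Type v} [NonUnitalRing B] [Module ℂ B] [Bornology B] [BornologicalAlgebra B]

variable (A) in
/-- The multiplication as a bounded bilinear map. -/
def mulB : BLin A (BLin A A) :=
  BLin.mk₂ (fun a b => a * b) add_mul (fun c a b => smul_mul_assoc c a b) mul_add
    (fun c a b => mul_smul_comm c a b) (fun _ _ hs ht => BornologicalAlgebra.bounded_mul hs ht)

@[simp] theorem mulB_apply (a b : A) : mulB A a b = a * b := rfl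

/-- The bilinear map `(a, b) ↦ f a ⊗ g b` for `f`, `g` with values in operators. -/
def BTensor.opB {V V' W W' H K : Type*}
    [AddCommGroup V] [Module ℂ V] [Bornology V] [BornologicalSpace V]
    [AddCommGroup W] [Module ℂ W] [Bornology W] [BornologicalSpace W]
    [AddCommGroup V'] [Module ℂ V'] [Bornology V'] [BornologicalSpace V']
    [AddCommGroup W'] [Module ℂ W'] [Bornology W'] [BornologicalSpace W']
    [AddCommGroup H] [Module ℂ H] [Bornology H] [BornologicalSpace H]
    [AddCommGroup K] [Module ℂ K] [Bornology K] [BornologicalSpace K]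
    (f : BLin H (BLin V V')) (g : BLin K (BLin W W')) :
    BLin (BTensor H K) (BLin (BTensor V W) (BTensor V' W')) :=
  BTensor.lift (BLin.mk₂ (fun x y => BTensor.mapB (f x) (g y)) (fun x x' y => by simp only [map_add, BLin.add_apply])
    (fun c x y => by simp only [map_smul, BLin.smul_apply])
    (fun x y y' => by simp only [map_add])
    (fun c x y => by simp only [map_smul])
    (by
      intro s t hs ht
      refine (BTensor.mapB.bounded₂ (f.bounded hs) (g.bounded ht)).subset ?_
      rintro _ ⟨x, hx, y, hy, rfl⟩
      exact ⟨f x, ⟨x, hx, rfl⟩, g y, ⟨y, hy, rfl⟩, rfl⟩))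

@[simp] theorem BTensor.opB_tmul {V V' W W' H K : Type*}
    [AddCommGroup V] [Module ℂ V] [Bornology V] [BornologicalSpace V]
    [AddCommGroup W] [Module ℂ W] [Bornology W] [BornologicalSpace W]
    [AddCommGroup V'] [Module ℂ V'] [Bornology V'] [BornologicalSpace V']
    [AddCommGroup W'] [Module ℂ W'] [Bornology W'] [BornologicalSpace W']
    [AddCommGroup H] [Module ℂ H] [Bornology H] [BornologicalSpace H]
    [AddCommGroup K] [Module ℂ K] [Bornology K] [BornologicalSpace K]
    (f : BLin H (BLin V V')) (g : BLin K (BLin W W')) (x : H) (y : K) :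
    BTensor.opB f g (tmul x y) = BTensor.map (f x) (g y) := by
  simp [BTensor.opB]

/-- The multiplication `(a ⊗ b)(c ⊗ d) = ac ⊗ bd` of the tensor product. -/
instance : Mul (BTensor A B) := ⟨fun z w => BTensor.opB (mulB A) (mulB B) z w⟩

theorem BTensor.mul_def (z w : BTensor A B) : z * w = BTensor.opB (mulB A) (mulB B) z w := rfl

@[simp] theorem tmul_mul_tmul (a c : A) (b d : B) :
    (tmul a b * tmul c d : BTensor A B) = tmul (a * c) (b * d) := by
  simp [BTensor.mul_def]

theorem BTensor.add_mul' (x y z : BTensor A B) : (x + y) * z = x * z + y * z := by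
  simp [BTensor.mul_def]

theorem BTensor.mul_add' (x y z : BTensor A B) : x * (y + z) = x * y + x * z := by
  simp [BTensor.mul_def]

theorem BTensor.smul_mul' (c : ℂ) (x y : BTensor A B) : (c • x) * y = c • (x * y) := by
  simp [BTensor.mul_def]

theorem BTensor.mul_smul' (c : ℂ) (x y : BTensor A B) : x * (c • y) = c • (x * y) := by
  simp [BTensor.mul_def]

theorem BTensor.bounded_mul' {s t : Set (BTensor A B)} (hs : IsBounded s) (ht : IsBounded t) :
    IsBounded (s * t) := by
  refine (BLin.bounded₂ (BTensor.opB (mulB A) (mulB B)) hs ht).subset ?_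
  rintro _ ⟨x, hx, y, hy, rfl⟩
  exact ⟨x, hx, y, hy, rfl⟩

/-- The multiplication of the tensor product as a bilinear map. -/
def BTensor.mulB' : BLin (BTensor A B) (BLin (BTensor A B) (BTensor A B)) :=
  BTensor.opB (mulB A) (mulB B)

theorem BTensor.mul_assoc' (x y z : BTensor A B) : x * y * z = x * (y * z) := by
  let m : BLin (BTensor A B) (BLin (BTensor A B) (BTensor A B)) := BTensor.mulB'
  have h1 : ∀ a b c d (w : BTensor A B), m (m (tmul a b) (tmul c d)) w =
      m (tmul a b) (m (tmul c d) w) := by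
    intro a b c d w
    refine DFunLike.congr_fun (f := m (m (tmul a b) (tmul c d)))
      (g := (m (tmul a b)).comp (m (tmul c d))) (BTensor.hom_ext fun e f => ?_) w
    change (tmul a b * tmul c d : BTensor A B) * tmul e f = tmul a b * (tmul c d * tmul e f)
    simp [mul_assoc]
  have h2 : ∀ a b (v w : BTensor A B), m (m (tmul a b) v) w = m (tmul a b) (m v w) := by
    intro a b v w
    refine DFunLike.congr_fun (f := (m.flip w).comp (m (tmul a b)))
      (g := (m (tmul a b)).comp (m.flip w)) (BTensor.hom_ext fun e f => ?_) v
    exact h1 a b e f w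
  refine DFunLike.congr_fun (f := (m.flip z).comp (m.flip y))
      (g := m.flip (m y z)) (BTensor.hom_ext fun e f => ?_) x
  exact h2 e f y z

instance : NonUnitalRing (BTensor A B) :=
  { (inferInstance : AddCommGroup (BTensor A B)), (inferInstance : Mul (BTensor A B)) with
    left_distrib := BTensor.mul_add'
    right_distrib := BTensor.add_mul'
    zero_mul := fun x => by
      have := BTensor.smul_mul' 0 (0 : BTensor A B) x
      simpa using this
    mul_zero := fun x => by
      have := BTensor.mul_smul' 0 x (0 : BTensor A B)
      simpa using this
    mul_assoc := BTensor.mul_assoc' }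

instance : BornologicalAlgebra (BTensor A B) where
  smul_assoc := fun c x y => BTensor.smul_mul' c x y
  smul_comm := fun c x y => (BTensor.mul_smul' c x y).symm
  bounded_mul := BTensor.bounded_mul'

/-- The complex numbers form a bornological algebra. -/
instance : BornologicalSpace ℂ where
  bounded_add := fun hs ht => hs.add ht
  bounded_smul := fun c s hs => by
    obtain ⟨C, hC⟩ := hs.exists_norm_le
    refine isBounded_iff_forall_norm_le.2 ⟨‖c‖ * C, ?_⟩
    rintro _ ⟨x, hx, rfl⟩
    simpa using mul_le_mul_of_nonneg_left (hC x hx) (norm_nonneg c)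
  complete := by
    intro s hs
    obtain ⟨C, hC⟩ := hs.exists_norm_le
    have hC0 : (0 : ℝ) < |C| + 1 := by positivity
    have hmem : ∀ {ε : ℝ}, 0 < ε → ∀ {z : ℂ},
        z ∈ (ε : ℂ) • {z : ℂ | ‖z‖ ≤ |C| + 1} ↔ ‖z‖ ≤ ε * (|C| + 1) := by
      intro ε hε z
      have hε' : (ε : ℂ) ≠ 0 := by exact_mod_cast hε.ne'
      rw [Set.mem_smul_set_iff_inv_smul_mem₀ hε', Set.mem_ofPred_eq, norm_smul, norm_inv,
        Complex.norm_real, Real.norm_of_nonneg hε.le, inv_mul_le_iff₀ hε]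
    refine ⟨{z | ‖z‖ ≤ |C| + 1}, ?_, ?_, ⟨?_, ?_⟩, ?_⟩
    · exact isBounded_iff_forall_norm_le.2 ⟨_, fun z hz => hz⟩
    · intro x hx y hy a b hab
      rw [Set.mem_ofPred_eq] at *
      refine (norm_add_le _ _).trans ?_
      rw [norm_smul, norm_smul]
      nlinarith [mul_le_mul_of_nonneg_left hx (norm_nonneg a),
        mul_le_mul_of_nonneg_left hy (norm_nonneg b)]
    · intro x hx
      rw [← norm_le_zero_iff]
      refine le_of_forall_pos_le_add fun ε hε => ?_
      have := (hmem (by positivity)).1 (hx (ε / (|C| + 1)) (by positivity))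
      rwa [div_mul_cancel₀ _ hC0.ne', ← zero_add ε] at this
    · intro f _ hf
      have hcs : CauchySeq f := by
        rw [Metric.cauchySeq_iff]
        intro ε hε
        obtain ⟨N, hN⟩ := hf (ε / 2 / (|C| + 1)) (by positivity)
        refine ⟨N, fun m hm n hn => ?_⟩
        have := (hmem (by positivity)).1 (hN m hm n hn)
        rw [div_mul_cancel₀ _ hC0.ne'] at this
        rw [dist_eq_norm]
        linarith
      obtain ⟨g, hg⟩ := cauchySeq_tendsto_of_complete hcs
      refine ⟨g, ?_, fun ε hε => ?_⟩
      · have h1 : (1 : ℂ) ∈ {z : ℂ | ‖z‖ ≤ |C| + 1} := by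
          simp
        simpa using Submodule.smul_mem (Submodule.span ℂ {z : ℂ | ‖z‖ ≤ |C| + 1}) g
          (Submodule.subset_span h1)
      · obtain ⟨N, hN⟩ := (Metric.tendsto_atTop.1 hg) (ε * (|C| + 1)) (by positivity)
        refine ⟨N, fun n hn => (hmem hε).2 ?_⟩
        rw [← dist_eq_norm]
        exact (hN n hn).le
    · intro z hz
      exact (hC z hz).trans (by linarith [le_abs_self C])

instance : BornologicalAlgebra ℂ where
  bounded_mul := fun {s t} hs ht => by
    obtain ⟨C, hC⟩ := hs.exists_norm_le
    obtain ⟨C', hC'⟩ := ht.exists_norm_le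
    refine isBounded_iff_forall_norm_le.2 ⟨|C| * |C'|, ?_⟩
    rintro _ ⟨x, hx, y, hy, rfl⟩
    simp only [norm_mul]
    exact mul_le_mul ((hC x hx).trans (le_abs_self C)) ((hC' y hy).trans (le_abs_self C'))
      (norm_nonneg _) (abs_nonneg _)

end Algebra

section Balanced

variable {A M N P : Type*}
  [AddCommGroup A] [Module ℂ A] [Bornology A] [BornologicalSpace A]
  [AddCommGroup M] [Module ℂ M] [Bornology M] [BornologicalSpace M]
  [AddCommGroup N] [Module ℂ N] [Bornology N] [BornologicalSpace N]
  [AddCommGroup P] [Module ℂ P] [Bornology P] [BornologicalSpace P]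

/-- The relations `ma ⊗ n = m ⊗ an`, for a right action `r` of `A` on `M` and a left action `l`
of `A` on `N`. -/
def balancedRel (r : BLin M (BLin A M)) (l : BLin A (BLin N N)) : Set (BTensor M N) :=
  {t | ∃ m a n, t = tmul (r m a) n - tmul m (l a n)}

/-- The tensor product of `M` and `N` over `A`. -/
def BalTensor (r : BLin M (BLin A M)) (l : BLin A (BLin N N)) := BQuot (balancedRel r l)

variable (r : BLin M (BLin A M)) (l : BLin A (BLin N N))

instance : AddCommGroup (BalTensor r l) := inferInstanceAs (AddCommGroup (BQuot (balancedRel r l)))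
instance : Module ℂ (BalTensor r l) := inferInstanceAs (Module ℂ (BQuot (balancedRel r l)))
instance : Bornology (BalTensor r l) := inferInstanceAs (Bornology (BQuot (balancedRel r l)))
instance : BornologicalSpace (BalTensor r l) :=
  inferInstanceAs (BornologicalSpace (BQuot (balancedRel r l)))

/-- The quotient map from the tensor product to the balanced tensor product. -/
def BalTensor.mk : BLin (BTensor M N) (BalTensor r l) := BQuot.mk (balancedRel r l)

theorem BalTensor.mk_surjective : Function.Surjective (BalTensor.mk r l) := BQuot.mk_surjective _

theorem BalTensor.mk_rel (m : M) (a : A) (n : N) :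
    BalTensor.mk r l (tmul (r m a) n) = BalTensor.mk r l (tmul m (l a n)) := by
  rw [← sub_eq_zero, ← map_sub]
  exact (BQuot.mk_eq_zero _).2 (subset_closedSpan _ ⟨m, a, n, rfl⟩)

variable {r l}

theorem BalTensor.hom_ext {f g : BLin (BalTensor r l) P}
    (h : ∀ m n, f (BalTensor.mk r l (tmul m n)) = g (BalTensor.mk r l (tmul m n))) : f = g := by
  have h1 : f.comp (BalTensor.mk r l) = g.comp (BalTensor.mk r l) := BTensor.hom_ext h
  ext z
  obtain ⟨a, rfl⟩ := BalTensor.mk_surjective r l z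
  exact DFunLike.congr_fun h1 a

/-- The map on the balanced tensor product induced by a balanced bounded bilinear map. -/
def BalTensor.lift (b : BLin M (BLin N P)) (h : ∀ m a n, b (r m a) n = b m (l a n)) :
    BLin (BalTensor r l) P :=
  BQuot.lift (BTensor.lift b) (by
    rintro _ ⟨m, a, n, rfl⟩
    simp [h])

@[simp] theorem BalTensor.lift_mk (b : BLin M (BLin N P))
    (h : ∀ m a n, b (r m a) n = b m (l a n)) (z : BTensor M N) :
    BalTensor.lift b h (BalTensor.mk r l z) = BTensor.lift b z := rfl

variable (r l)

/-- The bilinear map `b` is balanced and induces an isomorphism of `P` with the tensor product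
of `M` and `N` over `A`. -/
def IsBalancedIso (b : BLin M (BLin N P)) : Prop :=
  ∃ h : ∀ m a n, b (r m a) n = b m (l a n), IsBornIso (BalTensor.lift (r := r) (l := l) b h)

variable {r l}

theorem IsBalancedIso.surjective {b : BLin M (BLin N P)} (h : IsBalancedIso r l b) :
    Function.Surjective (BTensor.lift b) := by
  obtain ⟨h, g, _, hg⟩ := h
  intro y
  obtain ⟨z, hz⟩ := BalTensor.mk_surjective r l (g y)
  exact ⟨z, by rw [← hg y, ← hz]; rfl⟩

theorem eq_zero_of_surjective {X : Type*} [AddCommGroup X] [Module ℂ X] [Bornology X]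
    [BornologicalSpace X] {b : BLin M (BLin N P)}
    (hb : Function.Surjective (BTensor.lift b)) (T : BLin P X)
    (h : ∀ m n, T (b m n) = 0) (p : P) : T p = 0 := by
  have : T.comp (BTensor.lift b) = 0 := BTensor.hom_ext (by simpa using h)
  obtain ⟨z, rfl⟩ := hb p
  exact DFunLike.congr_fun this z

/-- Composition with a fixed map. -/
def BLin.postcomp {V X Y : Type*} [AddCommGroup V] [Module ℂ V] [Bornology V]
    [BornologicalSpace V] [AddCommGroup X] [Module ℂ X] [Bornology X] [BornologicalSpace X]
    [AddCommGroup Y] [Module ℂ Y] [Bornology Y] [BornologicalSpace Y] (p : BLin X Y) :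
    BLin (BLin V X) (BLin V Y) :=
  BLin.mk₂ (fun f x => p (f x)) (by simp) (by simp) (by simp) (by simp) (by
    intro s t hs ht
    refine (p.bounded (BLin.isBounded_iff.1 hs t ht)).subset ?_
    rintro _ ⟨f, hf, x, hx, rfl⟩
    exact ⟨f x, ⟨f, hf, x, hx, rfl⟩, rfl⟩)

@[simp] theorem BLin.postcomp_apply {V X Y : Type*} [AddCommGroup V] [Module ℂ V] [Bornology V]
    [BornologicalSpace V] [AddCommGroup X] [Module ℂ X] [Bornology X] [BornologicalSpace X]
    [AddCommGroup Y] [Module ℂ Y] [Bornology Y] [BornologicalSpace Y] (p : BLin X Y)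
    (f : BLin V X) (x : V) : BLin.postcomp p f x = p (f x) := rfl

variable {A' M' N' P' : Type*}
  [AddCommGroup A'] [Module ℂ A'] [Bornology A'] [BornologicalSpace A']
  [AddCommGroup M'] [Module ℂ M'] [Bornology M'] [BornologicalSpace M']
  [AddCommGroup N'] [Module ℂ N'] [Bornology N'] [BornologicalSpace N']
  [AddCommGroup P'] [Module ℂ P'] [Bornology P'] [BornologicalSpace P']

/-- Compatibility of balanced tensor products with tensor products of algebras. -/
theorem IsBalancedIso.tensor {r : BLin M (BLin A M)} {l : BLin A (BLin N N)}
    {b : BLin M (BLin N P)} (h : IsBalancedIso r l b)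
    {r' : BLin M' (BLin A' M')} {l' : BLin A' (BLin N' N')}
    {b' : BLin M' (BLin N' P')} (h' : IsBalancedIso r' l' b')
    (hr : Function.Surjective (BTensor.lift r)) (hr' : Function.Surjective (BTensor.lift r'))
    (m : BLin A (BLin A A)) (m' : BLin A' (BLin A' A'))
    (hrm : ∀ x a c, r (r x a) c = r x (m a c)) (hrm' : ∀ x a c, r' (r' x a) c = r' x (m' a c))
    (hlm : ∀ a c x, l a (l c x) = l (m a c) x) (hlm' : ∀ a c x, l' a (l' c x) = l' (m' a c) x) :
    IsBalancedIso (BTensor.opB r r') (BTensor.opB l l') (BTensor.opB b b') := by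
  have hbal : ∀ z a w, BTensor.opB b b' (BTensor.opB r r' z a) w =
      BTensor.opB b b' z (BTensor.opB l l' a w) := by
    intro z a w
    refine DFunLike.congr_fun (f := ((BTensor.opB b b').flip w).comp ((BTensor.opB r r').flip a))
      (g := (BTensor.opB b b').flip (BTensor.opB l l' a w)) (BTensor.hom_ext fun x x' => ?_) z
    refine DFunLike.congr_fun
      (f := ((BTensor.opB b b').flip w).comp (BTensor.opB r r' (tmul x x')))
      (g := (BTensor.opB b b' (tmul x x')).comp ((BTensor.opB l l').flip w))
      (BTensor.hom_ext fun c c' => ?_) a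
    refine DFunLike.congr_fun
      (f := BTensor.opB b b' (BTensor.opB r r' (tmul x x') (tmul c c')))
      (g := (BTensor.opB b b' (tmul x x')).comp (BTensor.opB l l' (tmul c c')))
      (BTensor.hom_ext fun y y' => ?_) w
    simp [h.choose, h'.choose]
  obtain ⟨h1, g, hgl, hgr⟩ := h
  obtain ⟨h1', g', hgl', hgr'⟩ := h'
  let R := BTensor.opB r r'
  let L := BTensor.opB l l'
  let π : BLin (BTensor (BTensor M M') (BTensor N N')) (BalTensor R L) := BalTensor.mk R L
  let Θ : BLin (BTensor M N) (BLin (BTensor M' N') (BalTensor R L)) :=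
    (BLin.postcomp π).comp (BTensor.opB tmul tmul)
  have hΘ : ∀ x y x' y', Θ (tmul x y) (tmul x' y') = π (tmul (tmul x x') (tmul y y')) := by
    intro x y x' y'
    simp [Θ]
  have hπ : ∀ x x' a a' y y', π (tmul (tmul (r x a) (r' x' a')) (tmul y y')) =
      π (tmul (tmul x x') (tmul (l a y) (l' a' y'))) := by
    intro x x' a a' y y'
    have := BalTensor.mk_rel R L (tmul x x') (tmul a a') (tmul y y')
    simpa [R, L] using this
  -- `T` vanishes on `M ⊗ M'` as soon as it vanishes on products
  have hdense : ∀ (T : BLin M (BLin M' (BalTensor R L))),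
      (∀ x a x' a', T (r x a) (r' x' a') = 0) → ∀ x x', T x x' = 0 := by
    intro T hT x x'
    refine eq_zero_of_surjective hr (T.flip x') (fun y a => ?_) x
    exact eq_zero_of_surjective hr' (T (r y a)) (fun y' a' => hT y a y' a') x'
  have hk1 : ∀ x a y x' y', Θ (tmul (r x a) y - tmul x (l a y)) (tmul x' y') = 0 := by
    intro x a y x' y'
    let T : BLin M (BLin M' (BalTensor R L)) :=
      (((BLin.postcomp (π.comp ((tmul (V := BTensor M M')).flip (tmul y y')))).comp
        (tmul (V := M) (W := M'))).comp (r.flip a)) -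
      ((BLin.postcomp (π.comp ((tmul (V := BTensor M M')).flip (tmul (l a y) y')))).comp
        (tmul (V := M) (W := M')))
    have hT : ∀ x x', T x x' = π (tmul (tmul (r x a) x') (tmul y y')) -
        π (tmul (tmul x x') (tmul (l a y) y')) := fun _ _ => rfl
    rw [map_sub, BLin.sub_apply, hΘ, hΘ, ← hT]
    refine hdense T (fun x c x' c' => ?_) x x'
    rw [hT, hrm, hπ, hπ, hlm, sub_self]
  have hk2 : ∀ x y x' a' y', Θ (tmul x y) (tmul (r' x' a') y' - tmul x' (l' a' y')) = 0 := by
    intro x y x' a' y'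
    let T : BLin M (BLin M' (BalTensor R L)) :=
      (((BLin.postcomp (π.comp ((tmul (V := BTensor M M')).flip (tmul y y')))).comp
        (tmul (V := M) (W := M'))).flip.comp (r'.flip a')).flip -
      ((BLin.postcomp (π.comp ((tmul (V := BTensor M M')).flip (tmul y (l' a' y'))))).comp
        (tmul (V := M) (W := M')))
    have hT : ∀ x x', T x x' = π (tmul (tmul x (r' x' a')) (tmul y y')) -
        π (tmul (tmul x x') (tmul y (l' a' y'))) := fun _ _ => rfl
    rw [map_sub, hΘ, hΘ, ← hT]
    refine hdense T (fun x c x' c' => ?_) x x'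
    rw [hT, hrm', hπ, hπ, hlm', sub_self]
  have hK1 : ∀ t ∈ balancedRel r l, Θ t = 0 := by
    rintro _ ⟨x, a, y, rfl⟩
    exact BTensor.hom_ext fun x' y' => hk1 x a y x' y'
  let Φ₁ : BLin (BalTensor r l) (BLin (BTensor M' N') (BalTensor R L)) := BQuot.lift Θ hK1
  have hK2 : ∀ t ∈ balancedRel r' l', Φ₁.flip t = 0 := by
    rintro _ ⟨x', a', y', rfl⟩
    exact BalTensor.hom_ext fun x y => hk2 x y x' a' y'
  let Φ : BLin (BalTensor r l) (BLin (BalTensor r' l') (BalTensor R L)) :=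
    (BQuot.lift Φ₁.flip hK2 : BLin (BalTensor r' l') (BLin (BalTensor r l) (BalTensor R L))).flip
  have hΦ : ∀ x y x' y', Φ (BalTensor.mk r l (tmul x y)) (BalTensor.mk r' l' (tmul x' y')) =
      π (tmul (tmul x x') (tmul y y')) := hΘ
  let c : BLin (BalTensor R L) (BTensor P P') := BalTensor.lift (BTensor.opB b b') hbal
  let c₁ := BalTensor.lift (r := r) (l := l) b h1
  let c₂ := BalTensor.lift (r := r') (l := l') b' h1'
  have hc : ∀ p p', c (Φ p p') = tmul (c₁ p) (c₂ p') := by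
    intro p p'
    refine DFunLike.congr_fun (f := c.comp (Φ.flip p')) (g := (tmul.flip (c₂ p')).comp c₁)
      (BalTensor.hom_ext fun x y => ?_) p
    refine DFunLike.congr_fun (f := c.comp (Φ (BalTensor.mk r l (tmul x y))))
      (g := (tmul (c₁ (BalTensor.mk r l (tmul x y)))).comp c₂)
      (BalTensor.hom_ext fun x' y' => ?_) p'
    simp only [BLin.comp_apply]
    rw [hΦ]
    simp [c, π, c₁, c₂]
  let G : BLin (BTensor P P') (BalTensor R L) :=
    BTensor.lift (((Φ.comp g).flip.comp g').flip)
  have hG : ∀ y y', G (tmul y y') = Φ (g y) (g' y') := by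
    intro y y'
    simp [G]
  refine ⟨hbal, G, ?_, ?_⟩
  · intro q
    refine DFunLike.congr_fun (f := G.comp c) (g := BLin.id _)
      (BalTensor.hom_ext fun z w => ?_) q
    refine DFunLike.congr_fun (f := (G.comp (c.comp π)).comp (tmul.flip w))
      (g := π.comp (tmul.flip w)) (BTensor.hom_ext fun x x' => ?_) z
    refine DFunLike.congr_fun (f := (G.comp (c.comp π)).comp (tmul (tmul x x')))
      (g := π.comp (tmul (tmul x x'))) (BTensor.hom_ext fun y y' => ?_) w
    have hcπ : c (π (tmul (tmul x x') (tmul y y'))) = tmul (b x y) (b' x' y') := by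
      simp [c, π]
    simp only [BLin.comp_apply, hcπ, hG]
    rw [← hΦ x y x' y']
    congr 1
    · congr 1
      have := hgl (BalTensor.mk r l (tmul x y))
      simpa using this
    · have := hgl' (BalTensor.mk r' l' (tmul x' y'))
      simpa using this
  · intro q
    refine DFunLike.congr_fun (f := c.comp G) (g := BLin.id _)
      (BTensor.hom_ext fun y y' => ?_) q
    simp only [BLin.comp_apply, hG, hc, BLin.id_apply]
    rw [show c₁ (g y) = y from hgr y, show c₂ (g' y') = y' from hgr' y']

end Balanced

section Multipliers

variable (A : Type u) [NonUnitalRing A] [Module ℂ A] [Bornology A] [BornologicalAlgebra A]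

/-- The pairs `(L, R)` of a left and a right multiplier with `x L(y) = R(x) y`. -/
def multipliers : Submodule ℂ (BLin A A × BLin A A) where
  carrier := {p | (∀ x y, p.1 (x * y) = p.1 x * y) ∧ (∀ x y, p.2 (x * y) = x * p.2 y) ∧
    ∀ x y, x * p.1 y = p.2 x * y}
  add_mem' := by
    rintro p q ⟨h1, h2, h3⟩ ⟨h1', h2', h3'⟩
    refine ⟨fun x y => ?_, fun x y => ?_, fun x y => ?_⟩
    · simp [h1, h1', add_mul]
    · simp [h2, h2', mul_add]
    · simp [h3, h3', mul_add, add_mul]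
  zero_mem' := by simp
  smul_mem' := by
    rintro c p ⟨h1, h2, h3⟩
    refine ⟨fun x y => ?_, fun x y => ?_, fun x y => ?_⟩
    · simp [h1, smul_mul_assoc]
    · simp [h2, mul_smul_comm]
    · simp [h3, mul_smul_comm, smul_mul_assoc]

/-- The multiplier algebra `M(A)`. -/
def Mult : Type u := multipliers A

instance : AddCommGroup (Mult A) := inferInstanceAs (AddCommGroup (multipliers A))
instance : Module ℂ (Mult A) := inferInstanceAs (Module ℂ (multipliers A))
/-- The bornology of `M(A)` is inherited from `Hom(A, A) × Hom(A, A)`. -/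
instance : Bornology (Mult A) :=
  Bornology.induced (fun m : Mult A => (Subtype.val m : BLin A A × BLin A A))

variable {A}

/-- Left multiplication by a multiplier, `m.L x = m · x`. -/
def Mult.L (m : Mult A) : BLin A A := (Subtype.val m : BLin A A × BLin A A).1

/-- Right multiplication by a multiplier, `m.R x = x · m`. -/
def Mult.R (m : Mult A) : BLin A A := (Subtype.val m : BLin A A × BLin A A).2

/-- The multiplier with given left and right parts. -/
def Mult.of (L R : BLin A A) (h1 : ∀ x y, L (x * y) = L x * y) (h2 : ∀ x y, R (x * y) = x * R y)
    (h3 : ∀ x y, x * L y = R x * y) : Mult A := Subtype.mk (L, R) ⟨h1, h2, h3⟩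

@[simp] theorem Mult.of_L (L R : BLin A A) (h1 h2 h3) : (Mult.of L R h1 h2 h3).L = L := rfl
@[simp] theorem Mult.of_R (L R : BLin A A) (h1 h2 h3) : (Mult.of L R h1 h2 h3).R = R := rfl
@[simp] theorem Mult.add_L (m n : Mult A) : (m + n).L = m.L + n.L := rfl
@[simp] theorem Mult.add_R (m n : Mult A) : (m + n).R = m.R + n.R := rfl
@[simp] theorem Mult.smul_L (c : ℂ) (m : Mult A) : (c • m).L = c • m.L := rfl
@[simp] theorem Mult.smul_R (c : ℂ) (m : Mult A) : (c • m).R = c • m.R := rfl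

theorem Mult.L_mul (m : Mult A) (x y : A) : m.L (x * y) = m.L x * y := (Subtype.property m).1 x y
theorem Mult.R_mul (m : Mult A) (x y : A) : m.R (x * y) = x * m.R y :=
  (Subtype.property m).2.1 x y
theorem Mult.compat (m : Mult A) (x y : A) : x * m.L y = m.R x * y :=
  (Subtype.property m).2.2 x y

@[ext] theorem Mult.ext {m n : Mult A} (hL : ∀ x, m.L x = n.L x) (hR : ∀ x, m.R x = n.R x) :
    m = n :=
  Subtype.ext (Prod.ext (BLin.ext hL) (BLin.ext hR))

theorem Mult.isBounded_iff {s : Set (Mult A)} :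
    IsBounded s ↔ IsBounded (Mult.L '' s) ∧ IsBounded (Mult.R '' s) := by
  rw [Bornology.isBounded_induced]
  constructor
  · intro h
    refine ⟨h.image_fst.subset ?_, h.image_snd.subset ?_⟩
    · rintro _ ⟨m, hm, rfl⟩
      exact ⟨_, ⟨m, hm, rfl⟩, rfl⟩
    · rintro _ ⟨m, hm, rfl⟩
      exact ⟨_, ⟨m, hm, rfl⟩, rfl⟩
  · rintro ⟨h1, h2⟩
    refine (h1.prod h2).subset ?_
    rintro _ ⟨m, hm, rfl⟩
    exact Set.mk_mem_prod ⟨m, hm, rfl⟩ ⟨m, hm, rfl⟩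

instance : One (Mult A) :=
  ⟨Mult.of (BLin.id A) (BLin.id A) (fun _ _ => rfl) (fun _ _ => rfl) (fun _ _ => rfl)⟩

instance : Mul (Mult A) :=
  ⟨fun m n => Mult.of (m.L.comp n.L) (n.R.comp m.R)
    (fun x y => by simp [Mult.L_mul]) (fun x y => by simp [Mult.R_mul])
    (fun x y => by simp [Mult.compat])⟩

@[simp] theorem Mult.one_L (x : A) : (1 : Mult A).L x = x := rfl
@[simp] theorem Mult.one_R (x : A) : (1 : Mult A).R x = x := rfl
@[simp] theorem Mult.mul_L (m n : Mult A) (x : A) : (m * n).L x = m.L (n.L x) := rfl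
@[simp] theorem Mult.mul_R (m n : Mult A) (x : A) : (m * n).R x = n.R (m.R x) := rfl

/-- The canonical map `ι : A → M(A)`. -/
def Mult.ι (a : A) : Mult A :=
  Mult.of (mulB A a) ((mulB A).flip a) (fun x y => by simp [mul_assoc])
    (fun x y => by simp [mul_assoc]) (fun x y => by simp [mul_assoc])

@[simp] theorem Mult.ι_L (a x : A) : (Mult.ι a).L x = a * x := rfl
@[simp] theorem Mult.ι_R (a x : A) : (Mult.ι a).R x = x * a := rfl

variable {B : Type v} [NonUnitalRing B] [Module ℂ B] [Bornology B] [BornologicalAlgebra B]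

/-- The multiplier `m ⊗ n` of `A ⊗ B`. -/
def Mult.tensor (m : Mult A) (n : Mult B) : Mult (BTensor A B) :=
  Mult.of (BTensor.map m.L n.L) (BTensor.map m.R n.R)
    (fun z w => by
      refine DFunLike.congr_fun
        (f := (BTensor.map m.L n.L).comp ((mulB (BTensor A B)).flip w))
        (g := ((mulB (BTensor A B)).flip w).comp (BTensor.map m.L n.L))
        (BTensor.hom_ext fun a b => ?_) z
      refine DFunLike.congr_fun
        (f := (BTensor.map m.L n.L).comp (mulB (BTensor A B) (tmul a b)))
        (g := mulB (BTensor A B) (BTensor.map m.L n.L (tmul a b)))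
        (BTensor.hom_ext fun c d => ?_) w
      simp [Mult.L_mul])
    (fun z w => by
      refine DFunLike.congr_fun
        (f := (BTensor.map m.R n.R).comp ((mulB (BTensor A B)).flip w))
        (g := (mulB (BTensor A B)).flip (BTensor.map m.R n.R w))
        (BTensor.hom_ext fun a b => ?_) z
      refine DFunLike.congr_fun
        (f := (BTensor.map m.R n.R).comp (mulB (BTensor A B) (tmul a b)))
        (g := (mulB (BTensor A B) (tmul a b)).comp (BTensor.map m.R n.R))
        (BTensor.hom_ext fun c d => ?_) w
      simp [Mult.R_mul])
    (fun z w => by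
      refine DFunLike.congr_fun
        (f := (mulB (BTensor A B)).flip (BTensor.map m.L n.L w))
        (g := ((mulB (BTensor A B)).flip w).comp (BTensor.map m.R n.R))
        (BTensor.hom_ext fun a b => ?_) z
      refine DFunLike.congr_fun
        (f := (mulB (BTensor A B) (tmul a b)).comp (BTensor.map m.L n.L))
        (g := mulB (BTensor A B) (BTensor.map m.R n.R (tmul a b)))
        (BTensor.hom_ext fun c d => ?_) w
      simp [Mult.compat])

end Multipliers

section Homs

/-- Homomorphisms of bornological algebras `H → M(K)`: bounded linear multiplicative maps. -/
structure MHom (H : Type u) (K : Type v) [NonUnitalRing H] [Module ℂ H] [Bornology H]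
    [BornologicalAlgebra H] [NonUnitalRing K] [Module ℂ K] [Bornology K]
    [BornologicalAlgebra K] where
  /-- The underlying linear map. -/
  toLin : H →ₗ[ℂ] Mult K
  bounded : ∀ s : Set H, IsBounded s → IsBounded (toLin '' s)
  map_mul : ∀ x y, toLin (x * y) = toLin x * toLin y

variable {H : Type u} [NonUnitalRing H] [Module ℂ H] [Bornology H] [BornologicalAlgebra H]
  {K : Type v} [NonUnitalRing K] [Module ℂ K] [Bornology K] [BornologicalAlgebra K]

instance : CoeFun (MHom H K) (fun _ => H → Mult K) := ⟨fun f => f.toLin⟩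

/-- The left action `h · k = f(h) k` of `H` on `K`. -/
def MHom.actL (f : MHom H K) : BLin H (BLin K K) :=
  BLin.of { toFun := fun h => (f h).L, map_add' := by simp, map_smul' := by simp } (by
    intro s hs
    refine (Mult.isBounded_iff.1 (f.bounded s hs)).1.subset ?_
    rintro _ ⟨x, hx, rfl⟩
    exact ⟨_, ⟨x, hx, rfl⟩, rfl⟩)

/-- The right action `k · h = k f(h)` of `H` on `K`. -/
def MHom.actR (f : MHom H K) : BLin K (BLin H K) :=
  BLin.flip (BLin.of { toFun := fun h => (f h).R, map_add' := by simp, map_smul' := by simp } (by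
    intro s hs
    refine (Mult.isBounded_iff.1 (f.bounded s hs)).2.subset ?_
    rintro _ ⟨x, hx, rfl⟩
    exact ⟨_, ⟨x, hx, rfl⟩, rfl⟩) : BLin H (BLin K K))

@[simp] theorem MHom.actL_apply (f : MHom H K) (h : H) (k : K) : f.actL h k = (f h).L k := rfl
@[simp] theorem MHom.actR_apply (f : MHom H K) (k : K) (h : H) : f.actR k h = (f h).R k := rfl

variable (H) in
/-- A bornological algebra `H` is essential if the multiplication induces an isomorphism
of `H ⊗_H H` with `H`. -/
def IsEssentialAlgebra : Prop := IsBalancedIso (mulB H) (mulB H) (mulB H)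

/-- A homomorphism `f : H → M(K)` is essential if the module structures of `K` induce isomorphisms
of `H ⊗_H K` and of `K ⊗_H H` with `K`. -/
def MHom.IsEssential (f : MHom H K) : Prop :=
  IsBalancedIso (mulB H) f.actL f.actL ∧ IsBalancedIso f.actR (mulB H) f.actR

theorem MHom.IsEssential.left_ext {f : MHom H K} (hf : f.IsEssential) {X : Type*}
    [AddCommGroup X] [Module ℂ X] [Bornology X] [BornologicalSpace X] {S T : BLin K X}
    (h : ∀ x k, S ((f x).L k) = T ((f x).L k)) (k : K) : S k = T k := by
  have := eq_zero_of_surjective hf.1.surjective (S - T) (fun x k => by simp [h]) k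
  rwa [BLin.sub_apply, sub_eq_zero] at this

theorem MHom.IsEssential.right_ext {f : MHom H K} (hf : f.IsEssential) {X : Type*}
    [AddCommGroup X] [Module ℂ X] [Bornology X] [BornologicalSpace X] {S T : BLin K X}
    (h : ∀ x k, S ((f x).R k) = T ((f x).R k)) (k : K) : S k = T k := by
  have := eq_zero_of_surjective hf.2.surjective (S - T) (fun k x => by simp [h]) k
  rwa [BLin.sub_apply, sub_eq_zero] at this

/-- The bilinear map `(h, k) ↦ f(m h) k`. -/
def MHom.extBL (f : MHom H K) (m : Mult H) : BLin H (BLin K K) := f.actL.comp m.L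

/-- The bilinear map `(k, h) ↦ k f(h m)`. -/
def MHom.extBR (f : MHom H K) (m : Mult H) : BLin K (BLin H K) := (f.actR.flip.comp m.R).flip

theorem MHom.extBL_bal (f : MHom H K) (m : Mult H) (x a : H) (k : K) :
    f.extBL m (mulB H x a) k = f.extBL m x (f.actL a k) := by
  simp [MHom.extBL, Mult.L_mul, f.map_mul]

theorem MHom.extBR_bal (f : MHom H K) (m : Mult H) (k : K) (a x : H) :
    f.extBR m (f.actR k a) x = f.extBR m k (mulB H a x) := by
  simp [MHom.extBR, Mult.R_mul, f.map_mul]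

theorem MHom.IsEssential.exists_extL {f : MHom H K} (hf : f.IsEssential) (m : Mult H) :
    ∃ T : BLin K K, ∀ x k, T ((f x).L k) = (f (m.L x)).L k := by
  obtain ⟨h, g, hg, -⟩ := hf.1
  refine ⟨(BalTensor.lift (r := mulB H) (l := f.actL) (f.extBL m) (f.extBL_bal m)).comp g,
    fun x k => ?_⟩
  have h1 := hg (BalTensor.mk _ _ (tmul x k))
  rw [BalTensor.lift_mk, BTensor.lift_tmul, MHom.actL_apply] at h1
  rw [BLin.comp_apply, h1, BalTensor.lift_mk, BTensor.lift_tmul]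
  rfl

theorem MHom.IsEssential.exists_extR {f : MHom H K} (hf : f.IsEssential) (m : Mult H) :
    ∃ T : BLin K K, ∀ x k, T ((f x).R k) = (f (m.R x)).R k := by
  obtain ⟨h, g, hg, -⟩ := hf.2
  refine ⟨(BalTensor.lift (r := f.actR) (l := mulB H) (f.extBR m) (f.extBR_bal m)).comp g,
    fun x k => ?_⟩
  have h1 := hg (BalTensor.mk _ _ (tmul k x))
  rw [BalTensor.lift_mk, BTensor.lift_tmul, MHom.actR_apply] at h1
  rw [BLin.comp_apply, h1, BalTensor.lift_mk, BTensor.lift_tmul]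
  rfl

variable (H K) in
/-- Essential homomorphisms `H → M(K)`. -/
structure EssHom extends MHom H K where
  essential : toMHom.IsEssential

instance : CoeFun (EssHom H K) (fun _ => H → Mult K) := ⟨fun f => f.toLin⟩

/-- The extension of an essential homomorphism `f : H → M(K)` to a map `M(H) → M(K)`. It is
determined by `EssHom.ext_L` and `EssHom.ext_R`, which express that it is multiplicative and
extends `f`. -/
def EssHom.ext (f : EssHom H K) (m : Mult H) : Mult K :=
  Mult.of (f.essential.exists_extL m).choose (f.essential.exists_extR m).choose
    (fun x y => by
      have hT := (f.essential.exists_extL m).choose_spec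
      generalize (f.essential.exists_extL m).choose = T at hT
      refine f.essential.left_ext (S := T.comp ((mulB K).flip y))
        (T := ((mulB K).flip y).comp T) (fun h k => ?_) x
      simp [← Mult.L_mul, hT])
    (fun x y => by
      have hT := (f.essential.exists_extR m).choose_spec
      generalize (f.essential.exists_extR m).choose = T at hT
      refine f.essential.right_ext (S := T.comp (mulB K x))
        (T := (mulB K x).comp T) (fun h k => ?_) y
      simp [← Mult.R_mul, hT])
    (fun x y => by
      have hT := (f.essential.exists_extL m).choose_spec
      have hT' := (f.essential.exists_extR m).choose_spec
      generalize (f.essential.exists_extL m).choose = T at hT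
      generalize (f.essential.exists_extR m).choose = T' at hT'
      refine f.essential.left_ext (S := (mulB K x).comp T)
        (T := mulB K (T' x)) (fun h k => ?_) y
      refine f.essential.right_ext (S := (mulB K).flip (T ((f h).L k)))
        (T := ((mulB K).flip ((f h).L k)).comp T') (fun h' k' => ?_) x
      have e : (f h').R k' * (f (m.L h)).L k = (f (m.R h')).R k' * (f h).L k := by
        have e' : f h' * f (m.L h) = f (m.R h') * f h := by
          rw [← f.map_mul, ← f.map_mul, Mult.compat m h' h]
        rw [← Mult.compat, ← Mult.compat, ← Mult.mul_L, ← Mult.mul_L, e']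
      simp [hT, hT', e])

theorem EssHom.ext_L (f : EssHom H K) (m : Mult H) (x : H) (k : K) :
    (f.ext m).L ((f x).L k) = (f (m.L x)).L k := (f.essential.exists_extL m).choose_spec x k

theorem EssHom.ext_R (f : EssHom H K) (m : Mult H) (x : H) (k : K) :
    (f.ext m).R ((f x).R k) = (f (m.R x)).R k := (f.essential.exists_extR m).choose_spec x k

/-- The extension is indeed an extension. -/
theorem EssHom.ext_ι (f : EssHom H K) (x : H) : f.ext (Mult.ι x) = f x := by
  refine Mult.ext (f.essential.left_ext fun h k => ?_) (f.essential.right_ext fun h k => ?_)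
  · rw [f.ext_L, Mult.ι_L, f.map_mul, Mult.mul_L]
  · rw [f.ext_R, Mult.ι_R, f.map_mul, Mult.mul_R]

variable (H) in
/-- The identity of `H`, as a homomorphism `H → M(H)`. -/
def MHom.ident : MHom H H where
  toLin :=
    { toFun := Mult.ι
      map_add' := fun x y => Mult.ext (by simp [add_mul]) (by simp [mul_add])
      map_smul' := fun c x => Mult.ext (by simp [smul_mul_assoc]) (by simp [mul_smul_comm]) }
  bounded := fun s hs => Mult.isBounded_iff.2
    ⟨((mulB H).bounded hs).subset (by rintro _ ⟨_, ⟨x, hx, rfl⟩, rfl⟩; exact ⟨x, hx, rfl⟩),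
      ((mulB H).flip.bounded hs).subset (by rintro _ ⟨_, ⟨x, hx, rfl⟩, rfl⟩; exact ⟨x, hx, rfl⟩)⟩
  map_mul := fun x y => Mult.ext (by simp [mul_assoc]) (by simp [mul_assoc])

/-- The identity of an essential algebra is an essential homomorphism. -/
def EssHom.ident (hH : IsEssentialAlgebra H) : EssHom H H where
  toMHom := MHom.ident H
  essential := ⟨hH, hH⟩

variable {H' : Type*} [NonUnitalRing H'] [Module ℂ H'] [Bornology H'] [BornologicalAlgebra H']
  {K' : Type*} [NonUnitalRing K'] [Module ℂ K'] [Bornology K'] [BornologicalAlgebra K']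

/-- The left multiplications of the tensor product of homomorphisms. -/
def MHom.tensorL (f : MHom H K) (f' : MHom H' K') :
    BLin (BTensor H H') (BLin (BTensor K K') (BTensor K K')) := BTensor.opB f.actL f'.actL

/-- The right multiplications of the tensor product of homomorphisms. -/
def MHom.tensorR (f : MHom H K) (f' : MHom H' K') :
    BLin (BTensor K K') (BLin (BTensor H H') (BTensor K K')) := BTensor.opB f.actR f'.actR

theorem MHom.tensorL_tmul (f : MHom H K) (f' : MHom H' K') (x : H) (y : H') :
    f.tensorL f' (tmul x y) = ((f x).tensor (f' y)).L := by
  simp [MHom.tensorL]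
  rfl

theorem MHom.tensorR_tmul (f : MHom H K) (f' : MHom H' K') (x : H) (y : H') (w) :
    f.tensorR f' w (tmul x y) = ((f x).tensor (f' y)).R w := by
  refine DFunLike.congr_fun (f := (f.tensorR f').flip (tmul x y))
    (g := ((f x).tensor (f' y)).R) (BTensor.hom_ext fun k k' => ?_) w
  simp only [MHom.tensorR, BLin.flip_apply, BTensor.opB_tmul, BTensor.map_tmul, MHom.actR_apply]
  exact (BTensor.map_tmul _ _ _ _).symm

/-- The tensor product `f ⊗ f' : H ⊗ H' → M(K ⊗ K')` of homomorphisms. -/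
def MHom.tensor (f : MHom H K) (f' : MHom H' K') : MHom (BTensor H H') (BTensor K K') where
  toLin :=
    { toFun := fun z => Mult.of (f.tensorL f' z) ((f.tensorR f').flip z)
        (fun v w => by
          refine DFunLike.congr_fun (f := (f.tensorL f').flip (v * w))
            (g := ((mulB (BTensor K K')).flip w).comp ((f.tensorL f').flip v))
            (BTensor.hom_ext fun x y => ?_) z
          simp [MHom.tensorL_tmul, Mult.L_mul])
        (fun v w => by
          refine DFunLike.congr_fun (f := f.tensorR f' (v * w))
            (g := (mulB (BTensor K K') v).comp (f.tensorR f' w))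
            (BTensor.hom_ext fun x y => ?_) z
          simp [MHom.tensorR_tmul, Mult.R_mul])
        (fun v w => by
          refine DFunLike.congr_fun (f := (mulB (BTensor K K') v).comp ((f.tensorL f').flip w))
            (g := ((mulB (BTensor K K')).flip w).comp (f.tensorR f' v))
            (BTensor.hom_ext fun x y => ?_) z
          simp [MHom.tensorL_tmul, MHom.tensorR_tmul, Mult.compat])
      map_add' := fun x y => Mult.ext
        (fun v => DFunLike.congr_fun (map_add (f.tensorL f') x y) v)
        (fun v => map_add (f.tensorR f' v) x y)
      map_smul' := fun c x => Mult.ext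
        (fun v => DFunLike.congr_fun (map_smul (f.tensorL f') c x) v)
        (fun v => map_smul (f.tensorR f' v) c x) }
  bounded := fun s hs => Mult.isBounded_iff.2
    ⟨((f.tensorL f').bounded hs).subset
        (by rintro _ ⟨_, ⟨x, hx, rfl⟩, rfl⟩; exact ⟨x, hx, rfl⟩),
      ((f.tensorR f').flip.bounded hs).subset
        (by rintro _ ⟨_, ⟨x, hx, rfl⟩, rfl⟩; exact ⟨x, hx, rfl⟩)⟩
  map_mul := fun z w => by
    refine Mult.ext (fun v => ?_) (fun v => ?_)
    · refine DFunLike.congr_fun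
        (f := ((f.tensorL f').flip v).comp ((mulB (BTensor H H')).flip w))
        (g := (f.tensorL f').flip (f.tensorL f' w v)) (BTensor.hom_ext fun x y => ?_) z
      refine DFunLike.congr_fun
        (f := ((f.tensorL f').flip v).comp (mulB (BTensor H H') (tmul x y)))
        (g := (f.tensorL f' (tmul x y)).comp ((f.tensorL f').flip v))
        (BTensor.hom_ext fun x' y' => ?_) w
      refine DFunLike.congr_fun
        (f := f.tensorL f' (tmul x y * tmul x' y'))
        (g := (f.tensorL f' (tmul x y)).comp (f.tensorL f' (tmul x' y')))
        (BTensor.hom_ext fun k k' => ?_) v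
      simp [MHom.tensorL, f.map_mul, f'.map_mul]
    · refine DFunLike.congr_fun
        (f := (f.tensorR f' v).comp ((mulB (BTensor H H')).flip w))
        (g := ((f.tensorR f').flip w).comp (f.tensorR f' v)) (BTensor.hom_ext fun x y => ?_) z
      refine DFunLike.congr_fun
        (f := (f.tensorR f' v).comp (mulB (BTensor H H') (tmul x y)))
        (g := f.tensorR f' (f.tensorR f' v (tmul x y)))
        (BTensor.hom_ext fun x' y' => ?_) w
      refine DFunLike.congr_fun
        (f := (f.tensorR f').flip (tmul x y * tmul x' y'))
        (g := ((f.tensorR f').flip (tmul x' y')).comp ((f.tensorR f').flip (tmul x y)))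
        (BTensor.hom_ext fun k k' => ?_) v
      simp [MHom.tensorR, f.map_mul, f'.map_mul]

@[simp] theorem MHom.tensor_tmul (f : MHom H K) (f' : MHom H' K') (x : H) (y : H') :
    f.tensor f' (tmul x y) = (f x).tensor (f' y) :=
  Mult.ext (DFunLike.congr_fun (f.tensorL_tmul f' x y)) (f.tensorR_tmul f' x y)

theorem mulB_tensor : mulB (BTensor H H') = BTensor.opB (mulB H) (mulB H') := rfl

theorem IsEssentialAlgebra.tensor (hH : IsEssentialAlgebra H) (hH' : IsEssentialAlgebra H') :
    IsEssentialAlgebra (BTensor H H') :=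
  IsBalancedIso.tensor hH hH' hH.surjective hH'.surjective (mulB H) (mulB H')
    (by simp [mul_assoc]) (by simp [mul_assoc]) (by simp [mul_assoc]) (by simp [mul_assoc])

theorem MHom.IsEssential.tensor {f : MHom H K} {f' : MHom H' K'} (hH : IsEssentialAlgebra H)
    (hH' : IsEssentialAlgebra H') (hf : f.IsEssential) (hf' : f'.IsEssential) :
    (f.tensor f').IsEssential :=
  ⟨IsBalancedIso.tensor hf.1 hf'.1 hH.surjective hH'.surjective (mulB H) (mulB H')
    (by simp [mul_assoc]) (by simp [mul_assoc]) (by simp [f.map_mul]) (by simp [f'.map_mul]),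
  IsBalancedIso.tensor hf.2 hf'.2 hf.2.surjective hf'.2.surjective (mulB H) (mulB H')
    (by simp [f.map_mul]) (by simp [f'.map_mul]) (by simp [mul_assoc]) (by simp [mul_assoc])⟩

/-- The tensor product of essential homomorphisms is essential. -/
def EssHom.tensor (hH : IsEssentialAlgebra H) (hH' : IsEssentialAlgebra H') (f : EssHom H K)
    (f' : EssHom H' K') : EssHom (BTensor H H') (BTensor K K') where
  toMHom := f.toMHom.tensor f'.toMHom
  essential := f.essential.tensor hH hH' f'.essential

end Homs

section Approximation

variable (V : Type u) [AddCommGroup V] [Module ℂ V] [Bornology V] [BornologicalSpace V]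

variable {V} in
/-- Compact subsets: compact subsets of the Banach space spanned by some small completant disk,
where compactness in this normed space is expressed by sequences. -/
def IsBornCompact (S : Set V) : Prop :=
  ∃ T : Set V, IsBounded T ∧ IsDisk T ∧ IsCompletant T ∧ S ⊆ Submodule.span ℂ T ∧
    ∀ s : ℕ → V, (∀ n, s n ∈ S) → ∃ x ∈ S, ∃ k : ℕ → ℕ, StrictMono k ∧
      ∀ ε : ℝ, 0 < ε → ∃ N, ∀ n ≥ N, s (k n) - x ∈ (ε : ℂ) • T

variable {V} in
/-- Finite rank operators: those in the image of `V ⊗ Hom(V, ℂ)` in `Hom(V, V)`. -/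
def IsFiniteRank (F : BLin V V) : Prop :=
  ∃ (n : ℕ) (y : Fin n → V) (ω : Fin n → BLin V ℂ), ∀ x, F x = ∑ i, ω i x • y i

/-- The approximation property: for every compact disk `S` there are finite rank operators that
converge to the identity in `Hom(⟨S⟩, V)`, that is, uniformly on `S` with respect to
some small disk `D`. -/
def HasApproximationProperty : Prop :=
  ∀ S : Set V, IsDisk S → IsBornCompact S →
    ∃ F : ℕ → BLin V V, (∀ n, IsFiniteRank (F n)) ∧
      ∃ D : Set V, IsBounded D ∧ IsDisk D ∧
        ∀ ε : ℝ, 0 < ε → ∃ N, ∀ n ≥ N, ∀ x ∈ S, F n x - x ∈ (ε : ℂ) • D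

end Approximation

section TensorMaps

variable {U : Type*} [AddCommGroup U] [Module ℂ U] [Bornology U] [BornologicalSpace U]
  {V : Type*} [AddCommGroup V] [Module ℂ V] [Bornology V] [BornologicalSpace V]
  {W : Type*} [AddCommGroup W] [Module ℂ W] [Bornology W] [BornologicalSpace W]

variable (V) in
/-- The bilinear map `(c, x) ↦ c x`. -/
def smulB : BLin ℂ (BLin V V) :=
  BLin.mk₂ (fun c x => c • x) add_smul (fun c d x => mul_smul c d x) smul_add
    (fun c d x => smul_comm d c x) (by
      intro s t hs ht
      obtain ⟨C, hC⟩ := hs.exists_norm_le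
      obtain ⟨T, hT, hd, _, hsub, _⟩ := exists_disk ht
      refine (BornologicalSpace.bounded_smul ((|C| : ℝ) : ℂ) hT).subset ?_
      rintro _ ⟨c, hc, x, hx, rfl⟩
      have h1 := hd.scale_smul (r := 1) (x := x) ⟨x, hsub hx, by simp⟩ c
      exact hd.scale_mono (by positivity) (by linarith [hC c hc, le_abs_self C]) h1)

/-- `ω ⊗ id : V ⊗ W → W` for a functional `ω` on `V`. -/
def sliceL (ω : BLin V ℂ) : BLin (BTensor V W) W := BTensor.lift ((smulB W).comp ω)

/-- `id ⊗ ω : V ⊗ W → V` for a functional `ω` on `W`. -/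
def sliceR (ω : BLin W ℂ) : BLin (BTensor V W) V := BTensor.lift ((smulB V).comp ω).flip

@[simp] theorem sliceL_tmul (ω : BLin V ℂ) (x : V) (y : W) :
    sliceL ω (tmul x y) = ω x • y := by
  rw [sliceL, BTensor.lift_tmul]
  rfl

@[simp] theorem sliceR_tmul (ω : BLin W ℂ) (x : V) (y : W) :
    sliceR ω (tmul x y) = ω y • x := by
  rw [sliceR, BTensor.lift_tmul]
  rfl

/-- The flip map `τ`. -/
def BTensor.swap : BLin (BTensor V W) (BTensor W V) := BTensor.lift tmul.flip

@[simp] theorem BTensor.swap_tmul (x : V) (y : W) :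
    BTensor.swap (tmul x y) = tmul y x := by
  rw [BTensor.swap, BTensor.lift_tmul]
  rfl

/-- The canonical map `(U ⊗ V) ⊗ W → U ⊗ (V ⊗ W)`. -/
def BTensor.assoc : BLin (BTensor (BTensor U V) W) (BTensor U (BTensor V W)) :=
  BTensor.lift (BTensor.lift (BLin.mk₂ (fun u v => (tmul u).comp (tmul v))
    (fun u u' v => BLin.ext (by simp)) (fun c u v => BLin.ext (by simp))
    (fun u v v' => BLin.ext (by simp)) (fun c u v => BLin.ext (by simp)) (by
      intro s t hs ht
      rw [BLin.isBounded_iff]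
      intro r hr
      refine (tmul.bounded₂ hs (tmul.bounded₂ ht hr)).subset ?_
      rintro _ ⟨_, ⟨u, hu, v, hv, rfl⟩, w, hw, rfl⟩
      exact ⟨u, hu, tmul v w, ⟨v, hv, w, hw, rfl⟩, rfl⟩)))

@[simp] theorem BTensor.assoc_tmul (u : U) (v : V) (w : W) :
    BTensor.assoc (tmul (tmul u v) w) = tmul u (tmul v w) := by
  rw [BTensor.assoc, BTensor.lift_tmul, BTensor.lift_tmul]
  rfl

end TensorMaps

section AntiAutomorphisms

/-- Bornological linear isomorphisms `σ : A → A` that are algebra antihomomorphisms. -/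
structure AntiAut (A : Type u) [NonUnitalRing A] [Module ℂ A] [Bornology A]
    [BornologicalAlgebra A] where
  /-- The map itself. -/
  map : BLin A A
  /-- The inverse map. -/
  inv : BLin A A
  inv_map : ∀ x, inv (map x) = x
  map_inv : ∀ x, map (inv x) = x
  map_mul : ∀ x y, map (x * y) = map y * map x

variable {A : Type u} [NonUnitalRing A] [Module ℂ A] [Bornology A] [BornologicalAlgebra A]

theorem AntiAut.inv_mul (σ : AntiAut A) (x y : A) : σ.inv (x * y) = σ.inv y * σ.inv x := by
  conv_lhs => rw [← σ.map_inv x, ← σ.map_inv y, ← σ.map_mul, σ.inv_map]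

/-- The extension of `σ` to an antiautomorphism of `M(A)`: the multiplier `n = σ(m)` is determined
by `n σ(x) = σ(x m)` and `σ(x) n = σ(m x)`. -/
def AntiAut.ext (σ : AntiAut A) (m : Mult A) : Mult A :=
  Mult.of (σ.map.comp (m.R.comp σ.inv)) (σ.map.comp (m.L.comp σ.inv))
    (fun x y => by simp [σ.inv_mul, Mult.R_mul, σ.map_mul, σ.map_inv])
    (fun x y => by simp [σ.inv_mul, Mult.L_mul, σ.map_mul, σ.map_inv])
    (fun x y => by
      have h := congrArg σ.map (m.compat (σ.inv y) (σ.inv x))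
      rw [σ.map_mul, σ.map_mul, σ.map_inv, σ.map_inv] at h
      exact h.symm)

/-- The antiautomorphism `(σ ⊗ σ)τ` of `A ⊗ A`, that is, `x ⊗ y ↦ σ(y) ⊗ σ(x)`. -/
def AntiAut.tensorSwap (σ : AntiAut A) : AntiAut (BTensor A A) where
  map := (BTensor.map σ.map σ.map).comp BTensor.swap
  inv := (BTensor.map σ.inv σ.inv).comp BTensor.swap
  inv_map := fun z => DFunLike.congr_fun
    (f := ((BTensor.map σ.inv σ.inv).comp BTensor.swap).comp
      ((BTensor.map σ.map σ.map).comp BTensor.swap)) (g := BLin.id _)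
    (BTensor.hom_ext fun x y => by simp [σ.inv_map]) z
  map_inv := fun z => DFunLike.congr_fun
    (f := ((BTensor.map σ.map σ.map).comp BTensor.swap).comp
      ((BTensor.map σ.inv σ.inv).comp BTensor.swap)) (g := BLin.id _)
    (BTensor.hom_ext fun x y => by simp [σ.map_inv]) z
  map_mul := fun z w => by
    let T : BLin (BTensor A A) (BTensor A A) := (BTensor.map σ.map σ.map).comp BTensor.swap
    refine DFunLike.congr_fun (f := T.comp ((mulB (BTensor A A)).flip w))
      (g := (mulB (BTensor A A) (T w)).comp T) (BTensor.hom_ext fun x y => ?_) z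
    refine DFunLike.congr_fun (f := T.comp (mulB (BTensor A A) (tmul x y)))
      (g := ((mulB (BTensor A A)).flip (T (tmul x y))).comp T)
      (BTensor.hom_ext fun x' y' => ?_) w
    simp [T, σ.map_mul]

end AntiAutomorphisms

section QuantumGroups

/-- Bornological quantum groups. The Galois maps, defined by
`γl (f ⊗ g) = Δ(f)(g ⊗ 1)`, `γr (f ⊗ g) = Δ(f)(1 ⊗ g)`, `ρl (f ⊗ g) = (f ⊗ 1)Δ(g)` and
`ρr (f ⊗ g) = (1 ⊗ f)Δ(g)`, take values in the multipliers given by elements of `H ⊗ H`, and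
are isomorphisms of `H ⊗ H` onto itself. Left invariance of `φ` says that the multiplier
`(id ⊗ φ)Δ(f)`, which acts by `g ↦ (id ⊗ φ) γl (f ⊗ g)` from the left and by
`g ↦ (id ⊗ φ) ρl (g ⊗ f)` from the right, is `φ(f) 1`. -/
structure QuantumGroup (H : Type u) [NonUnitalRing H] [Module ℂ H] [Bornology H]
    [BornologicalAlgebra H] where
  nontrivial : Nontrivial H
  essential : IsEssentialAlgebra H
  approximation : HasApproximationProperty H
  /-- The comultiplication. -/
  Δ : EssHom H (BTensor H H)
  coassoc_L : ∀ f z,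
    BTensor.assoc (((Δ.tensor essential essential (EssHom.ident essential)).ext (Δ f)).L z) =
      (((EssHom.ident essential).tensor essential essential Δ).ext (Δ f)).L (BTensor.assoc z)
  coassoc_R : ∀ f z,
    BTensor.assoc (((Δ.tensor essential essential (EssHom.ident essential)).ext (Δ f)).R z) =
      (((EssHom.ident essential).tensor essential essential Δ).ext (Δ f)).R (BTensor.assoc z)
  /-- The Galois maps. -/
  γl : BLin (BTensor H H) (BTensor H H)
  γr : BLin (BTensor H H) (BTensor H H)
  ρl : BLin (BTensor H H) (BTensor H H)
  ρr : BLin (BTensor H H) (BTensor H H)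
  γl_tmul : ∀ f g, Mult.ι (γl (tmul f g)) = Δ f * Mult.tensor (Mult.ι g) 1
  γr_tmul : ∀ f g, Mult.ι (γr (tmul f g)) = Δ f * Mult.tensor 1 (Mult.ι g)
  ρl_tmul : ∀ f g, Mult.ι (ρl (tmul f g)) = Mult.tensor (Mult.ι f) 1 * Δ g
  ρr_tmul : ∀ f g, Mult.ι (ρr (tmul f g)) = Mult.tensor 1 (Mult.ι f) * Δ g
  γl_iso : IsBornIso γl
  γr_iso : IsBornIso γr
  ρl_iso : IsBornIso ρl
  ρr_iso : IsBornIso ρr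
  /-- The left Haar functional. -/
  φ : BLin H ℂ
  faithful_left : ∀ f, (∀ g, φ (f * g) = 0) → f = 0
  faithful_right : ∀ g, (∀ f, φ (f * g) = 0) → g = 0
  invariant_L : ∀ f g, sliceR φ (γl (tmul f g)) = φ f • g
  invariant_R : ∀ f g, sliceR φ (ρl (tmul g f)) = φ f • g

variable {H : Type u} [NonUnitalRing H] [Module ℂ H] [Bornology H] [BornologicalAlgebra H]
  {K : Type v} [NonUnitalRing K] [Module ℂ K] [Bornology K] [BornologicalAlgebra K]

/-- Morphisms of bornological quantum groups: essential homomorphisms `α : H → M(K)` with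
`(α ⊗ α)Δ = Δα`. -/
def IsMorphism (G : QuantumGroup H) (G' : QuantumGroup K) (α : EssHom H K) : Prop :=
  ∀ f, (α.tensor G.essential G.essential α).ext (G.Δ f) = G'.Δ.ext (α f)

/-- The homomorphism `H → M(K)` given by a homomorphism `H → K`. -/
def MHom.ofHom (f : BLin H K) (hf : ∀ x y, f (x * y) = f x * f y) : MHom H K where
  toLin :=
    { toFun := fun x => Mult.ι (f x)
      map_add' := fun x y => Mult.ext (by simp [add_mul]) (by simp [mul_add])
      map_smul' := fun c x => Mult.ext (by simp [smul_mul_assoc]) (by simp [mul_smul_comm]) }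
  bounded := fun s hs => by
    have h := (MHom.ident K).bounded _ (f.bounded hs)
    rwa [← Set.image_comp] at h
  map_mul := fun x y => Mult.ext (by simp [hf, mul_assoc]) (by simp [hf, mul_assoc])

/-- A counit `ε` and an antipode `S` of a bornological quantum group: `ε : H → ℂ` is an essential
algebra homomorphism, `S : H → H` is a linear isomorphism which is an algebra antihomomorphism
and a coalgebra antihomomorphism, `(ε ⊗ id)Δ = id = (id ⊗ ε)Δ` as multipliers, and
`μ(S ⊗ id)γr = ε ⊗ id`, `μ(id ⊗ S)ρl = id ⊗ ε`. -/
structure CounitAntipode (G : QuantumGroup H) where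
  /-- The counit. -/
  ε : BLin H ℂ
  ε_mul : ∀ x y, ε (x * y) = ε x * ε y
  ε_essential : (MHom.ofHom ε ε_mul).IsEssential
  ε_left_L : ∀ f g, sliceL ε (G.γr (tmul f g)) = f * g
  ε_left_R : ∀ f g, sliceL ε (G.ρr (tmul g f)) = g * f
  ε_right_L : ∀ f g, sliceR ε (G.γl (tmul f g)) = f * g
  ε_right_R : ∀ f g, sliceR ε (G.ρl (tmul g f)) = g * f
  /-- The antipode. -/
  S : AntiAut H
  S_comul : ∀ f, G.Δ (S.map f) = S.tensorSwap.ext (G.Δ f)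
  S_left : ∀ z, BTensor.lift (mulB H) (BTensor.map S.map (BLin.id H) (G.γr z)) = sliceL ε z
  S_right : ∀ z, BTensor.lift (mulB H) (BTensor.map (BLin.id H) S.map (G.ρl z)) = sliceR ε z

/-- The counit as an essential homomorphism `H → M(ℂ)`, where `M(ℂ) = ℂ`. -/
def CounitAntipode.counit {G : QuantumGroup H} (c : CounitAntipode G) : EssHom H ℂ where
  toMHom := MHom.ofHom c.ε c.ε_mul
  essential := c.ε_essential

end QuantumGroups

end Born

end

open Born

/-! Counit and antipode are recovered from the Galois maps, following Van Daele's theory of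
algebraic quantum groups, and they are then so rigid that uniqueness and compatibility with `α`
follow from bijectivity of `γr`.

Every identity is proved by multiplying with further elements until only honest elements of `H ⊗ H`
or `H ⊗ H ⊗ H` occur. This requires that the product of these tensor powers be nondegenerate. For
`H` this is faithfulness of `φ`. For tensor powers it requires that slices separate points
(`HasApproximationProperty.eq_zero_of_sliceL`), and this is where the approximation property enters:
an element of `V ⊗ W` is an absolutely convergent series whose first legs can be rescaled to lie in
one compact disk, and on that disk finite rank operators approximate the identity.

Counit. Coassociativity makes `ρl` on the first two legs commute with `γr` on the last two. Hence
`(id ⊗ μγr⁻¹)(ρl(y) ⊗ b) = μ(y) ⊗ b` (`map_μ_γrInv_ρl`), and comparing legs forces `μγr⁻¹ = ε ⊗ id`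
for a functional `ε`. The counit identities and multiplicativity follow.

Antipode. Applying `id ⊗ id ⊗ φ` to `Δ²(a)(1 ⊗ Δ(b))(1 ⊗ c ⊗ 1)` and using left invariance gives `(ε
⊗ id)γr⁻¹((id ⊗ φ)(Δ(a)(1 ⊗ b)) ⊗ c) = (id ⊗ φ)((1 ⊗ a)Δ(b)) c` (`counit_γrInv_slice`). So there is
a map `S` with `S(f)c = (ε ⊗ id)γr⁻¹(f ⊗ c)` and `S((id ⊗ φ)(Δ(a)(1 ⊗ b))) = (id ⊗ φ)((1 ⊗ a)Δ(b))`.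
The mirrored computation gives `S⁻¹`. The first formula yields the antipode identities and
antimultiplicativity, the second one invertibility and, with the first-order consequences of
coassociativity, `ΔS = (S ⊗ S)τΔ`.

Uniqueness. `ε ⊗ id` is `μγr⁻¹`, and `S` is given by its first formula.

Morphisms. Put `k ⊗ l` behind `(α ⊗ α)(Δ(f)(1 ⊗ g))`; this gives `Δ(α(f))(k ⊗ α(g)l)`, where the
counit or antipode identity of `K` applies. The result agrees with that of the identity of `H`. As
`γr` is onto, `Δ(f)(1 ⊗ g)` may be replaced by any `f ⊗ g`, which is the claim up to factors that
can be cancelled (`counitM_morphism`, `antipodeMap_morphism`). -/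

noncomputable section

set_option linter.unusedSectionVars false

namespace Born

open Bornology
open scoped Pointwise

/-! ### Bounded linear functions and extensionality on tensor products -/

section Linearity

variable {U V W X : Type*} [AddCommGroup U] [Module ℂ U] [Bornology U] [BornologicalSpace U]
  [AddCommGroup V] [Module ℂ V] [Bornology V] [BornologicalSpace V]
  [AddCommGroup W] [Module ℂ W] [Bornology W] [BornologicalSpace W]
  [AddCommGroup X] [Module ℂ X] [Bornology X] [BornologicalSpace X]

/-- A function is bounded linear if it underlies an element of `Hom(V, W)`. -/
@[fun_prop]
def IsBLin (f : V → W) : Prop := ∃ F : BLin V W, ∀ x, F x = f x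

@[fun_prop]
theorem IsBLin.id' : IsBLin (fun x : V => x) := ⟨BLin.id V, fun _ => rfl⟩

@[fun_prop]
theorem IsBLin.comp {g : V → W} {f : U → V} (hg : IsBLin g) (hf : IsBLin f) :
    IsBLin (fun x => g (f x)) := by
  obtain ⟨F, hF⟩ := hf
  obtain ⟨G, hG⟩ := hg
  exact ⟨G.comp F, fun x => by simp [hF, hG]⟩

@[fun_prop]
theorem BLin.isBLin (F : BLin V W) : IsBLin (fun x => F x) := ⟨F, fun _ => rfl⟩

@[fun_prop]
theorem IsBLin.apply {f : U → BLin V W} (hf : IsBLin f) (v : V) : IsBLin (fun x => f x v) := by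
  obtain ⟨F, hF⟩ := hf
  exact ⟨F.flip v, fun x => by simp [hF]⟩

@[fun_prop]
theorem IsBLin.const_smul {f : V → W} (hf : IsBLin f) (c : ℂ) : IsBLin (fun x => c • f x) := by
  obtain ⟨F, hF⟩ := hf
  exact ⟨c • F, fun x => by simp [hF]⟩

@[fun_prop]
theorem IsBLin.mapTensor {f : V → BLin U W} (hf : IsBLin f) {U' W' : Type*}
    [AddCommGroup U'] [Module ℂ U'] [Bornology U'] [BornologicalSpace U']
    [AddCommGroup W'] [Module ℂ W'] [Bornology W'] [BornologicalSpace W'] (g : BLin U' W') :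
    IsBLin (fun x => BTensor.map g (f x)) := by
  obtain ⟨F, hF⟩ := hf
  exact ⟨(BTensor.mapB g).comp F, fun x => by simp [hF]⟩

@[fun_prop]
theorem IsBLin.postcomp {f : U → BLin V W} (hf : IsBLin f) (g : BLin W X) :
    IsBLin (fun x => g.comp (f x)) := by
  obtain ⟨F, hF⟩ := hf
  exact ⟨(BLin.postcomp g).comp F, fun x => congrArg g.comp (hF x)⟩

/-- The form of `BTensor.hom_ext` used throughout: `f` and `g` are plain functions, and their
linearity is left to `fun_prop`. -/
theorem BTensor.ind {f g : BTensor V W → X} (hf : IsBLin f) (hg : IsBLin g)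
    (h : ∀ x y, f (tmul x y) = g (tmul x y)) (z : BTensor V W) : f z = g z := by
  obtain ⟨F, hF⟩ := hf
  obtain ⟨G, hG⟩ := hg
  rw [← hF, ← hG]
  exact DFunLike.congr_fun (BTensor.hom_ext fun x y => by rw [hF, hG, h]) z

/-- The canonical map `U ⊗ (V ⊗ W) → (U ⊗ V) ⊗ W`. -/
def BTensor.assocInv : BLin (BTensor U (BTensor V W)) (BTensor (BTensor U V) W) :=
  -- Rotation through `(V ⊗ W) ⊗ U`, `V ⊗ (W ⊗ U)`, `(W ⊗ U) ⊗ V` and `W ⊗ (U ⊗ V)`, so that `assoc`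
  -- itself provides its inverse.
  BTensor.swap.comp (BTensor.assoc.comp (BTensor.swap.comp (BTensor.assoc.comp BTensor.swap)))

@[simp] theorem BTensor.assocInv_tmul (u : U) (v : V) (w : W) :
    BTensor.assocInv (tmul u (tmul v w)) = tmul (tmul u v) w := by
  simp [BTensor.assocInv]

theorem BTensor.assoc_assocInv (z : BTensor U (BTensor V W)) :
    BTensor.assoc (BTensor.assocInv z) = z := by
  refine BTensor.ind (f := fun z => BTensor.assoc (BTensor.assocInv z)) (g := fun z => z)
    (by fun_prop) (by fun_prop) (fun u y => ?_) z
  refine BTensor.ind (f := fun y => BTensor.assoc (BTensor.assocInv (tmul u y)))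
    (g := fun y => tmul u y) (by fun_prop) (by fun_prop) (fun v w => ?_) y
  simp

end Linearity

/-! ### Weights tending to infinity for a summable family -/

section Weights

/-- A summable family remains summable after multiplication with suitable weights that tend to
infinity. -/
theorem exists_weights {ι : Type*} {a : ι → ℝ} (h0 : ∀ i, 0 < a i) (ha : Summable a) :
    ∃ c : ι → ℝ, (∀ i, 1 ≤ c i) ∧ (Summable fun i => a i * c i) ∧
      ∀ ε : ℝ, 0 < ε → ∃ s : Finset ι, ∀ i ∉ s, (c i)⁻¹ ≤ ε := by
  classical
  -- Finite sets `s k` outside of which the tail of the series is below `2⁻ᵏ`; the sets `u k` are an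
  -- increasing version of them.
  have hs : ∀ k : ℕ, ∃ s : Finset ι, ∀ t, Disjoint t s → ∑ i ∈ t, a i < (1 / 2) ^ k := by
    intro k
    obtain ⟨s, hs⟩ := summable_iff_vanishing_norm.1 ha ((1 / 2) ^ k) (by positivity)
    exact ⟨s, fun t ht => (Real.le_norm_self _).trans_lt (hs t ht)⟩
  choose s hs using hs
  let u : ℕ → Finset ι := fun k => (Finset.range (k + 1)).biUnion s
  -- Positivity of `a i` is essential here: an index outside all `u k` would have `a i < 2⁻ᵏ` for
  -- every `k`.
  have hu : ∀ i, ∃ k, i ∈ u k := by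
    intro i
    by_contra! h
    obtain ⟨k, hk⟩ := exists_pow_lt_of_lt_one (h0 i) (by norm_num : (1 / 2 : ℝ) < 1)
    have h1 : i ∉ s k := fun hi =>
      h k (Finset.mem_biUnion.2 ⟨k, Finset.mem_range.2 (Nat.lt_succ_self k), hi⟩)
    have := hs k {i} (by simpa using h1)
    rw [Finset.sum_singleton] at this
    linarith
  have humono : ∀ {j k}, j ≤ k → u j ⊆ u k := fun h =>
    Finset.biUnion_subset_biUnion_of_subset_left _ (Finset.range_mono (by omega))
  let N : ι → ℕ := fun i => Nat.find (hu i)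
  have hN : ∀ i k, k < N i ↔ i ∉ u k := by
    intro i k
    constructor
    · exact fun h => Nat.find_min (hu i) h
    · intro h
      by_contra! hle
      exact h (humono hle (Nat.find_spec (hu i)))
  -- The weight is one plus the first stage at which `i` is absorbed; only the finitely many `i ∈ u
  -- k` have `N i ≤ k`.
  refine ⟨fun i => 1 + N i, fun i => by simp, ?_, fun ε hε => ?_⟩
  · simp only [mul_add, mul_one]
    refine ha.add (summable_of_sum_le (c := 2) (fun i => mul_nonneg (h0 i).le (by simp))
      fun t => ?_)
    let M := t.sup N
    -- Layer-cake: `N i` counts the stages `k` with `i ∉ u k`. After exchanging the sums, stage `k`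
    -- contributes a tail below `2⁻ᵏ`, hence the bound `2`.
    have h1 : ∀ i ∈ t, a i * N i = ∑ k ∈ Finset.range M, if i ∉ u k then a i else 0 := by
      intro i hi
      have hM : N i ≤ M := Finset.le_sup hi
      rw [← Finset.sum_filter, Finset.sum_const, nsmul_eq_mul, mul_comm]
      congr 2
      have : (Finset.range M).filter (fun k => i ∉ u k) = Finset.range (N i) := by
        ext k
        simp only [Finset.mem_filter, Finset.mem_range, ← hN]
        omega
      rw [this, Finset.card_range]
    rw [Finset.sum_congr rfl h1, Finset.sum_comm]
    calc _ ≤ ∑ k ∈ Finset.range M, (1 / 2 : ℝ) ^ k := by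
          refine Finset.sum_le_sum fun k _ => ?_
          rw [← Finset.sum_filter]
          refine (hs k _ ?_).le
          rw [Finset.disjoint_left]
          intro i hi hik
          exact (Finset.mem_filter.1 hi).2
            (Finset.mem_biUnion.2 ⟨k, Finset.mem_range.2 (Nat.lt_succ_self k), hik⟩)
      _ ≤ ∑' k, (1 / 2 : ℝ) ^ k := by
          refine (summable_geometric_of_lt_one (by norm_num) (by norm_num)).sum_le_tsum _
            fun _ _ => by positivity
      _ = 2 := tsum_geometric_two
  · obtain ⟨k, hk⟩ := exists_nat_one_div_lt hε
    refine ⟨u k, fun i hi => le_trans ?_ hk.le⟩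
    have h2 : ((k : ℝ)) ≤ N i := by exact_mod_cast ((hN i k).2 hi).le
    rw [one_div]
    exact inv_anti₀ (by positivity) (by linarith)

end Weights

/-! ### Compactness of the closed disked hull of a null family -/

section Hull

variable {V : Type*} [AddCommGroup V] [Module ℂ V] [Bornology V] [BornologicalSpace V]

theorem scale_scale {D : Set V} {r s : ℝ} {x : V} (hx : x ∈ (r : ℂ) • D) :
    (s : ℂ) • x ∈ ((s * r : ℝ) : ℂ) • D := by
  obtain ⟨d, hd, rfl⟩ := hx
  exact ⟨d, hd, by simp only [smul_smul, Complex.ofReal_mul]⟩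

/-- Sums of elements of `ε D`. -/
theorem IsDisk.scale_sum_scale {D : Set V} (hD : IsDisk D) (h0 : (0 : V) ∈ D) {ι : Type*}
    (s : Finset ι) (c : ι → ℂ) (e : ι → V) {ε : ℝ} (he : ∀ i ∈ s, e i ∈ (ε : ℂ) • D) :
    ∑ i ∈ s, c i • e i ∈ ((ε * ∑ i ∈ s, ‖c i‖ : ℝ) : ℂ) • D := by
  choose! d hd h using he
  have h1 : ∑ i ∈ s, c i • e i = (ε : ℂ) • ∑ i ∈ s, c i • d i := by
    rw [Finset.smul_sum]
    refine Finset.sum_congr rfl fun i hi => ?_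
    rw [← h i hi]
    exact smul_comm _ _ _
  rw [h1]
  exact scale_scale (hD.scale_sum h0 s c d fun i hi _ => hd i hi)

/-- The closed disked hull of a family that tends to zero. -/
def nullHull (D : Set V) {ι : Type*} (v : ι → V) : Set V :=
  {y | ∃ t : ι → ℂ, (∀ s : Finset ι, ∑ i ∈ s, ‖t i‖ ≤ 1) ∧ ∀ ε : ℝ, 0 < ε →
    ∃ s₀ : Finset ι, ∀ s, s₀ ⊆ s → y - ∑ i ∈ s, t i • v i ∈ (ε : ℂ) • D}

variable {D : Set V} {ι : Type*} {v : ι → V}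

theorem mem_nullHull (h0 : (0 : V) ∈ D) (i : ι) : v i ∈ nullHull D v := by
  classical
  refine ⟨Pi.single i 1, fun s => ?_, fun ε hε => ⟨{i}, fun s hs => ?_⟩⟩
  · by_cases hi : i ∈ s
    · rw [Finset.sum_eq_single_of_mem i hi fun j _ hj => by simp [hj]]
      simp
    · rw [Finset.sum_eq_zero fun j hj => ?_]
      · exact zero_le_one
      · have : j ≠ i := fun h => hi (h ▸ hj)
        simp [this]
  · rw [Finset.sum_eq_single_of_mem i (hs (Finset.mem_singleton_self i))
      fun j _ hj => by simp [hj]]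
    exact ⟨0, h0, by simp⟩

theorem isDisk_nullHull (hD : IsDisk D) : IsDisk (nullHull D v) := by
  classical
  rintro x ⟨t, ht, hx⟩ y ⟨t', ht', hy⟩ a b hab
  refine ⟨fun i => a * t i + b * t' i, fun s => ?_, fun ε hε => ?_⟩
  · calc ∑ i ∈ s, ‖a * t i + b * t' i‖ ≤ ∑ i ∈ s, (‖a‖ * ‖t i‖ + ‖b‖ * ‖t' i‖) :=
          Finset.sum_le_sum fun i _ => (norm_add_le _ _).trans (by simp)
      _ = ‖a‖ * ∑ i ∈ s, ‖t i‖ + ‖b‖ * ∑ i ∈ s, ‖t' i‖ := by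
          rw [Finset.sum_add_distrib, Finset.mul_sum, Finset.mul_sum]
      _ ≤ ‖a‖ * 1 + ‖b‖ * 1 := by
          gcongr
          · exact ht s
          · exact ht' s
      _ ≤ 1 := by simpa using hab
  · obtain ⟨s₀, hs₀⟩ := hx ε hε
    obtain ⟨s₁, hs₁⟩ := hy ε hε
    refine ⟨s₀ ∪ s₁, fun s hs => ?_⟩
    obtain ⟨d, hd, h⟩ := hs₀ s (Finset.union_subset_left hs)
    obtain ⟨d', hd', h'⟩ := hs₁ s (Finset.union_subset_right hs)
    refine ⟨a • d + b • d', hD d hd d' hd' a b hab, ?_⟩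
    simp only at h h' ⊢
    rw [smul_add, smul_comm _ a, smul_comm _ b, h, h']
    simp only [add_smul, mul_smul, Finset.sum_add_distrib, smul_sub, Finset.smul_sum]
    abel

/-- The coefficient families form the unit ball of `ℓ¹`, which is compact for pointwise convergence.
Since `v` tends to zero, `t ↦ ∑ t i • v i` is continuous from this topology to the norm of `D`.
Countability of `ι` turns compactness into sequential compactness. -/
theorem isBornCompact_nullHull [Countable ι] (hb : IsBounded D) (hD : IsDisk D)
    (hc : IsCompletant D) (h0 : (0 : V) ∈ D) (hv : ∀ i, v i ∈ D)
    (hv0 : ∀ ε : ℝ, 0 < ε → ∃ s : Finset ι, ∀ i ∉ s, v i ∈ (ε : ℂ) • D) :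
    IsBornCompact (nullHull D v) := by
  classical
  refine ⟨D, hb, hD, hc, ?_, fun y hy => ?_⟩
  · rintro x ⟨t, -, hx⟩
    obtain ⟨s, hs⟩ := hx 1 one_pos
    have h1 := mem_span_of_scale (hs s le_rfl)
    have h2 : ∑ i ∈ s, t i • v i ∈ Submodule.span ℂ D :=
      Submodule.sum_mem _ fun i _ => Submodule.smul_mem _ _ (Submodule.subset_span (hv i))
    have := Submodule.add_mem _ h1 h2
    rwa [sub_add_cancel] at this
  · choose t ht hy using hy
    let B : Set (ι → ℂ) := {t | ∀ s : Finset ι, ∑ i ∈ s, ‖t i‖ ≤ 1}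
    have hB : IsCompact B := by
      -- Tychonoff: the ball is a closed subset of a product of closed discs.
      refine (isCompact_univ_pi fun _ : ι => isCompact_closedBall (0 : ℂ) 1).of_isClosed_subset
        ?_ fun t ht i _ => ?_
      · have : B = ⋂ s : Finset ι, {t | ∑ i ∈ s, ‖t i‖ ≤ 1} := by
          ext
          simp [B]
        rw [this]
        exact isClosed_iInter fun s => isClosed_le (by fun_prop) continuous_const
      · simpa using ht {i}
    obtain ⟨t', ht', k, hk, hlim⟩ := hB.isSeqCompact (x := t) ht
    have hsum : Summable fun i => ‖t' i‖ := summable_of_sum_le (fun i => norm_nonneg _) ht'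
    obtain ⟨x, hx⟩ := hc.exists_sum hD h0 hsum (e := v) fun i _ => hv i
    refine ⟨x, ⟨t', ht', hx⟩, k, hk, fun ε hε => ?_⟩
    -- Off `s` the vectors lie in `(ε / 8) • D` and two coefficient families differ by at most `2`
    -- in `ℓ¹`, which costs `ε / 4`. The finitely many coordinates in `s` cost another `ε / 4` by
    -- pointwise convergence, and truncating the two series costs `ε / 4` each.
    obtain ⟨s, hs⟩ := hv0 (ε / 8) (by positivity)
    have hlim' : Filter.Tendsto (fun n => ∑ i ∈ s, ‖t (k n) i - t' i‖) Filter.atTop (nhds 0) := by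
      rw [show (0 : ℝ) = ∑ i ∈ s, ‖t' i - t' i‖ by simp]
      refine tendsto_finsetSum _ fun i _ => ?_
      exact (((tendsto_pi_nhds.1 hlim) i).sub_const _).norm
    obtain ⟨N, hN⟩ := Filter.eventually_atTop.1
      (hlim'.eventually (gt_mem_nhds (show (0 : ℝ) < ε / 4 by positivity)))
    refine ⟨N, fun n hn => ?_⟩
    obtain ⟨s₁, hs₁⟩ := hy (k n) (ε / 4) (by positivity)
    obtain ⟨s₂, hs₂⟩ := hx (ε / 4) (by positivity)
    let r := s ∪ (s₁ ∪ s₂)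
    have hsr : s ⊆ r := Finset.subset_union_left
    have e1 := hs₁ r (Finset.subset_union_left.trans Finset.subset_union_right)
    have e2 := hs₂ r (Finset.subset_union_right.trans Finset.subset_union_right)
    have e3 := hD.scale_mono (Finset.sum_nonneg fun _ _ => norm_nonneg _) (hN n hn).le
      (hD.scale_sum h0 s (fun i => t (k n) i - t' i) v fun i _ _ => hv i)
    have e4 : ∑ i ∈ r \ s, (t (k n) i - t' i) • v i ∈ ((ε / 4 : ℝ) : ℂ) • D := by
      refine hD.scale_mono (by positivity) ?_ (hD.scale_sum_scale h0 (r \ s)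
        (fun i => t (k n) i - t' i) v fun i hi => hs i (Finset.mem_sdiff.1 hi).2)
      have : ∑ i ∈ r \ s, ‖t (k n) i - t' i‖ ≤ 2 := by
        calc _ ≤ ∑ i ∈ r \ s, (‖t (k n) i‖ + ‖t' i‖) :=
              Finset.sum_le_sum fun i _ => norm_sub_le _ _
          _ ≤ 1 + 1 := by
              rw [Finset.sum_add_distrib]
              exact add_le_add (ht _ _) (ht' _)
          _ = 2 := by norm_num
      nlinarith
    have e5 := hD.scale_add (by positivity) (by positivity)
      (hD.scale_sub (by positivity) (by positivity) e1 e2)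
      (hD.scale_add (by positivity) (by positivity) e4 e3)
    rw [Finset.sum_sdiff hsr] at e5
    rw [show ε / 4 + ε / 4 + (ε / 4 + ε / 4) = ε by ring] at e5
    convert e5 using 1
    simp only [sub_smul, Finset.sum_sub_distrib]
    abel

end Hull

/-! ### Separation of points of the tensor product by slice maps -/

section Separation

variable {V : Type*} [AddCommGroup V] [Module ℂ V] [Bornology V] [BornologicalSpace V]
  {W : Type*} [AddCommGroup W] [Module ℂ W] [Bornology W] [BornologicalSpace W]

theorem smul_tmul' (c : ℂ) (x : V) (y : W) : c • tmul x y = tmul (c • x) y := by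
  rw [map_smul, BLin.smul_apply]

theorem BornHasSum.map {ι : Type*} {f : ι → V} {x : V} (h : BornHasSum f x) (F : BLin V W) :
    BornHasSum (fun i => F (f i)) (F x) := by
  obtain ⟨D, hD, hd, h⟩ := h
  refine ⟨F '' D, F.bounded hD, ?_, fun ε hε => ?_⟩
  · rintro _ ⟨x, hx, rfl⟩ _ ⟨y, hy, rfl⟩ a b hab
    exact ⟨a • x + b • y, hd x hx y hy a b hab, by simp⟩
  · obtain ⟨s₀, hs⟩ := h ε hε
    refine ⟨s₀, fun s hss => ?_⟩
    obtain ⟨d, hd, h⟩ := hs s hss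
    exact ⟨F d, ⟨d, hd, rfl⟩, by simp only at h ⊢; rw [← map_sum, ← map_sub, ← h, map_smul]⟩

/-- Series in `Ell1 (V × W)` are indexed by all pairs. Restricting to the nonzero terms gives a
countable index set and positive norms, as needed for `isBornCompact_nullHull` and `exists_weights`.
-/
theorem BornHasSum.subtype {ι : Type*} {f : ι → V} {x : V} (h : BornHasSum f x) {p : ι → Prop}
    (hp : ∀ i, ¬ p i → f i = 0) : BornHasSum (fun i : {i // p i} => f i) x := by
  classical
  obtain ⟨D, hD, hd, h⟩ := h
  refine ⟨D, hD, hd, fun ε hε => ?_⟩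
  obtain ⟨s₀, hs⟩ := h ε hε
  refine ⟨s₀.subtype p, fun s hss => ?_⟩
  have := hs (s₀ ∪ s.map (Function.Embedding.subtype p)) Finset.subset_union_left
  convert this using 2
  rw [← Finset.sum_subset (Finset.subset_union_right (s₁ := s₀)) fun i hi hi' => ?_,
    Finset.sum_map]
  · rfl
  · by_cases hpi : p i
    · exfalso
      refine hi' (Finset.mem_map.2 ⟨⟨i, hpi⟩, ?_, rfl⟩)
      rcases Finset.mem_union.1 hi with h1 | h1
      · exact hss (Finset.mem_subtype.2 h1)
      · exact absurd h1 hi'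
    · exact hp i hpi

/-- Elements of the tensor product as absolutely convergent series. -/
theorem BTensor.exists_hasSum (z : BTensor V W) :
    ∃ (p : V × W → Prop) (a : {q // p q} → ℂ) (D : Set V) (E : Set W), Countable {q // p q} ∧
      (∀ q, a q ≠ 0) ∧ (Summable fun q => ‖a q‖) ∧ (IsBounded D ∧ IsDisk D ∧ IsCompletant D ∧
      (0 : V) ∈ D) ∧ IsBounded E ∧ (∀ q : {q // p q}, q.1.1 ∈ D ∧ q.1.2 ∈ E) ∧
      BornHasSum (fun q : {q // p q} => a q • tmul q.1.1 q.1.2) z := by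
  obtain ⟨a, rfl⟩ := BTensor.mk_surjective z
  obtain ⟨B, hB, h⟩ := a.exists_support
  obtain ⟨D, hDb, hD, hDc, hsub, h0⟩ := exists_disk hB.image_fst
  refine ⟨fun q => Ell1.val a q ≠ 0, fun q => Ell1.val a q.1, D, Prod.snd '' B, ?_,
    fun q => q.2, a.summable.subtype _, ⟨hDb, hD, hDc, h0⟩, hB.image_snd, fun q => ?_, ?_⟩
  · have := a.summable.countable_support
    refine (this.mono fun q hq => ?_).to_subtype (s := {q | Ell1.val a q ≠ 0})
    exact norm_ne_zero_iff.2 hq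
  · have hq : q.1 ∈ B := by
      by_contra hq
      exact q.2 (h _ hq)
    exact ⟨hsub ⟨q.1, hq, rfl⟩, ⟨q.1, hq, rfl⟩⟩
  · have h1 := (a.hasSum_delta.map BTensor.mk).subtype (p := fun q => Ell1.val a q ≠ 0)
      (fun q hq => by simp [not_not.1 hq])
    simpa only [map_smul, tmul_def] using h1

/-- If `V` has the approximation property, then the slice maps of bounded functionals on `V`
separate the points of `V ⊗ W`. -/
theorem HasApproximationProperty.eq_zero_of_sliceL (hV : HasApproximationProperty V)
    {z : BTensor V W} (hz : ∀ ψ : BLin V ℂ, sliceL ψ z = 0) : z = 0 := by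
  obtain ⟨p, a, D, E, hcount, ha0, ha, ⟨hDb, hD, hDc, h0⟩, hE, hmem, hsum⟩ :=
    BTensor.exists_hasSum z
  -- The weights are moved from the vectors to the coefficients: `a q • x = b q • v q`, where `b` is
  -- still summable and the vectors `v q` now tend to zero, so that they lie in a compact disk.
  obtain ⟨c, hc1, hcs, hc0⟩ := exists_weights (fun q => norm_pos_iff.2 (ha0 q)) ha
  have hcpos : ∀ q, 0 < c q := fun q => one_pos.trans_le (hc1 q)
  let v : {q // p q} → V := fun q => (((c q)⁻¹ : ℝ) : ℂ) • q.1.1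
  let b : {q // p q} → ℂ := fun q => a q * c q
  have hbs : Summable fun q => ‖b q‖ := by
    refine hcs.congr fun q => ?_
    rw [norm_mul, Complex.norm_real, Real.norm_of_nonneg (hcpos q).le]
  have hbv : ∀ q, a q • q.1.1 = b q • v q := by
    intro q
    have : (c q : ℂ) ≠ 0 := by exact_mod_cast (hcpos q).ne'
    simp only [b, v, smul_smul]
    congr 1
    push_cast
    field_simp
  have hsum' : BornHasSum (fun q => b q • tmul (v q) q.1.2) z := by
    convert hsum using 2 with q
    rw [smul_tmul', smul_tmul', hbv]
  have hvD : ∀ q, v q ∈ D := fun q => hD.smul_mem (hmem q).1 (by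
    rw [Complex.norm_real, Real.norm_of_nonneg (inv_nonneg.2 (hcpos q).le)]
    exact inv_le_one_of_one_le₀ (hc1 q))
  obtain ⟨F, hF, D', hD'b, hD', hconv⟩ := hV (nullHull D v) (isDisk_nullHull hD)
    (isBornCompact_nullHull hDb hD hDc h0 hvD fun ε hε => by
      obtain ⟨s, hs⟩ := hc0 ε hε
      exact ⟨s, fun q hq => hD.scale_mono (inv_nonneg.2 (hcpos q).le) (hs q hq)
        ⟨q.1.1, (hmem q).1, rfl⟩⟩)
  clear_value v b
  -- For `F n = ∑ ωᵢ(·) yᵢ` the element `(F n ⊗ id) z` is `∑ yᵢ ⊗ (ωᵢ ⊗ id) z`, and all these slices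
  -- vanish by assumption.
  have hF0 : ∀ n, BTensor.map (F n) (BLin.id W) z = 0 := by
    intro n
    obtain ⟨m, y, ω, hω⟩ := hF n
    have : BTensor.map (F n) (BLin.id W) = ∑ i, (tmul (y i)).comp (sliceL (ω i)) := by
      refine BTensor.hom_ext fun x w => ?_
      have h1 : ∀ (s : Finset (Fin m)) (f : Fin m → BLin (BTensor V W) (BTensor V W)) u,
          (∑ i ∈ s, f i) u = ∑ i ∈ s, f i u := by
        intro s f u
        classical
        induction s using Finset.induction_on with
        | empty => simp
        | insert i s hi ih => rw [Finset.sum_insert hi, Finset.sum_insert hi, BLin.add_apply, ih]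
      have h2 : ∀ (s : Finset (Fin m)) (f : Fin m → BLin W (BTensor V W)) u,
          (∑ i ∈ s, f i) u = ∑ i ∈ s, f i u := by
        intro s f u
        classical
        induction s using Finset.induction_on with
        | empty => simp
        | insert i s hi ih => rw [Finset.sum_insert hi, Finset.sum_insert hi, BLin.add_apply, ih]
      rw [BTensor.map_tmul, hω, h1, map_sum, h2]
      simp
    rw [this]
    have h1 : ∀ (s : Finset (Fin m)) (f : Fin m → BLin (BTensor V W) (BTensor V W)) u,
        (∀ i, f i u = 0) → (∑ i ∈ s, f i) u = 0 := by
      intro s f u hf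
      classical
      induction s using Finset.induction_on with
      | empty => simp
      | insert i s hi ih => rw [Finset.sum_insert hi, BLin.add_apply, ih, hf, add_zero]
    exact h1 _ _ _ fun i => by simp [hz]
  obtain ⟨Q, hQb, hQ, hQc, hsub, hQ0⟩ := exists_disk (tmul.bounded₂ hD'b hE)
  refine hQc.1 z fun ε hε => ?_
  -- `C` bounds the gauge in `Q` of any series `∑ b q • e q` with `e q ∈ Q`: the sum of the `‖b q‖`
  -- bounds a partial sum, and the summand `1` absorbs the remainder.
  set C : ℝ := 1 + ∑' q, ‖b q‖ with hC
  have hCpos : 0 < C := by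
    have : 0 ≤ ∑' q, ‖b q‖ := tsum_nonneg fun _ => norm_nonneg _
    linarith
  have hδ : 0 < ε / C := by positivity
  obtain ⟨N, hN⟩ := hconv (ε / C) hδ
  choose d hd hdv using fun q => hN N le_rfl (v q) (mem_nullHull h0 q)
  have hdQ : ∀ q, tmul (d q) q.1.2 ∈ Q := fun q => hsub ⟨d q, hd q, q.1.2, (hmem q).2, rfl⟩
  obtain ⟨x, hx⟩ := hQc.exists_sum hQ hQ0 hbs (e := fun q => tmul (d q) q.1.2) fun q _ => hdQ q
  have hx1 : BornHasSum (fun q => b q • tmul (d q) q.1.2) x := ⟨Q, hQb, hQ, hx⟩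
  -- Termwise `v q - F N (v q) = -(ε / C) • d q`, while the series built from the `F N (v q)` sums
  -- to `(F N ⊗ id) z = 0`. Hence `z ∈ ε • Q` for every `ε`, and `Q` is completant.
  have hxz : z = (-((ε / C : ℝ) : ℂ)) • x := by
    refine BornHasSum.unique hsum' ?_
    have h1 := (hsum'.map (BTensor.map (F N) (BLin.id W))).add
      (hx1.smul (-((ε / C : ℝ) : ℂ)))
    rw [hF0, zero_add] at h1
    convert h1 using 2 with q
    have e : v q = F N (v q) + (-((ε / C : ℝ) : ℂ)) • d q := by
      have := hdv q
      simp only at this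
      rw [neg_smul, this]
      abel
    rw [map_smul, BTensor.map_tmul, BLin.id_apply, smul_comm _ (b q), ← smul_add]
    conv_lhs => rw [e]
    simp only [map_add, map_smul, BLin.add_apply, BLin.smul_apply]
  have hxQ : x ∈ ((C : ℝ) : ℂ) • Q := by
    obtain ⟨s, hs⟩ := hx 1 one_pos
    have h1 := hs s le_rfl
    have h2 := hQ.scale_mono (Finset.sum_nonneg fun _ _ => norm_nonneg _)
      (hbs.sum_le_tsum s fun _ _ => norm_nonneg _)
      (hQ.scale_sum hQ0 s b _ fun q _ _ => hdQ q)
    have := hQ.scale_add zero_le_one (tsum_nonneg fun _ => norm_nonneg _) h1 h2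
    rwa [sub_add_cancel] at this
  rw [hxz, neg_smul]
  have := scale_scale (s := ε / C) hxQ
  rw [div_mul_cancel₀ _ hCpos.ne'] at this
  exact hQ.scale_neg this

end Separation

/-! ### Separated spaces and nondegenerate algebras -/

section Separating

variable {V : Type*} [AddCommGroup V] [Module ℂ V] [Bornology V] [BornologicalSpace V]
  {W : Type*} [AddCommGroup W] [Module ℂ W] [Bornology W] [BornologicalSpace W]

variable (V) in
/-- The bounded linear functionals separate points. -/
def IsSeparated : Prop := ∀ x : V, (∀ ψ : BLin V ℂ, ψ x = 0) → x = 0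

theorem IsSeparated.eq_zero_of_slices (hV : HasApproximationProperty V) (hW : IsSeparated W)
    {z : BTensor V W} (h : ∀ (ψ : BLin V ℂ) (ω : BLin W ℂ), ω (sliceL ψ z) = 0) : z = 0 :=
  hV.eq_zero_of_sliceL fun ψ => hW _ fun ω => h ψ ω

theorem IsSeparated.tensor (hV : HasApproximationProperty V) (hW : IsSeparated W) :
    IsSeparated (BTensor V W) := fun _ hz =>
  IsSeparated.eq_zero_of_slices hV hW fun ψ ω => hz (ω.comp (sliceL ψ))

variable {A : Type*} [NonUnitalRing A] [Module ℂ A] [Bornology A] [BornologicalAlgebra A]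
  {B : Type*} [NonUnitalRing B] [Module ℂ B] [Bornology B] [BornologicalAlgebra B]

@[fun_prop]
theorem IsBLin.mul_const {f : V → A} (hf : IsBLin f) (a : A) : IsBLin (fun x => f x * a) := by
  obtain ⟨F, hF⟩ := hf
  exact ⟨((mulB A).flip a).comp F, fun x => congrArg (· * a) (hF x)⟩

@[fun_prop]
theorem IsBLin.const_mul {f : V → A} (hf : IsBLin f) (a : A) : IsBLin (fun x => a * f x) := by
  obtain ⟨F, hF⟩ := hf
  exact ⟨(mulB A a).comp F, fun x => congrArg (a * ·) (hF x)⟩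

variable (A) in
/-- Elements that annihilate the algebra from the left vanish. -/
def IsNondegenerate : Prop := ∀ x : A, (∀ y, x * y = 0) → x = 0

theorem IsNondegenerate.eq (hA : IsNondegenerate A) {x x' : A} (h : ∀ y, x * y = x' * y) :
    x = x' :=
  sub_eq_zero.1 (hA _ fun y => by rw [sub_mul, h, sub_self])

/-- The left part determines the right part through `(x m) y = x (m y)`. This halves most identities
between multipliers. -/
theorem IsNondegenerate.mult_ext (hA : IsNondegenerate A) {m n : Mult A}
    (h : ∀ x, m.L x = n.L x) : m = n :=
  Mult.ext h fun x => hA.eq fun y => by rw [← Mult.compat, ← Mult.compat, h]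

/-- If a functional is faithful on `A`, then nondegeneracy passes to tensor products with `A`. -/
theorem IsNondegenerate.tensor (hA : HasApproximationProperty A) (φ : BLin A ℂ)
    (hφ : ∀ f, (∀ g, φ (f * g) = 0) → f = 0) (hB : IsNondegenerate B) (hB' : IsSeparated B) :
    IsNondegenerate (BTensor A B) := by
  intro z hz
  -- Slicing `z (a ⊗ b) = 0` with `φ` gives `(φ(· a) ⊗ id)(z) b = 0` for all `b`, and `B` is
  -- nondegenerate.
  have h1 : ∀ a, sliceL (φ.comp ((mulB A).flip a)) z = 0 := by
    intro a
    refine hB _ fun b => ?_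
    have : sliceL φ (z * tmul a b) = sliceL (φ.comp ((mulB A).flip a)) z * b := by
      refine BTensor.ind (f := fun z => sliceL φ (z * tmul a b))
        (g := fun z => sliceL (φ.comp ((mulB A).flip a)) z * b) (by fun_prop) (by fun_prop)
        (fun x y => ?_) z
      simp [smul_mul_assoc]
    rw [← this, hz, map_zero]
  refine IsSeparated.eq_zero_of_slices hA hB' fun ψ ω => ?_
  have h2 : ∀ (χ : BLin A ℂ), ω (sliceL χ z) = χ (sliceR ω z) := by
    intro χ
    refine BTensor.ind (f := fun z => ω (sliceL χ z)) (g := fun z => χ (sliceR ω z))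
      (by fun_prop) (by fun_prop) (fun x y => ?_) z
    simp [mul_comm]
  -- Exchanging the two slices turns `h1` into `φ((id ⊗ ω)(z) a) = 0` for all `a`, where
  -- faithfulness applies.
  have h3 : sliceR ω z = 0 := hφ _ fun a => by
    have := h2 (φ.comp ((mulB A).flip a))
    rw [h1, map_zero] at this
    exact this.symm
  rw [h2, h3, map_zero]

theorem BTensor.assoc_mul {C : Type*} [NonUnitalRing C] [Module ℂ C] [Bornology C]
    [BornologicalAlgebra C] (z w : BTensor (BTensor A B) C) :
    BTensor.assoc (z * w) = BTensor.assoc z * BTensor.assoc w := by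
  refine BTensor.ind (f := fun z => BTensor.assoc (z * w))
    (g := fun z => BTensor.assoc z * BTensor.assoc w) (by fun_prop) (by fun_prop)
    (fun x c => ?_) z
  refine BTensor.ind (f := fun x => BTensor.assoc (tmul x c * w))
    (g := fun x => BTensor.assoc (tmul x c) * BTensor.assoc w) (by fun_prop) (by fun_prop)
    (fun a b => ?_) x
  refine BTensor.ind (f := fun w => BTensor.assoc (tmul (tmul a b) c * w))
    (g := fun w => BTensor.assoc (tmul (tmul a b) c) * BTensor.assoc w) (by fun_prop) (by fun_prop)
    (fun x' c' => ?_) w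
  refine BTensor.ind (f := fun x' => BTensor.assoc (tmul (tmul a b) c * tmul x' c'))
    (g := fun x' => BTensor.assoc (tmul (tmul a b) c) * BTensor.assoc (tmul x' c'))
    (by fun_prop) (by fun_prop) (fun a' b' => ?_) x'
  simp

end Separating

/-! ### Extensions of essential homomorphisms to multipliers -/

section Extensions

variable {H : Type*} [NonUnitalRing H] [Module ℂ H] [Bornology H] [BornologicalAlgebra H]
  {K : Type*} [NonUnitalRing K] [Module ℂ K] [Bornology K] [BornologicalAlgebra K]
  {H' : Type*} [NonUnitalRing H'] [Module ℂ H'] [Bornology H'] [BornologicalAlgebra H']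
  {K' : Type*} [NonUnitalRing K'] [Module ℂ K'] [Bornology K'] [BornologicalAlgebra K']
  {V : Type*} [AddCommGroup V] [Module ℂ V] [Bornology V] [BornologicalSpace V]

@[fun_prop]
theorem IsBLin.actL (f : MHom H K) {g : V → H} (hg : IsBLin g) :
    IsBLin (fun x => (f.toLin (g x)).L) := by
  obtain ⟨G, hG⟩ := hg
  exact ⟨f.actL.comp G, fun x => congrArg f.actL (hG x)⟩

@[fun_prop]
theorem IsBLin.actR (f : MHom H K) {g : V → H} (hg : IsBLin g) :
    IsBLin (fun x => (f.toLin (g x)).R) := by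
  obtain ⟨G, hG⟩ := hg
  exact ⟨f.actR.flip.comp G, fun x => congrArg f.actR.flip (hG x)⟩

@[fun_prop]
theorem IsBLin.ι_L {g : V → H} (hg : IsBLin g) : IsBLin (fun x => (Mult.ι (g x)).L) := by
  obtain ⟨G, hG⟩ := hg
  exact ⟨(mulB H).comp G, fun x => congrArg (mulB H) (hG x)⟩

@[simp] theorem Mult.tensor_L (m : Mult H) (n : Mult K) (x : H) (y : K) :
    (m.tensor n).L (tmul x y) = tmul (m.L x) (n.L y) := BTensor.map_tmul _ _ _ _

@[simp] theorem Mult.tensor_R (m : Mult H) (n : Mult K) (x : H) (y : K) :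
    (m.tensor n).R (tmul x y) = tmul (m.R x) (n.R y) := BTensor.map_tmul _ _ _ _

theorem Mult.tensor_L_eq (m : Mult H) (n : Mult K) : (m.tensor n).L = BTensor.map m.L n.L := rfl

theorem Mult.tensor_one_one : Mult.tensor (1 : Mult H) (1 : Mult K) = 1 :=
  Mult.ext (BTensor.ind (by fun_prop) (by fun_prop) (by simp))
    (BTensor.ind (by fun_prop) (by fun_prop) (by simp))

theorem Mult.tensor_mul_tensor (m m' : Mult H) (n n' : Mult K) :
    m.tensor n * m'.tensor n' = (m * m').tensor (n * n') :=
  Mult.ext (BTensor.ind (by fun_prop) (by fun_prop) (by simp))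
    (BTensor.ind (by fun_prop) (by fun_prop) (by simp))

theorem Mult.ι_tmul (x : H) (y : K) :
    Mult.ι (tmul x y) = (Mult.ι x).tensor (Mult.ι y) :=
  Mult.ext (BTensor.ind (by fun_prop) (by fun_prop) (by simp))
    (BTensor.ind (by fun_prop) (by fun_prop) (by simp))

theorem EssHom.ext_L_mul (f : EssHom H K) (m n : Mult H) (k : K) :
    (f.ext (m * n)).L k = (f.ext m).L ((f.ext n).L k) :=
  f.essential.left_ext (S := (f.ext (m * n)).L) (T := (f.ext m).L.comp (f.ext n).L)
    (fun x k => by simp [EssHom.ext_L]) k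

theorem EssHom.ext_mul (f : EssHom H K) (m n : Mult H) : f.ext (m * n) = f.ext m * f.ext n :=
  Mult.ext (f.ext_L_mul m n)
    (f.essential.right_ext (S := (f.ext (m * n)).R) (T := (f.ext n).R.comp (f.ext m).R)
      (fun x k => by simp [EssHom.ext_R]))

theorem EssHom.ext_one (f : EssHom H K) : f.ext 1 = 1 :=
  Mult.ext (f.essential.left_ext (S := (f.ext 1).L) (T := BLin.id K)
      (fun x k => by simp [EssHom.ext_L]))
    (f.essential.right_ext (S := (f.ext 1).R) (T := BLin.id K)
      (fun x k => by simp [EssHom.ext_R]))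

theorem EssHom.ident_apply (hH : IsEssentialAlgebra H) (x : H) :
    (EssHom.ident hH) x = Mult.ι x := rfl

theorem EssHom.ident_ext (hH : IsEssentialAlgebra H) (m : Mult H) :
    (EssHom.ident hH).ext m = m :=
  Mult.ext ((EssHom.ident hH).essential.left_ext (fun x k => by
      rw [EssHom.ext_L]; simp [EssHom.ident_apply, Mult.L_mul]))
    ((EssHom.ident hH).essential.right_ext (fun x k => by
      rw [EssHom.ext_R]; simp [EssHom.ident_apply, Mult.R_mul]))

theorem EssHom.tensor_tmul (hH : IsEssentialAlgebra H) (hH' : IsEssentialAlgebra H')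
    (f : EssHom H K) (f' : EssHom H' K') (x : H) (y : H') :
    (EssHom.tensor hH hH' f f') (tmul x y) = (f x).tensor (f' y) :=
  MHom.tensor_tmul _ _ _ _

theorem EssHom.tensor_ext (hH : IsEssentialAlgebra H) (hH' : IsEssentialAlgebra H')
    (f : EssHom H K) (f' : EssHom H' K') (m : Mult H) (n : Mult H') :
    (EssHom.tensor hH hH' f f').ext (m.tensor n) = (f.ext m).tensor (f'.ext n) := by
  refine Mult.ext ((EssHom.tensor hH hH' f f').essential.left_ext fun z k => ?_)
    ((EssHom.tensor hH hH' f f').essential.right_ext fun z k => ?_)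
  · rw [EssHom.ext_L]
    refine BTensor.ind (f := fun z => ((EssHom.tensor hH hH' f f') ((m.tensor n).L z)).L k)
      (g := fun z => ((f.ext m).tensor (f'.ext n)).L (((EssHom.tensor hH hH' f f') z).L k))
      (by fun_prop) (by fun_prop) (fun x y => ?_) z
    simp only [EssHom.tensor_tmul, Mult.tensor_L]
    revert k
    exact BTensor.ind (by fun_prop) (by fun_prop) (fun x y => by simp [EssHom.ext_L])
  · rw [EssHom.ext_R]
    refine BTensor.ind (f := fun z => ((EssHom.tensor hH hH' f f') ((m.tensor n).R z)).R k)
      (g := fun z => ((f.ext m).tensor (f'.ext n)).R (((EssHom.tensor hH hH' f f') z).R k))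
      (by fun_prop) (by fun_prop) (fun x y => ?_) z
    simp only [EssHom.tensor_tmul, Mult.tensor_R]
    revert k
    exact BTensor.ind (by fun_prop) (by fun_prop) (fun x y => by simp [EssHom.ext_R])

end Extensions

/-! ### Nondegeneracy of the tensor powers; Galois maps as multipliers -/

namespace QuantumGroup

variable {H : Type*} [NonUnitalRing H] [Module ℂ H] [Bornology H] [BornologicalAlgebra H]

theorem isNondegenerate (G : QuantumGroup H) : IsNondegenerate H := fun x h =>
  G.faithful_left x fun y => by rw [h, map_zero]

theorem eq_of_mul_left (G : QuantumGroup H) {x x' : H} (h : ∀ y, y * x = y * x') : x = x' :=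
  sub_eq_zero.1 (G.faithful_right _ fun y => by rw [mul_sub, h, sub_self, map_zero])

/-- The functionals `φ(· y)` already separate points, by faithfulness. -/
theorem isSeparated (G : QuantumGroup H) : IsSeparated H := fun x h =>
  G.faithful_left x fun y => h (G.φ.comp ((mulB H).flip y))

theorem isNondegenerate₂ (G : QuantumGroup H) : IsNondegenerate (BTensor H H) :=
  IsNondegenerate.tensor G.approximation G.φ G.faithful_left G.isNondegenerate G.isSeparated

theorem isNondegenerate₃ (G : QuantumGroup H) : IsNondegenerate (BTensor H (BTensor H H)) :=
  IsNondegenerate.tensor G.approximation G.φ G.faithful_left G.isNondegenerate₂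
    (IsSeparated.tensor G.approximation G.isSeparated)

theorem mult_ext_of_R (G : QuantumGroup H) {m n : Mult H} (h : ∀ x, m.R x = n.R x) : m = n :=
  Mult.ext (fun x => G.eq_of_mul_left fun y => by rw [Mult.compat, Mult.compat, h]) h

/-- Elements of `H ⊗ (H ⊗ H)` may be compared after multiplication by `(H ⊗ H) ⊗ H`. -/
theorem eq_of_mul_assoc (G : QuantumGroup H) {z z' : BTensor H (BTensor H H)}
    (h : ∀ w : BTensor (BTensor H H) H, z * BTensor.assoc w = z' * BTensor.assoc w) : z = z' :=
  G.isNondegenerate₃.eq fun y => by rw [← BTensor.assoc_assocInv y, h]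

variable (G : QuantumGroup H)

/-- The defining identities of the Galois maps live in the multiplier algebra. Multiplied by an
element `w` they become equations in `H ⊗ H`, the form in which nondegeneracy can be used. -/
theorem γl_mul (f g : H) (w : BTensor H H) :
    G.γl (tmul f g) * w = (G.Δ f).L ((Mult.tensor (Mult.ι g) 1).L w) :=
  DFunLike.congr_fun (congrArg Mult.L (G.γl_tmul f g)) w

theorem γr_mul (f g : H) (w : BTensor H H) :
    G.γr (tmul f g) * w = (G.Δ f).L ((Mult.tensor 1 (Mult.ι g)).L w) :=
  DFunLike.congr_fun (congrArg Mult.L (G.γr_tmul f g)) w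

theorem ρl_mul (f g : H) (w : BTensor H H) :
    G.ρl (tmul f g) * w = (Mult.tensor (Mult.ι f) 1).L ((G.Δ g).L w) :=
  DFunLike.congr_fun (congrArg Mult.L (G.ρl_tmul f g)) w

theorem ρr_mul (f g : H) (w : BTensor H H) :
    G.ρr (tmul f g) * w = (Mult.tensor 1 (Mult.ι f)).L ((G.Δ g).L w) :=
  DFunLike.congr_fun (congrArg Mult.L (G.ρr_tmul f g)) w

/-- The homomorphism `Δ ⊗ id`. -/
abbrev Δι : EssHom (BTensor H H) (BTensor (BTensor H H) H) :=
  G.Δ.tensor G.essential G.essential (EssHom.ident G.essential)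

/-- The homomorphism `id ⊗ Δ`. -/
abbrev ιΔ : EssHom (BTensor H H) (BTensor H (BTensor H H)) :=
  (EssHom.ident G.essential).tensor G.essential G.essential G.Δ

/-- Here `G.Δι.ext (G.Δ a)` is `Δ²(a)`, so that this and the next five lemmas express iterated
Galois maps through `Δ²`. They hold because the extended homomorphisms are multiplicative, unital
and compatible with elementary tensors of multipliers. -/
theorem Δι_γr (a b : H) : G.Δι (G.γr (tmul a b)) =
    G.Δι.ext (G.Δ a) * Mult.tensor 1 (Mult.ι b) := by
  rw [← EssHom.ext_ι, G.γr_tmul, EssHom.ext_mul, EssHom.tensor_ext, EssHom.ext_one,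
    EssHom.ident_ext]

theorem Δι_ρr (a b : H) : G.Δι (G.ρr (tmul a b)) =
    Mult.tensor 1 (Mult.ι a) * G.Δι.ext (G.Δ b) := by
  rw [← EssHom.ext_ι, G.ρr_tmul, EssHom.ext_mul, EssHom.tensor_ext, EssHom.ext_one,
    EssHom.ident_ext]

theorem ιΔ_γr (a b : H) : G.ιΔ (G.γr (tmul a b)) =
    G.ιΔ.ext (G.Δ a) * Mult.tensor 1 (G.Δ b) := by
  rw [← EssHom.ext_ι, G.γr_tmul, EssHom.ext_mul, EssHom.tensor_ext, EssHom.ext_one,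
    EssHom.ext_ι]

theorem ιΔ_ρr (a b : H) : G.ιΔ (G.ρr (tmul a b)) =
    Mult.tensor 1 (G.Δ a) * G.ιΔ.ext (G.Δ b) := by
  rw [← EssHom.ext_ι, G.ρr_tmul, EssHom.ext_mul, EssHom.tensor_ext, EssHom.ext_one,
    EssHom.ext_ι]

theorem ιΔ_γl (a b : H) : G.ιΔ (G.γl (tmul a b)) =
    G.ιΔ.ext (G.Δ a) * Mult.tensor (Mult.ι b) 1 := by
  rw [← EssHom.ext_ι, G.γl_tmul, EssHom.ext_mul, EssHom.tensor_ext, EssHom.ext_one,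
    EssHom.ident_ext]

theorem ιΔ_ρl (a b : H) : G.ιΔ (G.ρl (tmul a b)) =
    Mult.tensor (Mult.ι a) 1 * G.ιΔ.ext (G.Δ b) := by
  rw [← EssHom.ext_ι, G.ρl_tmul, EssHom.ext_mul, EssHom.tensor_ext, EssHom.ext_one,
    EssHom.ident_ext]

end QuantumGroup

/-! ### Calculus of elementary tensors of multipliers -/

theorem Mult.one_mul' {A : Type*} [NonUnitalRing A] [Module ℂ A] [Bornology A]
    [BornologicalAlgebra A] (m : Mult A) : 1 * m = m := Mult.ext (fun _ => rfl) fun _ => rfl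

theorem Mult.mul_one' {A : Type*} [NonUnitalRing A] [Module ℂ A] [Bornology A]
    [BornologicalAlgebra A] (m : Mult A) : m * 1 = m := Mult.ext (fun _ => rfl) fun _ => rfl

theorem Mult.tensor_L_L {A B : Type*} [NonUnitalRing A] [Module ℂ A] [Bornology A]
    [BornologicalAlgebra A] [NonUnitalRing B] [Module ℂ B] [Bornology B] [BornologicalAlgebra B]
    (m m' : Mult A) (n n' : Mult B) (w : BTensor A B) :
    (m.tensor n).L ((m'.tensor n').L w) = ((m * m').tensor (n * n')).L w := by
  rw [← Mult.tensor_mul_tensor, Mult.mul_L]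

theorem Mult.assoc_tensor_L {A B C : Type*} [NonUnitalRing A] [Module ℂ A] [Bornology A]
    [BornologicalAlgebra A] [NonUnitalRing B] [Module ℂ B] [Bornology B] [BornologicalAlgebra B]
    [NonUnitalRing C] [Module ℂ C] [Bornology C] [BornologicalAlgebra C]
    (m : Mult A) (n : Mult B) (k : Mult C) (w : BTensor (BTensor A B) C) :
    BTensor.assoc (((m.tensor n).tensor k).L w) = (m.tensor (n.tensor k)).L (BTensor.assoc w) := by
  revert w
  refine BTensor.ind (by fun_prop) (by fun_prop) fun x c => ?_
  revert x
  exact BTensor.ind (by fun_prop) (by fun_prop) fun a b => by simp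

/-! ### Coassociativity in terms of Galois maps -/

namespace QuantumGroup

variable {H : Type*} [NonUnitalRing H] [Module ℂ H] [Bornology H] [BornologicalAlgebra H]
  (G : QuantumGroup H)

section Slots

variable (c : H)

/-- A Galois map with one argument frozen at `c`, acting on one leg of `z`, is `Δ ⊗ id` or `id ⊗ Δ`
of `z` times `c` in the appropriate slot. The eight variants in this section differ in the leg, the
slot and the side. -/
theorem map_γl_mul (z : BTensor H H) (w : BTensor (BTensor H H) H) :
    BTensor.map (G.γl.comp (tmul.flip c)) (BLin.id H) z * w =
      (G.Δι z).L ((((Mult.ι c).tensor 1).tensor 1).L w) := by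
  revert z
  refine BTensor.ind (by fun_prop) (by fun_prop) fun u v => ?_
  revert w
  exact BTensor.ind (by fun_prop) (by fun_prop) fun p q => by
    simp [EssHom.tensor_tmul, γl_mul, EssHom.ident_apply]

theorem map_γr_mul (z : BTensor H H) (w : BTensor (BTensor H H) H) :
    BTensor.map (G.γr.comp (tmul.flip c)) (BLin.id H) z * w =
      (G.Δι z).L (((Mult.tensor 1 (Mult.ι c)).tensor 1).L w) := by
  revert z
  refine BTensor.ind (by fun_prop) (by fun_prop) fun u v => ?_
  revert w
  exact BTensor.ind (by fun_prop) (by fun_prop) fun p q => by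
    simp [EssHom.tensor_tmul, γr_mul, EssHom.ident_apply]

theorem map_ρl_mul (z : BTensor H H) (w : BTensor (BTensor H H) H) :
    BTensor.map (G.ρl.comp (tmul c)) (BLin.id H) z * w =
      (((Mult.ι c).tensor 1).tensor 1).L ((G.Δι z).L w) := by
  revert z
  refine BTensor.ind (by fun_prop) (by fun_prop) fun u v => ?_
  revert w
  exact BTensor.ind (by fun_prop) (by fun_prop) fun p q => by
    simp [EssHom.tensor_tmul, ρl_mul, EssHom.ident_apply]

theorem map_ρr_mul (z : BTensor H H) (w : BTensor (BTensor H H) H) :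
    BTensor.map (G.ρr.comp (tmul c)) (BLin.id H) z * w =
      ((Mult.tensor 1 (Mult.ι c)).tensor 1).L ((G.Δι z).L w) := by
  revert z
  refine BTensor.ind (by fun_prop) (by fun_prop) fun u v => ?_
  revert w
  exact BTensor.ind (by fun_prop) (by fun_prop) fun p q => by
    simp [EssHom.tensor_tmul, ρr_mul, EssHom.ident_apply]

theorem mapr_γl_mul (z : BTensor H H) (w : BTensor H (BTensor H H)) :
    BTensor.map (BLin.id H) (G.γl.comp (tmul.flip c)) z * w =
      (G.ιΔ z).L ((Mult.tensor 1 ((Mult.ι c).tensor 1)).L w) := by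
  revert z
  refine BTensor.ind (by fun_prop) (by fun_prop) fun u v => ?_
  revert w
  exact BTensor.ind (by fun_prop) (by fun_prop) fun p q => by
    simp [EssHom.tensor_tmul, γl_mul, EssHom.ident_apply]

theorem mapr_γr_mul (z : BTensor H H) (w : BTensor H (BTensor H H)) :
    BTensor.map (BLin.id H) (G.γr.comp (tmul.flip c)) z * w =
      (G.ιΔ z).L ((Mult.tensor 1 (Mult.tensor 1 (Mult.ι c))).L w) := by
  revert z
  refine BTensor.ind (by fun_prop) (by fun_prop) fun u v => ?_
  revert w
  exact BTensor.ind (by fun_prop) (by fun_prop) fun p q => by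
    simp [EssHom.tensor_tmul, γr_mul, EssHom.ident_apply]

theorem mapr_ρl_mul (z : BTensor H H) (w : BTensor H (BTensor H H)) :
    BTensor.map (BLin.id H) (G.ρl.comp (tmul c)) z * w =
      (Mult.tensor 1 ((Mult.ι c).tensor 1)).L ((G.ιΔ z).L w) := by
  revert z
  refine BTensor.ind (by fun_prop) (by fun_prop) fun u v => ?_
  revert w
  exact BTensor.ind (by fun_prop) (by fun_prop) fun p q => by
    simp [EssHom.tensor_tmul, ρl_mul, EssHom.ident_apply]

theorem mapr_ρr_mul (z : BTensor H H) (w : BTensor H (BTensor H H)) :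
    BTensor.map (BLin.id H) (G.ρr.comp (tmul c)) z * w =
      (Mult.tensor 1 (Mult.tensor 1 (Mult.ι c))).L ((G.ιΔ z).L w) := by
  revert z
  refine BTensor.ind (by fun_prop) (by fun_prop) fun u v => ?_
  revert w
  exact BTensor.ind (by fun_prop) (by fun_prop) fun p q => by
    simp [EssHom.tensor_tmul, ρr_mul, EssHom.ident_apply]

end Slots

/-- Both sides are `(c ⊗ 1 ⊗ 1) Δ²(a) (1 ⊗ 1 ⊗ b)`. -/
theorem assoc_ρl_γr (a b c : H) :
    BTensor.assoc (BTensor.map (G.ρl.comp (tmul c)) (BLin.id H) (G.γr (tmul a b))) =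
      BTensor.map (BLin.id H) (G.γr.comp (tmul.flip b)) (G.ρl (tmul c a)) := by
  refine G.eq_of_mul_assoc fun w => ?_
  -- Both sides are reduced to `Δ²` with factors in the outer slots; coassociativity is needed only
  -- to move `Δ²(a)` across the associator.
  rw [← BTensor.assoc_mul, map_ρl_mul, mapr_γr_mul, Δι_γr, ιΔ_ρl, Mult.assoc_tensor_L,
    Mult.mul_L, Mult.mul_L, coassoc_L, ← Mult.tensor_one_one, Mult.assoc_tensor_L]

/-- Both sides are `(1 ⊗ 1 ⊗ a) Δ²(b) (c ⊗ 1 ⊗ 1)`. -/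
theorem assoc_γl_ρr (a b c : H) :
    BTensor.assoc (BTensor.map (G.γl.comp (tmul.flip c)) (BLin.id H) (G.ρr (tmul a b))) =
      BTensor.map (BLin.id H) (G.ρr.comp (tmul a)) (G.γl (tmul b c)) := by
  refine G.eq_of_mul_assoc fun w => ?_
  rw [← BTensor.assoc_mul, map_γl_mul, mapr_ρr_mul, Δι_ρr, ιΔ_γl, Mult.mul_L, Mult.mul_L,
    ← Mult.tensor_one_one, Mult.assoc_tensor_L, coassoc_L, Mult.assoc_tensor_L]

/-- The map `p ⊗ q ↦ Δ²(a) (1 ⊗ p ⊗ q)`. -/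
def γr₂ (a : H) : BLin (BTensor H H) (BTensor (BTensor H H) H) :=
  -- With `Δ(a)(1 ⊗ q) = ∑ u ⊗ v`, the outcome is `∑ Δ(u)(1 ⊗ p) ⊗ v`. The flip is needed because
  -- `γr` expects `p` as its second argument.
  (BTensor.map (G.γr.comp BTensor.swap) (BLin.id H)).comp
    (BTensor.assocInv.comp (BTensor.map (BLin.id H) (G.γr.comp (tmul a))))

/-- The map `p ⊗ q ↦ (1 ⊗ p ⊗ q) Δ²(a)`. -/
def ρr₂ (a : H) : BLin (BTensor H H) (BTensor (BTensor H H) H) :=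
  (BTensor.map G.ρr (BLin.id H)).comp
    (BTensor.assocInv.comp (BTensor.map (BLin.id H) (G.ρr.comp (tmul.flip a))))

theorem γr₂_tmul (a p q : H) : G.γr₂ a (tmul p q) =
    BTensor.map (G.γr.comp (tmul.flip p)) (BLin.id H) (G.γr (tmul a q)) := by
  simp only [γr₂, BLin.comp_apply, BTensor.map_tmul, BLin.id_apply]
  generalize G.γr (tmul a q) = z
  revert z
  exact BTensor.ind (by fun_prop) (by fun_prop) fun u v => by simp

theorem ρr₂_tmul (a p q : H) : G.ρr₂ a (tmul p q) =
    BTensor.map (G.ρr.comp (tmul p)) (BLin.id H) (G.ρr (tmul q a)) := by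
  simp only [ρr₂, BLin.comp_apply, BTensor.map_tmul, BLin.id_apply, BLin.flip_apply]
  generalize G.ρr (tmul q a) = z
  revert z
  exact BTensor.ind (by fun_prop) (by fun_prop) fun u v => by simp

/-- Extends the description of `γr₂ a` from elementary tensors to all `y`, so that `y = Δ(b)(c ⊗ 1)`
may be inserted; this is what produces `Δ²(a)(1 ⊗ Δ(b))`. -/
theorem assoc_γr₂_mul (a : H) (y : BTensor H H) (w : BTensor (BTensor H H) H) :
    BTensor.assoc (G.γr₂ a y) * BTensor.assoc w =
      (G.ιΔ.ext (G.Δ a)).L ((Mult.tensor 1 (Mult.ι y)).L (BTensor.assoc w)) := by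
  simp only [Mult.tensor_L_eq]
  revert y
  refine BTensor.ind (by fun_prop) (by fun_prop) fun p q => ?_
  rw [← BTensor.assoc_mul, γr₂_tmul, map_γr_mul, Δι_γr, Mult.mul_L, coassoc_L,
    ← Mult.tensor_L_eq, Mult.tensor_L_L, Mult.one_mul', Mult.mul_one', Mult.assoc_tensor_L,
    Mult.ι_tmul]

theorem assoc_ρr₂_mul (a : H) (y : BTensor H H) (w : BTensor (BTensor H H) H) :
    BTensor.assoc (G.ρr₂ a y) * BTensor.assoc w =
      (Mult.tensor 1 (Mult.ι y)).L ((G.ιΔ.ext (G.Δ a)).L (BTensor.assoc w)) := by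
  simp only [Mult.tensor_L_eq]
  revert y
  refine BTensor.ind (by fun_prop) (by fun_prop) fun p q => ?_
  rw [← BTensor.assoc_mul, ρr₂_tmul, map_ρr_mul, Δι_ρr, Mult.mul_L, ← Mult.tensor_L_eq,
    Mult.tensor_L_L, Mult.one_mul', Mult.mul_one', Mult.assoc_tensor_L, coassoc_L, Mult.ι_tmul]

/-- Both sides are `Δ²(a) (1 ⊗ Δ(b)) (1 ⊗ c ⊗ 1)`. -/
theorem assoc_γr₂_γl (a b c : H) : BTensor.assoc (G.γr₂ a (G.γl (tmul b c))) =
    BTensor.map (BLin.id H) (G.γl.comp (tmul.flip c)) (G.γr (tmul a b)) := by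
  refine G.eq_of_mul_assoc fun w => ?_
  rw [assoc_γr₂_mul, mapr_γl_mul, ιΔ_γr, Mult.mul_L, γl_tmul, Mult.tensor_L_L, Mult.one_mul']

/-- Both sides are `(1 ⊗ c ⊗ 1) (1 ⊗ Δ(b)) Δ²(a)`. -/
theorem assoc_ρr₂_ρl (a b c : H) : BTensor.assoc (G.ρr₂ a (G.ρl (tmul c b))) =
    BTensor.map (BLin.id H) (G.ρl.comp (tmul c)) (G.ρr (tmul b a)) := by
  refine G.eq_of_mul_assoc fun w => ?_
  rw [assoc_ρr₂_mul, mapr_ρl_mul, ιΔ_ρr, Mult.mul_L, ρl_tmul, Mult.tensor_L_L, Mult.one_mul']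

end QuantumGroup

/-! ### Slice maps and multipliers -/

section Slices

variable {A : Type*} [NonUnitalRing A] [Module ℂ A] [Bornology A] [BornologicalAlgebra A]
  {B : Type*} [NonUnitalRing B] [Module ℂ B] [Bornology B] [BornologicalAlgebra B]

theorem sliceL_one_tensor_L (ω : BLin A ℂ) (n : Mult B) (z : BTensor A B) :
    sliceL ω ((Mult.tensor 1 n).L z) = n.L (sliceL ω z) := by
  revert z
  exact BTensor.ind (by fun_prop) (by fun_prop) fun u v => by simp

theorem sliceL_one_tensor_R (ω : BLin A ℂ) (n : Mult B) (z : BTensor A B) :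
    sliceL ω ((Mult.tensor 1 n).R z) = n.R (sliceL ω z) := by
  revert z
  exact BTensor.ind (by fun_prop) (by fun_prop) fun u v => by simp

theorem sliceR_tensor_one_L (ω : BLin B ℂ) (n : Mult A) (z : BTensor A B) :
    sliceR ω ((Mult.tensor n 1).L z) = n.L (sliceR ω z) := by
  revert z
  exact BTensor.ind (by fun_prop) (by fun_prop) fun u v => by simp

theorem sliceR_tensor_one_R (ω : BLin B ℂ) (n : Mult A) (z : BTensor A B) :
    sliceR ω ((Mult.tensor n 1).R z) = n.R (sliceR ω z) := by
  revert z
  exact BTensor.ind (by fun_prop) (by fun_prop) fun u v => by simp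

theorem sliceL_character_L {ε : BLin A ℂ} (hε : ∀ x y, ε (x * y) = ε x * ε y) (a : A)
    (z : BTensor A B) : sliceL ε ((Mult.tensor (Mult.ι a) 1).L z) = ε a • sliceL ε z := by
  revert z
  exact BTensor.ind (by fun_prop) (by fun_prop) fun u v => by simp [hε, mul_smul]

theorem sliceL_character_R {ε : BLin A ℂ} (hε : ∀ x y, ε (x * y) = ε x * ε y) (a : A)
    (z : BTensor A B) : sliceL ε ((Mult.tensor (Mult.ι a) 1).R z) = ε a • sliceL ε z := by
  revert z
  exact BTensor.ind (by fun_prop) (by fun_prop) fun u v => by simp [hε, smul_smul, mul_comm]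

theorem sliceR_character_R {ε : BLin B ℂ} (hε : ∀ x y, ε (x * y) = ε x * ε y) (a : B)
    (z : BTensor A B) : sliceR ε ((Mult.tensor 1 (Mult.ι a)).R z) = ε a • sliceR ε z := by
  revert z
  exact BTensor.ind (by fun_prop) (by fun_prop) fun u v => by simp [hε, smul_smul, mul_comm]

end Slices

/-! ### Relations between the four Galois maps -/

namespace QuantumGroup

variable {H : Type*} [NonUnitalRing H] [Module ℂ H] [Bornology H] [BornologicalAlgebra H]
  (G : QuantumGroup H)

section Galois

theorem γr_surjective : Function.Surjective G.γr := fun y =>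
  let ⟨g, _, h⟩ := G.γr_iso; ⟨g y, h y⟩

theorem ρl_surjective : Function.Surjective G.ρl := fun y =>
  let ⟨g, _, h⟩ := G.ρl_iso; ⟨g y, h y⟩

variable (a b c : H)

/-- Associativity of `(c ⊗ 1)Δ(a)(1 ⊗ b)`. This lemma and the next three transfer information from
one Galois map to another. -/
theorem tensor_L_γr : (Mult.tensor (Mult.ι c) 1).L (G.γr (tmul a b)) =
    (Mult.tensor 1 (Mult.ι b)).R (G.ρl (tmul c a)) :=
  G.isNondegenerate₂.eq fun w => by rw [← Mult.L_mul, ← Mult.compat, γr_mul, ρl_mul]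

theorem tensor_L_γl : (Mult.tensor 1 (Mult.ι a)).L (G.γl (tmul b c)) =
    (Mult.tensor (Mult.ι c) 1).R (G.ρr (tmul a b)) :=
  G.isNondegenerate₂.eq fun w => by rw [← Mult.L_mul, ← Mult.compat, γl_mul, ρr_mul]

theorem one_tensor_L_γr : (Mult.tensor 1 (Mult.ι a)).L (G.γr (tmul b c)) =
    (Mult.tensor 1 (Mult.ι c)).R (G.ρr (tmul a b)) :=
  G.isNondegenerate₂.eq fun w => by rw [← Mult.L_mul, ← Mult.compat, γr_mul, ρr_mul]

theorem tensor_one_L_γl : (Mult.tensor (Mult.ι a) 1).L (G.γl (tmul b c)) =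
    (Mult.tensor (Mult.ι c) 1).R (G.ρl (tmul a b)) :=
  G.isNondegenerate₂.eq fun w => by rw [← Mult.L_mul, ← Mult.compat, γl_mul, ρl_mul]

theorem Δ_L_γr : (G.Δ a).L (G.γr (tmul b c)) = G.γr (tmul (a * b) c) :=
  G.isNondegenerate₂.eq fun w => by rw [← Mult.L_mul, γr_mul, γr_mul, G.Δ.map_mul, Mult.mul_L]

theorem Δ_R_ρl : (G.Δ a).R (G.ρl (tmul c b)) = G.ρl (tmul c (b * a)) :=
  G.isNondegenerate₂.eq fun w => by rw [← Mult.compat, ρl_mul, ρl_mul, G.Δ.map_mul, Mult.mul_L]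

theorem tmul_mul (p q : H) (w : BTensor H H) : tmul p q * w =
    (Mult.tensor (Mult.ι p) 1).L ((Mult.tensor 1 (Mult.ι q)).L w) := by
  rw [Mult.tensor_L_L, Mult.one_mul', Mult.mul_one', ← Mult.ι_tmul, Mult.ι_L]

theorem tmul_mul' (p q : H) (w : BTensor H H) : tmul p q * w =
    (Mult.tensor 1 (Mult.ι q)).L ((Mult.tensor (Mult.ι p) 1).L w) := by
  rw [Mult.tensor_L_L, Mult.one_mul', Mult.mul_one', ← Mult.ι_tmul, Mult.ι_L]

theorem Δ_L_tmul (p q : H) :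
    (G.Δ a).L (tmul p q) = (Mult.tensor (Mult.ι p) 1).R (G.γr (tmul a q)) :=
  G.isNondegenerate₂.eq fun w => by rw [← Mult.L_mul, ← Mult.compat, γr_mul, tmul_mul']

theorem Δ_L_tmul' (p q : H) :
    (G.Δ a).L (tmul p q) = (Mult.tensor 1 (Mult.ι q)).R (G.γl (tmul a p)) :=
  G.isNondegenerate₂.eq fun w => by rw [← Mult.L_mul, ← Mult.compat, γl_mul, tmul_mul]

theorem Δ_R_tmul (p q : H) :
    (G.Δ a).R (tmul p q) = (Mult.tensor 1 (Mult.ι q)).L (G.ρl (tmul p a)) :=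
  G.isNondegenerate₂.eq fun w => by rw [← Mult.L_mul, ← Mult.compat, ρl_mul, tmul_mul']

end Galois

/-! ### Construction of the counit -/

section Counit

/-- The multiplication as a map on `H ⊗ H`. -/
abbrev μ (H : Type*) [NonUnitalRing H] [Module ℂ H] [Bornology H] [BornologicalAlgebra H] :
    BLin (BTensor H H) H := BTensor.lift (mulB H)

theorem exists_φ_eq_one : ∃ k, G.φ k = 1 := by
  obtain ⟨x, hx⟩ := @exists_ne H G.nontrivial 0
  have : ∃ y, G.φ (x * y) ≠ 0 := by
    by_contra! h
    exact hx (G.faithful_left x h)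
  obtain ⟨y, hy⟩ := this
  exact ⟨(G.φ (x * y))⁻¹ • (x * y), by rw [map_smul, smul_eq_mul, inv_mul_cancel₀ hy]⟩

/-- An element of integral one. -/
def unitMass : H := G.exists_φ_eq_one.choose

@[simp] theorem φ_unitMass : G.φ G.unitMass = 1 := G.exists_φ_eq_one.choose_spec

/-- The inverse of `γr`. -/
def γrInv : BLin (BTensor H H) (BTensor H H) := G.γr_iso.choose

@[simp] theorem γrInv_γr (z : BTensor H H) : G.γrInv (G.γr z) = z := G.γr_iso.choose_spec.1 z
@[simp] theorem γr_γrInv (z : BTensor H H) : G.γr (G.γrInv z) = z := G.γr_iso.choose_spec.2 z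

/-- The inverse of `ρl`. -/
def ρlInv : BLin (BTensor H H) (BTensor H H) := G.ρl_iso.choose

@[simp] theorem ρl_ρlInv (z : BTensor H H) : G.ρl (G.ρlInv z) = z := G.ρl_iso.choose_spec.2 z

/-- The inverse of `ρr`. -/
def ρrInv : BLin (BTensor H H) (BTensor H H) := G.ρr_iso.choose

@[simp] theorem ρrInv_ρr (z : BTensor H H) : G.ρrInv (G.ρr z) = z := G.ρr_iso.choose_spec.1 z
@[simp] theorem ρr_ρrInv (z : BTensor H H) : G.ρr (G.ρrInv z) = z := G.ρr_iso.choose_spec.2 z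

/-- The Galois maps `ρl` on the first two legs and `γr` on the last two legs commute. -/
theorem ρl_γr_comm (c : H) (z : BTensor H H) :
    BTensor.assoc (BTensor.map (G.ρl.comp (tmul c)) (BLin.id H) (G.γr z)) =
      BTensor.map (BLin.id H) G.γr
        (BTensor.assoc (BTensor.map (G.ρl.comp (tmul c)) (BLin.id H) z)) := by
  revert z
  refine BTensor.ind (by fun_prop) (by fun_prop) fun a b => ?_
  rw [assoc_ρl_γr, BTensor.map_tmul, BLin.id_apply, BLin.comp_apply]
  generalize G.ρl (tmul c a) = w
  revert w
  exact BTensor.ind (by fun_prop) (by fun_prop) fun u v => by simp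

/-- For `z = a ⊗ b` both sides are `(c ⊗ 1)Δ(a)(1 ⊗ b)`: multiplying the second leg of `ρl (c ⊗ a)`
by `b` is right multiplication by `1 ⊗ b`. -/
theorem map_μ_ρl (c : H) (z : BTensor H H) :
    BTensor.map (BLin.id H) (μ H)
        (BTensor.assoc (BTensor.map (G.ρl.comp (tmul c)) (BLin.id H) z)) =
      (Mult.tensor (Mult.ι c) 1).L (G.γr z) := by
  revert z
  refine BTensor.ind (by fun_prop) (by fun_prop) fun a b => ?_
  rw [tensor_L_γr, BTensor.map_tmul, BLin.id_apply, BLin.comp_apply]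
  generalize G.ρl (tmul c a) = w
  revert w
  exact BTensor.ind (by fun_prop) (by fun_prop) fun u v => by simp

/-- The source of the counit. For `y = c ⊗ a` write `a ⊗ b = γr z`. Since `ρl` and `γr` act on
overlapping legs and commute, `ρl(c ⊗ a) ⊗ b` is `id ⊗ γr` of `(ρl(c ⊗ ·) ⊗ id) z`. So `γr⁻¹`
cancels, and `map_μ_ρl` gives `(c ⊗ 1)γr(z) = ca ⊗ b`. -/
theorem map_μ_γrInv_ρl (y : BTensor H H) (b : H) :
    BTensor.map (BLin.id H) ((μ H).comp G.γrInv) (BTensor.assoc (tmul (G.ρl y) b)) =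
      tmul (μ H y) b := by
  revert y
  refine BTensor.ind (by fun_prop) (by fun_prop) fun c a => ?_
  obtain ⟨z, hz⟩ := G.γr_surjective (tmul a b)
  have h1 := G.ρl_γr_comm c z
  rw [hz, BTensor.map_tmul, BLin.id_apply, BLin.comp_apply] at h1
  have h2 : ∀ w : BTensor H (BTensor H H),
      BTensor.map (BLin.id H) ((μ H).comp G.γrInv) (BTensor.map (BLin.id H) G.γr w) =
        BTensor.map (BLin.id H) (μ H) w :=
    BTensor.ind (by fun_prop) (by fun_prop) fun u v => by simp
  rw [h1, h2, map_μ_ρl, hz]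
  simp

/-- The counit. -/
def counit : BLin H ℂ := G.φ.comp ((μ H).comp (G.ρlInv.comp (tmul G.unitMass)))

/-- Let `k` be `unitMass`. With `ρl(y) = k ⊗ f`, `map_μ_γrInv_ρl` reads `k ⊗ μγr⁻¹(f ⊗ b) = μρl⁻¹(k
⊗ f) ⊗ b`. Applying `φ` to the first leg shows that `μγr⁻¹(f ⊗ b)` is a scalar multiple of `b`, and
the scalar is the definition of `counit`. -/
theorem μ_γrInv (y : BTensor H H) : μ H (G.γrInv y) = sliceL G.counit y := by
  revert y
  refine BTensor.ind (by fun_prop) (by fun_prop) fun f b => ?_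
  have h := congrArg (sliceL G.φ) (G.map_μ_γrInv_ρl (G.ρlInv (tmul G.unitMass f)) b)
  simpa [counit] using h

theorem counit_γr (z : BTensor H H) : sliceL G.counit (G.γr z) = μ H z := by
  rw [← μ_γrInv, γrInv_γr]

/-- The same identity `map_μ_γrInv_ρl` read again, now with `μγr⁻¹` replaced by `ε ⊗ id`: one
functional serves both sides. -/
theorem counit_ρl (z : BTensor H H) : sliceR G.counit (G.ρl z) = μ H z := by
  have h1 : ∀ (y : BTensor H H) b, BTensor.map (BLin.id H) ((μ H).comp G.γrInv)
      (BTensor.assoc (tmul y b)) = tmul (sliceR G.counit y) b := by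
    intro y b
    revert y
    refine BTensor.ind (by fun_prop) (by fun_prop) fun u v => ?_
    simp [μ_γrInv]
  have h := G.map_μ_γrInv_ρl z G.unitMass
  rw [h1] at h
  simpa using congrArg (sliceR G.φ) h

/-- On `w = (c ⊗ 1)Δ(a)` the map `id ⊗ ε` sends `w Δ(b)` to `cab`, whence `(id ⊗ ε)(w Δ(b)) = (id ⊗
ε)(w) b` for all `w`. For `w = p ⊗ q` this says that a factor `1 ⊗ q` in front of `(p ⊗ 1)Δ(b)`
contributes `ε(q)`. As `ρl` is onto, this holds in front of every tensor, in particular of `k ⊗ y`,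
where `k` is `unitMass`. -/
theorem counit_mul (x y : H) : G.counit (x * y) = G.counit x * G.counit y := by
  have h1 : ∀ b w, sliceR G.counit ((G.Δ b).R w) = sliceR G.counit w * b := by
    intro b w
    obtain ⟨z, rfl⟩ := G.ρl_surjective w
    revert z
    refine BTensor.ind (by fun_prop) (by fun_prop) fun c a => ?_
    rw [Δ_R_ρl, counit_ρl, counit_ρl]
    simp [mul_assoc]
  have h2 : ∀ (q : H) (v : BTensor H H), sliceR G.counit ((Mult.tensor 1 (Mult.ι q)).L v) =
      G.counit q • sliceR G.counit v := by
    intro q v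
    obtain ⟨z, rfl⟩ := G.ρl_surjective v
    revert z
    refine BTensor.ind (by fun_prop) (by fun_prop) fun p b => ?_
    rw [← Δ_R_tmul, h1, counit_ρl]
    simp [smul_mul_assoc]
  have h := congrArg G.φ (h2 x (tmul G.unitMass y))
  simpa using h

theorem counit_ρr (f g : H) : sliceL G.counit (G.ρr (tmul g f)) = g * f :=
  G.isNondegenerate.eq fun c => by
    rw [← Mult.ι_R, ← sliceL_one_tensor_R, ← one_tensor_L_γr, sliceL_one_tensor_L, counit_γr]
    simp [mul_assoc]

theorem counit_γl (f g : H) : sliceR G.counit (G.γl (tmul f g)) = f * g :=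
  G.eq_of_mul_left fun c => by
    rw [← Mult.ι_L, ← sliceR_tensor_one_L, tensor_one_L_γl, sliceR_tensor_one_R, counit_ρl]
    simp [mul_assoc]

/-- The factor `1 ⊗ g` of `Δ(f)(1 ⊗ g)` leaves `id ⊗ ε` as `ε(g)` because `ε` is a character, and
`(id ⊗ ε)Δ(f) = f`. -/
theorem sliceR_counit_γr (z : BTensor H H) :
    sliceR G.counit (G.γr z) = sliceR G.counit z := by
  revert z
  refine BTensor.ind (by fun_prop) (by fun_prop) fun f g => G.eq_of_mul_left fun c => ?_
  rw [← Mult.ι_L, ← sliceR_tensor_one_L, tensor_L_γr, sliceR_character_R G.counit_mul, counit_ρl]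
  simp [mul_smul_comm]

theorem sliceL_counit_ρl (z : BTensor H H) :
    sliceL G.counit (G.ρl z) = sliceL G.counit z := by
  revert z
  refine BTensor.ind (by fun_prop) (by fun_prop) fun f g => G.isNondegenerate.eq fun c => ?_
  rw [← Mult.ι_R, ← sliceL_one_tensor_R, ← tensor_L_γr, sliceL_character_L G.counit_mul,
    counit_γr]
  simp [smul_mul_assoc]

/-- If `ε` vanished, so would `(ε ⊗ id)γr = μ`, against nondegeneracy. -/
theorem exists_counit_eq_one : ∃ h, G.counit h = 1 := by
  have : ∃ h, G.counit h ≠ 0 := by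
    by_contra! h
    obtain ⟨x, hx⟩ := @exists_ne H G.nontrivial 0
    refine hx (G.isNondegenerate x fun y => ?_)
    have h1 := G.counit_γr (tmul x y)
    rw [BTensor.lift_tmul, mulB_apply] at h1
    rw [← h1]
    generalize G.γr (tmul x y) = w
    obtain ⟨z, rfl⟩ : ∃ z, z = w := ⟨w, rfl⟩
    refine BTensor.ind (f := fun z => sliceL G.counit z) (g := fun z => (0 : BLin _ H) z)
      (by fun_prop) (by fun_prop) (fun u v => ?_) z
    simp [h]
  obtain ⟨h, hh⟩ := this
  exact ⟨(G.counit h)⁻¹ • h, by rw [map_smul, smul_eq_mul, inv_mul_cancel₀ hh]⟩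

/-- The counit as a homomorphism to `M(ℂ)`. -/
abbrev counitHom : MHom H ℂ := MHom.ofHom G.counit G.counit_mul

/-- Fix `h₀` with `ε(h₀) = 1`. The inverse of `H ⊗_H ℂ → ℂ` is `c ↦ c [h₀ ⊗ 1]`, so the point is
that `[h ⊗ 1] = ε(h) [h₀ ⊗ 1]`, that is, that the kernel of `ε` dies in the balanced tensor product.
The other side is the mirror image, with `ρl` for `γr`. -/
theorem counit_essential : G.counitHom.IsEssential := by
  obtain ⟨h₀, hh₀⟩ := G.exists_counit_eq_one
  have hL : ∀ (x : H) (c : ℂ), G.counitHom.actL x c = G.counit x * c := fun _ _ => rfl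
  have hR : ∀ (c : ℂ) (x : H), G.counitHom.actR c x = c * G.counit x := fun _ _ => rfl
  constructor
  · let π := BalTensor.mk (mulB H) G.counitHom.actL
    have key : ∀ z : BTensor H H, π (tmul (μ H z) 1) = π (tmul (sliceR G.counit z) 1) := by
      refine BTensor.ind (by fun_prop) (by fun_prop) fun x y => ?_
      have h1 := BalTensor.mk_rel (mulB H) G.counitHom.actL x y 1
      have h2 : G.counitHom.actL y (1 : ℂ) = G.counit y • (1 : ℂ) := rfl
      rw [h2] at h1
      rw [BTensor.lift_tmul, sliceR_tmul, h1]
      simp only [map_smul, BLin.smul_apply]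
      rfl
    have key' : ∀ h, π (tmul h 1) = G.counit h • π (tmul h₀ 1) := by
      intro h
      -- For this `z` one has `μ(z) = (ε ⊗ id)(h₀ ⊗ h) = h` and `(id ⊗ ε)(z) = (id ⊗ ε)(h₀ ⊗ h) =
      -- ε(h) h₀`, and `key` identifies the classes of these two elements.
      obtain ⟨z, hz⟩ := G.γr_surjective (tmul h₀ h)
      have h1 := key z
      rw [← counit_γr, ← sliceR_counit_γr, hz, sliceL_tmul, sliceR_tmul, hh₀, one_smul] at h1
      rw [h1]
      simp only [map_smul, BLin.smul_apply]
    refine ⟨fun x a c => by simp only [hL, mulB_apply, counit_mul, mul_assoc],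
      (smulB _).flip (π (tmul h₀ 1)), fun q => ?_, fun c => ?_⟩
    · refine DFunLike.congr_fun (g := BLin.id _) (f := ((smulB _).flip (π (tmul h₀ 1))).comp
        (BalTensor.lift G.counitHom.actL _)) (BalTensor.hom_ext fun h c => ?_) q
      rw [BLin.comp_apply, BalTensor.lift_mk, BTensor.lift_tmul, hL]
      change (G.counit h * c) • π (tmul h₀ 1) = π (tmul h c)
      rw [mul_comm, mul_smul, ← key', ← map_smul, ← map_smul, smul_eq_mul, mul_one]
    · change BalTensor.lift _ _ (c • π (tmul h₀ 1)) = c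
      rw [map_smul, BalTensor.lift_mk, BTensor.lift_tmul, hL, hh₀]
      simp
  · let π := BalTensor.mk G.counitHom.actR (mulB H)
    have key : ∀ z : BTensor H H, π (tmul 1 (μ H z)) = π (tmul 1 (sliceL G.counit z)) := by
      refine BTensor.ind (by fun_prop) (by fun_prop) fun x y => ?_
      have h1 := BalTensor.mk_rel G.counitHom.actR (mulB H) 1 x y
      have h2 : G.counitHom.actR (1 : ℂ) x = G.counit x • (1 : ℂ) := mul_comm _ _
      rw [h2] at h1
      rw [BTensor.lift_tmul, sliceL_tmul, ← h1]
      simp only [map_smul, BLin.smul_apply]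
      rfl
    have key' : ∀ h, π (tmul 1 h) = G.counit h • π (tmul 1 h₀) := by
      intro h
      obtain ⟨z, hz⟩ := G.ρl_surjective (tmul h h₀)
      have h1 := key z
      rw [← counit_ρl, ← sliceL_counit_ρl, hz, sliceL_tmul, sliceR_tmul, hh₀, one_smul] at h1
      rw [h1]
      simp only [map_smul]
    refine ⟨fun x a c => by simp only [hR, mulB_apply, counit_mul, mul_assoc],
      (smulB _).flip (π (tmul 1 h₀)), fun q => ?_, fun c => ?_⟩
    · refine DFunLike.congr_fun (g := BLin.id _) (f := ((smulB _).flip (π (tmul 1 h₀))).comp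
        (BalTensor.lift G.counitHom.actR _)) (BalTensor.hom_ext fun c h => ?_) q
      rw [BLin.comp_apply, BalTensor.lift_mk, BTensor.lift_tmul, hR]
      change (c * G.counit h) • π (tmul 1 h₀) = π (tmul c h)
      rw [mul_smul, ← key', ← map_smul, smul_tmul', smul_eq_mul, mul_one]
    · change BalTensor.lift _ _ (c • π (tmul 1 h₀)) = c
      rw [map_smul, BalTensor.lift_mk, BTensor.lift_tmul, hR, hh₀]
      simp

end Counit

end QuantumGroup

/-! ### Construction of the antipode -/

/-- Lets a map act on the first leg before the last leg is integrated out, so that a Galois map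
applied to a slice becomes a slice of an element of the triple tensor product. -/
theorem apply_sliceR {U V W : Type*} [AddCommGroup U] [Module ℂ U] [Bornology U]
    [BornologicalSpace U] [AddCommGroup V] [Module ℂ V] [Bornology V] [BornologicalSpace V]
    [AddCommGroup W] [Module ℂ W] [Bornology W] [BornologicalSpace W] {X : Type*}
    [AddCommGroup X] [Module ℂ X] [Bornology X] [BornologicalSpace X]
    (ω : BLin W ℂ) (F : BLin U (BTensor V X)) (z : BTensor U W) :
    F (sliceR ω z) = BTensor.map (BLin.id V) (sliceR ω)
      (BTensor.assoc (BTensor.map F (BLin.id W) z)) := by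
  revert z
  refine BTensor.ind (by fun_prop) (by fun_prop) fun u v => ?_
  rw [BTensor.map_tmul, sliceR_tmul, map_smul, BLin.id_apply]
  generalize F u = w
  revert w
  exact BTensor.ind (by fun_prop) (by fun_prop) fun u v => by simp

theorem slice_comm {V W : Type*} [AddCommGroup V] [Module ℂ V] [Bornology V]
    [BornologicalSpace V] [AddCommGroup W] [Module ℂ W] [Bornology W] [BornologicalSpace W]
    (ψ : BLin V ℂ) (ω : BLin W ℂ) (z : BTensor V W) : ψ (sliceR ω z) = ω (sliceL ψ z) := by
  revert z
  exact BTensor.ind (by fun_prop) (by fun_prop) fun u v => by simp [mul_comm]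

theorem AntiAut.eq_of_map_eq {A : Type*} [NonUnitalRing A] [Module ℂ A] [Bornology A]
    [BornologicalAlgebra A] {σ τ : AntiAut A} (h : σ.map = τ.map) (h' : σ.inv = τ.inv) :
    σ = τ := by
  cases σ
  cases τ
  cases h
  cases h'
  rfl

namespace QuantumGroup

variable {H : Type*} [NonUnitalRing H] [Module ℂ H] [Bornology H] [BornologicalAlgebra H]
  (G : QuantumGroup H)

/-- The linear map underlying the antipode. -/
def antipodeMap : BLin H H :=
  -- Forced by `S((id ⊗ φ)γr z) = (id ⊗ φ)ρr z`: take `z = γr⁻¹(f ⊗ k)` with `φ(k) = 1`. That the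
  -- relation holds for every `z` is `antipodeMap_slice`.
  (sliceR G.φ).comp (G.ρr.comp (G.γrInv.comp (tmul.flip G.unitMass)))

/-- The linear map underlying the inverse of the antipode. -/
def antipodeInv : BLin H H :=
  (sliceR G.φ).comp (G.γr.comp (G.ρrInv.comp (tmul.flip G.unitMass)))

/-- For `y = p ⊗ q` both sides are `(id ⊗ id ⊗ φ)(Δ²(a)(1 ⊗ p ⊗ q))`. Reading it backwards gives
`γr⁻¹` of such slices explicitly. -/
theorem γr_slice (a : H) (y : BTensor H H) :
    G.γr (BTensor.swap (BTensor.map (BLin.id H) ((sliceR G.φ).comp (G.γr.comp (tmul a))) y)) =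
      BTensor.map (BLin.id H) (sliceR G.φ) (BTensor.assoc (G.γr₂ a y)) := by
  revert y
  refine BTensor.ind (by fun_prop) (by fun_prop) fun p q => ?_
  rw [γr₂_tmul, ← apply_sliceR]
  simp

theorem ρr_slice (a : H) (y : BTensor H H) :
    G.ρr (BTensor.map (BLin.id H) ((sliceR G.φ).comp (G.ρr.comp (tmul.flip a))) y) =
      BTensor.map (BLin.id H) (sliceR G.φ) (BTensor.assoc (G.ρr₂ a y)) := by
  revert y
  refine BTensor.ind (by fun_prop) (by fun_prop) fun p q => ?_
  rw [ρr₂_tmul, ← apply_sliceR]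
  simp

/-- Reflects `ε((id ⊗ φ)(Δ(a)(1 ⊗ q))) = φ(a q)`. -/
theorem counit_slice_γr (a : H) (y : BTensor H H) :
    sliceL G.counit (BTensor.swap
      (BTensor.map (BLin.id H) ((sliceR G.φ).comp (G.γr.comp (tmul a))) y)) =
      sliceR G.φ ((Mult.tensor 1 (Mult.ι a)).L y) := by
  revert y
  refine BTensor.ind (by fun_prop) (by fun_prop) fun p q => ?_
  simp [slice_comm, counit_γr]

theorem counit_slice_ρr (a : H) (y : BTensor H H) :
    sliceR G.counit
      (BTensor.map (BLin.id H) ((sliceR G.φ).comp (G.ρr.comp (tmul.flip a))) y) =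
      sliceR G.φ ((Mult.tensor 1 (Mult.ι a)).R y) := by
  revert y
  refine BTensor.ind (by fun_prop) (by fun_prop) fun p q => ?_
  simp [slice_comm, counit_ρr]

/-- Take `z = a ⊗ b` and `y = Δ(b)(c ⊗ 1)` in `γr_slice`. By left invariance the right side becomes
`(id ⊗ φ)(Δ(a)(1 ⊗ b)) ⊗ c`, so its preimage under `γr` is known, and `counit_slice_γr` evaluates `ε
⊗ id` on it as `(id ⊗ φ)((1 ⊗ a)Δ(b)(c ⊗ 1))`. -/
theorem counit_γrInv_slice (z : BTensor H H) (c : H) :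
    sliceL G.counit (G.γrInv (tmul (sliceR G.φ (G.γr z)) c)) = sliceR G.φ (G.ρr z) * c := by
  revert z
  refine BTensor.ind (by fun_prop) (by fun_prop) fun a b => ?_
  have h1 := G.γr_slice a (G.γl (tmul b c))
  rw [assoc_γr₂_γl] at h1
  have h2 : ∀ z : BTensor H H, BTensor.map (BLin.id H) (sliceR G.φ)
      (BTensor.map (BLin.id H) (G.γl.comp (tmul.flip c)) z) = tmul (sliceR G.φ z) c :=
    BTensor.ind (by fun_prop) (by fun_prop) fun u v => by simp [G.invariant_L]
  rw [← h2, ← h1, γrInv_γr, counit_slice_γr, tensor_L_γl, sliceR_tensor_one_R, Mult.ι_R]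

theorem counit_ρrInv_slice (z : BTensor H H) (c : H) :
    sliceR G.counit (G.ρrInv (tmul (sliceR G.φ (G.ρr z)) c)) = c * sliceR G.φ (G.γr z) := by
  revert z
  refine BTensor.ind (by fun_prop) (by fun_prop) fun b a => ?_
  have h1 := G.ρr_slice a (G.ρl (tmul c b))
  rw [assoc_ρr₂_ρl] at h1
  have h2 : ∀ z : BTensor H H, BTensor.map (BLin.id H) (sliceR G.φ)
      (BTensor.map (BLin.id H) (G.ρl.comp (tmul c)) z) = tmul (sliceR G.φ z) c :=
    BTensor.ind (by fun_prop) (by fun_prop) fun u v => by simp [G.invariant_R]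
  rw [← h2, ← h1, ρrInv_ρr, counit_slice_ρr, ← tensor_L_γr, sliceR_tensor_one_L, Mult.ι_L]

/-- A description of `S` free of `φ` and of `unitMass`; the antipode identities,
antimultiplicativity and uniqueness all rest on it. -/
theorem antipodeMap_mul_right (f c : H) :
    G.antipodeMap f * c = sliceL G.counit (G.γrInv (tmul f c)) := by
  have h := G.counit_γrInv_slice (G.γrInv (tmul f G.unitMass)) c
  rw [γr_γrInv, sliceR_tmul, φ_unitMass, one_smul] at h
  exact h.symm

theorem mul_antipodeInv (f c : H) :
    c * G.antipodeInv f = sliceR G.counit (G.ρrInv (tmul f c)) := by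
  have h := G.counit_ρrInv_slice (G.ρrInv (tmul f G.unitMass)) c
  rw [ρr_ρrInv, sliceR_tmul, φ_unitMass, one_smul] at h
  exact h.symm

/-- Strong left invariance: `S((id ⊗ φ)(Δ(a)(1 ⊗ b))) = (id ⊗ φ)((1 ⊗ a)Δ(b))`. Together with its
mirror image `antipodeInv_slice` it makes the two maps inverse to each other. -/
theorem antipodeMap_slice (z : BTensor H H) :
    G.antipodeMap (sliceR G.φ (G.γr z)) = sliceR G.φ (G.ρr z) :=
  G.isNondegenerate.eq fun c => by rw [antipodeMap_mul_right, counit_γrInv_slice]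

theorem antipodeInv_slice (z : BTensor H H) :
    G.antipodeInv (sliceR G.φ (G.ρr z)) = sliceR G.φ (G.γr z) :=
  G.eq_of_mul_left fun c => by rw [mul_antipodeInv, counit_ρrInv_slice]

theorem antipodeInv_antipodeMap (f : H) : G.antipodeInv (G.antipodeMap f) = f := by
  refine (G.antipodeInv_slice (G.γrInv (tmul f G.unitMass))).trans ?_
  rw [γr_γrInv, sliceR_tmul, φ_unitMass, one_smul]

theorem antipodeMap_antipodeInv (f : H) : G.antipodeMap (G.antipodeInv f) = f := by
  refine (G.antipodeMap_slice (G.ρrInv (tmul f G.unitMass))).trans ?_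
  rw [ρr_ρrInv, sliceR_tmul, φ_unitMass, one_smul]

theorem antipodeMap_left (z : BTensor H H) :
    μ H (BTensor.map G.antipodeMap (BLin.id H) (G.γr z)) = sliceL G.counit z := by
  have h : ∀ w : BTensor H H, μ H (BTensor.map G.antipodeMap (BLin.id H) w) =
      sliceL G.counit (G.γrInv w) :=
    BTensor.ind (by fun_prop) (by fun_prop) fun u v => by simp [antipodeMap_mul_right]
  rw [h, γrInv_γr]

/-- Multiply by `b` and replace `S(v) b` by `(ε ⊗ id)γr⁻¹(v ⊗ b)`. Writing `a ⊗ b = γr z` and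
commuting `ρl` with `γr` cancels `γr⁻¹`, and the counit identities leave `p μ(z) = p ε(a) b`. -/
theorem antipodeMap_right (z : BTensor H H) :
    μ H (BTensor.map (BLin.id H) G.antipodeMap (G.ρl z)) = sliceR G.counit z := by
  revert z
  refine BTensor.ind (by fun_prop) (by fun_prop) fun p a => G.isNondegenerate.eq fun b => ?_
  have h1 : ∀ w : BTensor H H, μ H (BTensor.map (BLin.id H) G.antipodeMap w) * b =
      μ H (BTensor.map (BLin.id H) ((sliceL G.counit).comp G.γrInv)
        (BTensor.assoc (tmul w b))) :=
    BTensor.ind (by fun_prop) (by fun_prop) fun u v => by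
      simp [← antipodeMap_mul_right, mul_assoc]
  obtain ⟨z, hz⟩ := G.γr_surjective (tmul a b)
  have h2 := G.ρl_γr_comm p z
  rw [hz, BTensor.map_tmul, BLin.id_apply, BLin.comp_apply] at h2
  have h3 : ∀ w : BTensor H (BTensor H H), BTensor.map (BLin.id H)
      ((sliceL G.counit).comp G.γrInv) (BTensor.map (BLin.id H) G.γr w) =
        BTensor.map (BLin.id H) (sliceL G.counit) w :=
    BTensor.ind (by fun_prop) (by fun_prop) fun u v => by simp
  have h4 : ∀ (w : BTensor H H) (b' : H), μ H (BTensor.map (BLin.id H) (sliceL G.counit)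
      (BTensor.assoc (tmul w b'))) = sliceR G.counit w * b' := by
    intro w b'
    revert w
    exact BTensor.ind (by fun_prop) (by fun_prop) fun u v => by simp [smul_mul_assoc]
  have h5 : ∀ z : BTensor H H, μ H (BTensor.map (BLin.id H) (sliceL G.counit)
      (BTensor.assoc (BTensor.map (G.ρl.comp (tmul p)) (BLin.id H) z))) = p * μ H z :=
    BTensor.ind (by fun_prop) (by fun_prop) fun u v => by simp [h4, counit_ρl, mul_assoc]
  rw [h1, h2, h3, h5, ← counit_γr, hz]
  simp [smul_mul_assoc, mul_smul_comm]

theorem antipodeMap_Δ (a : H) (w : BTensor H H) :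
    μ H (BTensor.map G.antipodeMap (BLin.id H) ((G.Δ a).L w)) =
      G.counit a • μ H (BTensor.map G.antipodeMap (BLin.id H) w) := by
  obtain ⟨z, rfl⟩ := G.γr_surjective w
  revert z
  refine BTensor.ind (by fun_prop) (by fun_prop) fun b c => ?_
  rw [Δ_L_γr, antipodeMap_left, antipodeMap_left, sliceL_tmul, sliceL_tmul, counit_mul, mul_smul]

/-- On `w = Δ(a)(1 ⊗ q)` the element `w (p ⊗ 1)` is `Δ(a)(p ⊗ q)`, and `μ(S ⊗ id)` turns the factor
`Δ(a)` into `ε(a)`. Hence `p` comes out as `S(p)` on the left, for every `w` since `γr` is onto, in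
particular for `w = x ⊗ y`. -/
theorem antipodeMap_mul (x p : H) :
    G.antipodeMap (x * p) = G.antipodeMap p * G.antipodeMap x := by
  have h : ∀ w : BTensor H H, μ H (BTensor.map G.antipodeMap (BLin.id H)
      ((Mult.tensor (Mult.ι p) 1).R w)) =
        G.antipodeMap p * μ H (BTensor.map G.antipodeMap (BLin.id H) w) := by
    intro w
    obtain ⟨z, rfl⟩ := G.γr_surjective w
    revert z
    refine BTensor.ind (by fun_prop) (by fun_prop) fun a q => ?_
    rw [← Δ_L_tmul, antipodeMap_Δ, antipodeMap_left]
    simp [mul_smul_comm]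
  refine G.isNondegenerate.eq fun y => ?_
  have := h (tmul x y)
  simpa [mul_assoc] using this

/-- The antipode. -/
def antipode : AntiAut H where
  map := G.antipodeMap
  inv := G.antipodeInv
  inv_map := G.antipodeInv_antipodeMap
  map_inv := G.antipodeMap_antipodeInv
  map_mul := G.antipodeMap_mul

/-- For `y = ∑ g ⊗ h`, the map `q ↦ ∑ φ(q h) g`. -/
def sliceMul (y : BTensor H H) : BLin H H :=
  (sliceR G.φ).comp (((BTensor.mapB (BLin.id H)).comp (mulB H)).flip y)

theorem sliceMul_apply (y : BTensor H H) (q : H) :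
    G.sliceMul y q = sliceR G.φ ((Mult.tensor 1 (Mult.ι q)).L y) := rfl

@[fun_prop]
theorem isBLin_sliceMul : IsBLin G.sliceMul := by
  unfold sliceMul
  fun_prop

/-- With `f = (id ⊗ φ)(Δ(a)(1 ⊗ b))` and `v = x ⊗ y`, both sides equal `(id ⊗ P)(Δ(b)(S(y) ⊗ 1))`,
where `P(h) = (id ⊗ φ)((1 ⊗ a)Δ(h)) S(x)`. Strong left invariance is used twice on the right side,
once for each leg of `Δ(f)`. -/
theorem Δ_antipodeMap_L (f : H) (v : BTensor H H) :
    (G.Δ (G.antipodeMap f)).L (G.antipode.tensorSwap.map v) =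
      G.antipode.tensorSwap.map ((G.Δ f).R v) := by
  have hT : ∀ v, G.antipode.tensorSwap.map v =
      BTensor.map G.antipodeMap G.antipodeMap (BTensor.swap v) := fun _ => rfl
  have hf : f = sliceR G.φ (G.γr (G.γrInv (tmul f G.unitMass))) := by simp
  rw [hf]
  generalize G.γrInv (tmul f G.unitMass) = z
  rw [antipodeMap_slice]
  simp only [hT]
  revert z
  refine BTensor.ind (by fun_prop) (by fun_prop) fun a b => ?_
  revert v
  refine BTensor.ind (by fun_prop) (by fun_prop) fun x y => ?_
  let N : BLin H H := (sliceR G.φ).comp (G.γr.comp (tmul.flip b))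
  have hN : ∀ q, N q = sliceR G.φ (G.γr (tmul q b)) := fun _ => rfl
  -- Coassociativity: applying `Δ` to the slice `f` amounts to slicing the second leg of `Δ(a)`
  -- again, by `N`.
  have e1 : G.ρl (tmul x (sliceR G.φ (G.γr (tmul a b)))) =
      BTensor.map (BLin.id H) N (G.ρl (tmul x a)) := by
    have h := apply_sliceR G.φ (G.ρl.comp (tmul x)) (G.γr (tmul a b))
    rw [assoc_ρl_γr] at h
    refine h.trans ?_
    generalize G.ρl (tmul x a) = w
    revert w
    exact BTensor.ind (by fun_prop) (by fun_prop) fun p q => by simp [N]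
  -- First use of strong left invariance: `S(y N(q)) = S(N(q)) S(y) = (id ⊗ φ)((1 ⊗ q)Δ(b)(S(y) ⊗
  -- 1))`.
  have e2 : ∀ w : BTensor H H, BTensor.map G.antipodeMap G.antipodeMap (BTensor.swap
      ((Mult.tensor 1 (Mult.ι y)).L (BTensor.map (BLin.id H) N w))) =
      BTensor.swap (BTensor.map G.antipodeMap
        (G.sliceMul (G.γl (tmul b (G.antipodeMap y)))) w) := by
    refine BTensor.ind (by fun_prop) (by fun_prop) fun p q => ?_
    simp only [BTensor.map_tmul, BTensor.swap_tmul, Mult.tensor_L, Mult.one_L, Mult.ι_L,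
      BLin.id_apply, antipodeMap_mul, hN, antipodeMap_slice, sliceMul_apply, tensor_L_γl,
      sliceR_tensor_one_R, Mult.ι_R]
  let P : BLin H H := ((mulB H).flip (G.antipodeMap x)).comp
    ((sliceR G.φ).comp (G.ρr.comp (tmul a)))
  -- Second use, on the other leg: for `t = g ⊗ h` the integral runs over `(x ⊗ 1)Δ(a)(1 ⊗ h)`, and
  -- `S` sends the resulting `x (id ⊗ φ)(Δ(a)(1 ⊗ h))` to `P(h)`.
  have e3 : ∀ t : BTensor H H, BTensor.swap (BTensor.map G.antipodeMap (G.sliceMul t)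
      (G.ρl (tmul x a))) = BTensor.map (BLin.id H) P t := by
    refine BTensor.ind (by fun_prop) (by fun_prop) fun g h => ?_
    have h1 : ∀ w, BTensor.swap (BTensor.map G.antipodeMap (G.sliceMul (tmul g h)) w) =
        tmul g (G.antipodeMap (sliceR G.φ ((Mult.tensor 1 (Mult.ι h)).R w))) :=
      BTensor.ind (by fun_prop) (by fun_prop) fun p q => by simp [sliceMul_apply]
    rw [h1, ← tensor_L_γr, sliceR_tensor_one_L, Mult.ι_L, antipodeMap_mul, antipodeMap_slice]
    simp [P]
  rw [Δ_R_tmul, e1, e2, e3, BTensor.swap_tmul, BTensor.map_tmul, Δ_L_tmul']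
  -- The left side: `S(f) = (id ⊗ φ)((1 ⊗ a)Δ(b))`, and `assoc_γl_ρr` moves `Δ` inside this slice.
  have h := apply_sliceR G.φ (G.γl.comp (tmul.flip (G.antipodeMap y))) (G.ρr (tmul a b))
  rw [assoc_γl_ρr, BLin.comp_apply, BLin.flip_apply] at h
  rw [h]
  generalize G.γl (tmul b (G.antipodeMap y)) = t
  revert t
  exact BTensor.ind (by fun_prop) (by fun_prop) fun p q => by simp [P]

theorem Δ_antipode (f : H) :
    G.Δ (G.antipode.map f) = G.antipode.tensorSwap.ext (G.Δ f) :=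
  G.isNondegenerate₂.mult_ext fun x => by
    have h := G.Δ_antipodeMap_L f (G.antipode.tensorSwap.inv x)
    rw [AntiAut.map_inv] at h
    exact h

/-- The counit and the antipode of a quantum group. -/
def counitAntipode : CounitAntipode G where
  ε := G.counit
  ε_mul := G.counit_mul
  ε_essential := G.counit_essential
  ε_left_L := fun f g => by rw [counit_γr]; simp
  ε_left_R := G.counit_ρr
  ε_right_L := G.counit_γl
  ε_right_R := fun f g => by rw [counit_ρl]; simp
  S := G.antipode
  S_comul := G.Δ_antipode
  S_left := G.antipodeMap_left
  S_right := G.antipodeMap_right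

/-- Apply `ε` to `μ(S ⊗ id)γr = ε ⊗ id`. Since `ε(μ(z)) = (ε ⊗ ε)(z)` and `μ = (ε ⊗ id)γr`, this
gives `ε(S(f)) ε(k) = ε(f) ε(k)`. -/
theorem counit_antipodeMap (f : H) : G.counit (G.antipodeMap f) = G.counit f := by
  have h : ∀ w : BTensor H H, G.counit (μ H (BTensor.map G.antipodeMap (BLin.id H) w)) =
      G.counit (sliceL G.counit w) := by
    intro w
    obtain ⟨z, rfl⟩ := G.γr_surjective w
    rw [antipodeMap_left, counit_γr]
    revert z
    exact BTensor.ind (by fun_prop) (by fun_prop) fun u v => by simp [counit_mul]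
  obtain ⟨k, hk⟩ := G.exists_counit_eq_one
  have := h (tmul f k)
  simpa [counit_mul, hk] using this

theorem counitAntipode_unique (d : CounitAntipode G) : d = G.counitAntipode := by
  have hε : d.ε = G.counit := by
    ext f
    -- On the range of `γr`, which is everything, any counit is prescribed by `(ε ⊗ id)(Δ(f)(1 ⊗ g))
    -- = fg`.
    have h : ∀ z : BTensor H H, sliceL d.ε z = sliceL G.counit z := by
      intro z
      obtain ⟨z, rfl⟩ := G.γr_surjective z
      rw [counit_γr]
      revert z
      exact BTensor.ind (by fun_prop) (by fun_prop) fun u v => by simp [d.ε_left_L]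
    simpa using congrArg G.φ (h (tmul f G.unitMass))
  have hS : d.S.map = G.antipodeMap := by
    ext f
    refine G.isNondegenerate.eq fun c => ?_
    have h := d.S_left (G.γrInv (tmul f c))
    rw [hε, ← antipodeMap_left, γr_γrInv] at h
    simpa using h
  have hS' : d.S = G.antipode := by
    have hinv : d.S.inv = G.antipodeInv := by
      ext f
      have h := d.S.inv_map (G.antipodeInv f)
      rwa [hS, antipodeMap_antipodeInv] at h
    exact AntiAut.eq_of_map_eq hS hinv
  cases d
  subst hε hS'
  rfl

/-! ### Compatibility with morphisms -/

section Morphisms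

variable {K : Type*} [NonUnitalRing K] [Module ℂ K] [Bornology K] [BornologicalAlgebra K]
  (G' : QuantumGroup K) (α : EssHom H K)

/-- The value of the counit on a multiplier. -/
def counitM (m : Mult H) : ℂ := (G.counitAntipode.counit.ext m).L 1

theorem counitM_mul (m : Mult H) (x : H) : G.counitM m * G.counit x = G.counit (m.L x) := by
  have h := G.counitAntipode.counit.ext_L m x 1
  have h1 : ∀ y, (G.counitAntipode.counit y).L 1 = G.counit y • (1 : ℂ) := fun y => rfl
  rw [h1, h1, map_smul, smul_eq_mul, smul_eq_mul, mul_one, mul_comm] at h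
  exact h

/-- The counit identity for multipliers, needed because `α(f)` is not an element of `K`. It reduces
to elements by writing `w` as `Δ(x)k`, which is possible up to linear combinations and limits since
`Δ` is essential. -/
theorem sliceL_counit_ext (m : Mult H) (w : BTensor H H) :
    sliceL G.counit ((G.Δ.ext m).L w) = m.L (sliceL G.counit w) := by
  have h1 : ∀ x (w : BTensor H H),
      sliceL G.counit ((G.Δ x).L w) = x * sliceL G.counit w := by
    intro x
    refine BTensor.ind (by fun_prop) (by fun_prop) fun p q => ?_
    rw [Δ_L_tmul, sliceL_character_R G.counit_mul, counit_γr]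
    simp [mul_smul_comm]
  refine G.Δ.essential.left_ext (S := (sliceL G.counit).comp (G.Δ.ext m).L)
    (T := m.L.comp (sliceL G.counit)) (fun x k => ?_) w
  rw [BLin.comp_apply, BLin.comp_apply, EssHom.ext_L, h1, h1, Mult.L_mul]

theorem antipodeMap_ext (m : Mult H) (w : BTensor H H) :
    μ H (BTensor.map G.antipodeMap (BLin.id H) ((G.Δ.ext m).L w)) =
      G.counitM m • μ H (BTensor.map G.antipodeMap (BLin.id H) w) := by
  refine G.Δ.essential.left_ext
    (S := ((μ H).comp (BTensor.map G.antipodeMap (BLin.id H))).comp (G.Δ.ext m).L)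
    (T := G.counitM m • ((μ H).comp (BTensor.map G.antipodeMap (BLin.id H)))) (fun x k => ?_) w
  simp only [BLin.comp_apply, BLin.smul_apply]
  rw [EssHom.ext_L, antipodeMap_Δ, antipodeMap_Δ, ← counitM_mul, mul_smul]

/-- The only place where `(α ⊗ α)Δ = Δα` is used. -/
theorem tensor_γr_L (hα : IsMorphism G G' α) (f g : H) (k l : K) :
    ((α.tensor G.essential G.essential α) (G.γr (tmul f g))).L (tmul k l) =
      (G'.Δ.ext (α f)).L (tmul k ((α g).L l)) := by
  rw [← EssHom.ext_ι, G.γr_tmul, EssHom.ext_mul, EssHom.tensor_ext, hα, EssHom.ext_one,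
    EssHom.ext_ι, Mult.mul_L, Mult.tensor_L, Mult.one_L]

theorem exists_L_ne_zero [Nontrivial K] : ∃ g l, (α g).L l ≠ 0 := by
  by_contra! h
  obtain ⟨x, hx⟩ := exists_ne (0 : K)
  exact hx (eq_zero_of_surjective α.essential.1.surjective (BLin.id K) h x)

/-- With `ε_K(k) = 1` and `η(u) = ε_K(α(u) k)`, applying `ε_K ⊗ id` to `(α ⊗ α)(z)(k ⊗ l)` gives
`α((η ⊗ id) z) l`. For `z = Δ(f)(1 ⊗ g)` the counit of `K` evaluates the same expression as `α(fg) l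
= α((ε_H ⊗ id) z) l`. Surjectivity of `γr` then allows `z = f ⊗ g`, and a nonzero `α(g) l` can be
cancelled. -/
theorem counitM_morphism (hα : IsMorphism G G' α) (f : H) :
    G'.counitM (α f) = G.counit f := by
  obtain ⟨k, hk⟩ := G'.exists_counit_eq_one
  have := G'.nontrivial
  obtain ⟨g, l, hgl⟩ := exists_L_ne_zero α
  let η : BLin H ℂ := G'.counit.comp (α.actL.flip k)
  have h1 : ∀ z : BTensor H H, sliceL G'.counit
      (((α.tensor G.essential G.essential α) z).L (tmul k l)) = (α (sliceL η z)).L l :=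
    BTensor.ind (by fun_prop) (by fun_prop) fun u v => by
      simp [EssHom.tensor_tmul, η]
  have h2 : ∀ z : BTensor H H, (α (sliceL η z)).L l = (α (sliceL G.counit z)).L l := by
    intro w
    obtain ⟨z, rfl⟩ := G.γr_surjective w
    revert z
    refine BTensor.ind (by fun_prop) (by fun_prop) fun f g => ?_
    rw [← h1, tensor_γr_L G G' α hα, sliceL_counit_ext, counit_γr, sliceL_tmul, hk, one_smul,
      BTensor.lift_tmul, mulB_apply, α.map_mul, Mult.mul_L]
  have h3 : η f • (α g).L l = G.counit f • (α g).L l := by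
    simpa using h2 (tmul f g)
  have h4 : G'.counitM (α f) = η f := by
    have := G'.counitM_mul (α f) k
    rwa [hk, mul_one] at this
  rw [h4]
  by_contra hne
  have h5 : (η f - G.counit f) • (α g).L l = 0 := by rw [sub_smul, h3, sub_self]
  apply hgl
  have h6 : η f - G.counit f ≠ 0 := sub_ne_zero.2 hne
  rw [← one_smul ℂ ((α g).L l), ← inv_mul_cancel₀ h6, mul_smul, h5, smul_zero]

/-- The same device with `μ(S ⊗ id)` in place of `ε ⊗ id`: for `z = Δ(f)(1 ⊗ g)` both sides of `h`
are `ε_H(f) S_K(k) α(g) l`, by `counitM_morphism`. At `z = f ⊗ g` the identity reads `S_K(α(f)k)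
α(g) l = S_K(k) α(S_H(f)) α(g) l`, and `α(g) l` is cancelled because `α` is essential. -/
theorem antipodeMap_morphism (hα : IsMorphism G G' α) (f : H) (k : K) :
    G'.antipodeMap ((α f).L k) = (α (G.antipodeMap f)).R (G'.antipodeMap k) := by
  have h : ∀ (l : K) (z : BTensor H H), μ K (BTensor.map G'.antipodeMap (BLin.id K)
      (((α.tensor G.essential G.essential α) z).L (tmul k l))) =
      G'.antipodeMap k * (α (μ H (BTensor.map G.antipodeMap (BLin.id H) z))).L l := by
    intro l w
    obtain ⟨z, rfl⟩ := G.γr_surjective w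
    revert z
    refine BTensor.ind (by fun_prop) (by fun_prop) fun f g => ?_
    rw [tensor_γr_L G G' α hα, antipodeMap_ext, counitM_morphism G G' α hα, antipodeMap_left]
    simp [mul_smul_comm]
  refine G'.isNondegenerate.eq fun l => ?_
  rw [← Mult.compat]
  refine α.essential.left_ext (S := mulB K (G'.antipodeMap ((α f).L k)))
    (T := (mulB K (G'.antipodeMap k)).comp (α (G.antipodeMap f)).L) (fun g l => ?_) l
  have := h l (tmul f g)
  simpa [EssHom.tensor_tmul, α.map_mul] using this

end Morphisms

end QuantumGroup

end Born

end

theorem mainTheorem6 {H : Type*} [NonUnitalRing H] [Module ℂ H] [Bornology H]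
    [BornologicalAlgebra H] {K : Type*} [NonUnitalRing K] [Module ℂ K] [Bornology K]
    [BornologicalAlgebra K] (G : QuantumGroup H) (G' : QuantumGroup K)
    (α : EssHom H K) (hα : IsMorphism G G' α) :
    ∃ (c : CounitAntipode G) (c' : CounitAntipode G'),
      (∀ d : CounitAntipode G, d = c) ∧ (∀ d : CounitAntipode G', d = c') ∧
      (∀ f, c'.counit.ext (α f) = c.counit f) ∧
      (∀ f, α (c.S.map f) = c'.S.ext (α f)) ∧
      (∀ f, c.ε (c.S.map f) = c.ε f) := by
  refine ⟨G.counitAntipode, G'.counitAntipode, G.counitAntipode_unique,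
    G'.counitAntipode_unique, fun f => ?_, fun f => ?_, G.counit_antipodeMap⟩
  · have hC : IsNondegenerate ℂ := fun x h => by simpa using h 1
    -- A multiplier of `ℂ` is determined by its value at `1`, which is `counitM`.
    refine hC.mult_ext fun x => ?_
    have h1 := (G'.counitAntipode.counit.ext (α f)).L_mul 1 x
    rw [one_mul] at h1
    rw [h1]
    exact congrArg (· * x) (QuantumGroup.counitM_morphism G G' α hα f)
  -- Right parts are compared since `antipodeMap_morphism` describes `S_K(k) α(S_H(f))`; it is
  -- applied to `k = S_K⁻¹(x)`.
  · refine G'.mult_ext_of_R fun x => ?_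
    have h := QuantumGroup.antipodeMap_morphism G G' α hα f (G'.antipodeInv x)
    rw [QuantumGroup.antipodeMap_antipodeInv] at h
    exact h.symm
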